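/- Let $\mathcal C$ be a binary linear block code of length $n\ge 1$ and rate $R=\dim(\mathcal C)/n$, let $H$ be a full-rank parity-check matrix of $\mathcal C$ (with $n(1-R)$ linearly independent rows), and let $\mathcal G$ be the bipartite Tanner graph of $H$: it has $n$ variable nodes, one parity-check node per row of $H$, and an edge for every non-zero entry of $H$. Let $a_{\mathrm R}$ be the average degree of the parity-check nodes, and let $|E|$, $|V|$, $C(\mathcal G)$ be the numbers of edges, vertices and connected components of $\mathcal G$. The cycle rank $\beta(\mathcal G)$ is the maximal number of edges that can be removed from $\mathcal G$ without increasing the number of components; removing such a maximal set of edges leaves a full spanning forest $\mathcal F$. The fundamental system of cycles of $\mathcal G$ associated with $\mathcal F$ is the set of all cycles of the graphs $\mathcal F\cup\{e\}$, where $e$ runs over the edges of $\mathcal G$ outside $\mathcal F$. Let $N$ be its cardinality. Write $h_2$ for the binary entropy function to the base 2 and $h_2^{-1}:[0,1]\to[0,\frac12]$ for its inverse. 1. For every full spanning forest $\mathcal F$ of $\mathcal G$, $N=\beta(\mathcal G)=|E|-|V|+C(\mathcal G)$ and $N>n\bigl[(1-R)(a_{\mathrm R}-1)-1\bigr]$.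 2. Suppose a uniformly chosen codeword is transmitted over a memoryless binary-input output-symmetric channel of capacity $C\in(0,1)$ bits per channel use, let $\varepsilon\in(0,1)$ and $R\ge(1-\varepsilon)C$, and let $P_{\mathrm b}$ be the bit error probability (averaged over the $n$ code bits) under some decoding algorithm, with $h_2(P_{\mathrm b})\le 1-C$. Let $a$ be the conditional law of the log-likelihood ratio at the channel output given that the input is zero, and $g_1=\int_0^\infty a(l)(1+e^{-l})\tanh^2(l/2)\,dl$. Then the inequality $N>n[(1-R)(a_{\mathrm R}-1)-1]$ remains true when $a_{\mathrm R}$ is replaced by $$\frac{2\ln\left(\frac{1}{1-2h_2^{-1}\left(\frac{1-C-h_2(P_{\mathrm b})}{1-(1-\varepsilon)C}\right)}\right)}{\ln\left(\frac1{g_1}\right)}.$$ 3. If the channel is a binary erasure channel with erasure probability $p\in(0,1)$ (so $C=1-p$), $\varepsilon\in(0,1)$, $R\ge(1-\varepsilon)C$, and $P_{\mathrm b}$ is the bit erasure probability of the code (averaged over the $n$ code bits) under some decoding algorithm that declares each bit either decoded, in which case it is correct with probability one, or erased, then the inequality remains true when $a_{\mathrm R}$ is replaced by $$\frac{\ln\left(1+\frac{p-P_{\mathrm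 b}}{(1-p)\varepsilon+P_{\mathrm b}}\right)}{\ln\left(\frac1{1-p}\right)}.$$ 4. Consequently $N=\Omega\bigl(\ln\frac1\varepsilon\bigr)$ for vanishing $P_{\mathrm b}$, in the following sense. Fix a channel as in 2 and a constant $K>0$. There are constants $c,\delta>0$, depending only on the channel and $K$, such that for every $\varepsilon\in(0,\delta]$, every $n\ge1$, every code of length $n$ with $R\ge(1-\varepsilon)C$, every full-rank parity-check matrix of the code, every full spanning forest of its Tanner graph, and every decoding algorithm with $h_2(P_{\mathrm b})\le K\varepsilon$, one has $N\ge c\,n\ln\frac1\varepsilon\ge0$; in particular $N\ge c\ln\frac1\varepsilon$. For the binary erasure channel with $p\in(0,1)$, and decoding algorithms as in 3, the same holds under the condition $P_{\mathrm b}\le K\varepsilon$ in place of $h_2(P_{\mathrm b})\le K\varepsilon$. -/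

import Mathlib

open MeasureTheory ProbabilityTheory
open scoped ENNReal

/-! ### Graph theory -/

/-- The number of components `C(G)` of a graph. -/
noncomputable def numComponents {V : Type*} (G : SimpleGraph V) : ℕ :=
  Nat.card G.ConnectedComponent

/-- The cycle rank `β(G)`: the maximal number of edges which can be removed from the graph
without increasing its number of components (used for finite graphs only, where the set of
admissible numbers is bounded). -/
noncomputable def cycleRank {V : Type*} (G : SimpleGraph V) : ℕ :=
  sSup {k : ℕ | ∃ S ⊆ G.edgeSet, S.ncard = k ∧
    numComponents (G.deleteEdges S) ≤ numComponents G}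

/-- `F` is a full spanning forest of `G`: it is what is left of `G` (with all its vertices) after
removing `β(G)` edges without increasing the number of components. -/
def IsFullSpanningForest {V : Type*} (G F : SimpleGraph V) : Prop :=
  ∃ S ⊆ G.edgeSet, S.ncard = cycleRank G ∧
    numComponents (G.deleteEdges S) ≤ numComponents G ∧ F = G.deleteEdges S

/-- The fundamental system of cycles of `G` associated with `F`: all cycles of the graphs
`F ∪ {e}`, where `e` is an edge of `G` outside `F`. A cycle is represented by its set of edges. -/
def fundamentalSystem {V : Type*} (G F : SimpleGraph V) : Set (Set (Sym2 V)) :=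
  {D | ∃ e ∈ G.edgeSet \ F.edgeSet, ∃ (v : V) (w : (F ⊔ SimpleGraph.fromEdgeSet {e}).Walk v v),
    w.IsCycle ∧ D = {f | f ∈ w.edges}}

/-! ### Binary linear codes and Tanner graphs -/

/-- `H` is a full-rank parity-check matrix of the binary linear code `𝒞`. -/
structure IsFullRankParityCheck {n m : ℕ} (𝒞 : Submodule (ZMod 2) (Fin n → ZMod 2))
    (H : Matrix (Fin m) (Fin n) (ZMod 2)) : Prop where
  mem_iff : ∀ x, x ∈ 𝒞 ↔ H.mulVec x = 0
  fullRank : H.rank = m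

/-- The rate of a code: dimension over block length. -/
noncomputable def codeRate {n : ℕ} (𝒞 : Submodule (ZMod 2) (Fin n → ZMod 2)) : ℝ :=
  (Module.finrank (ZMod 2) 𝒞 : ℝ) / n

/-- The Tanner graph of `H`: variable nodes `Sum.inl i`, parity-check nodes `Sum.inr j`, and an
edge between them if the `i`-th symbol is involved in the `j`-th parity-check equation. -/
def tannerGraph {n m : ℕ} (H : Matrix (Fin m) (Fin n) (ZMod 2)) :
    SimpleGraph (Fin n ⊕ Fin m) :=
  SimpleGraph.fromRel fun u v => ∃ i j, u = Sum.inl i ∧ v = Sum.inr j ∧ H j i ≠ 0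

/-- The average right degree `a_R`: the average degree of the parity-check nodes. -/
noncomputable def avgRightDegree {n m : ℕ} (H : Matrix (Fin m) (Fin n) (ZMod 2)) : ℝ :=
  (∑ j : Fin m, (((tannerGraph H).neighborSet (Sum.inr j)).ncard : ℝ)) / m

/-! ### Binary entropy -/

/-- The binary entropy function to the base 2. -/
noncomputable def h₂ (x : ℝ) : ℝ := Real.binEntropy x / Real.log 2

/-- The inverse `[0,1] → [0,1/2]` of the binary entropy function. -/
noncomputable def h₂Inv (u : ℝ) : ℝ := Function.invFunOn h₂ (Set.Icc 0 (1 / 2)) u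

/-! ### Channels -/

/-- A memoryless binary-input output-symmetric (MBIOS) channel with output alphabet `𝒴`:
the two conditional output laws are exchanged by a measurable involution of the output
alphabet. -/
structure MBIOSChannel (𝒴 : Type*) [MeasurableSpace 𝒴] where
  /-- the law of the output given the input -/
  law : ZMod 2 → Measure 𝒴
  isProb : ∀ x, IsProbabilityMeasure (law x)
  /-- the symmetry of the output alphabet -/
  flip : 𝒴 → 𝒴
  measurable_flip : Measurable flip
  flip_flip : ∀ y, flip (flip y) = y
  map_flip : (law 0).map flip = law 1

/-- `tanh (l / 2)` for an extended real number `l`. -/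
noncomputable def tanhHalf (l : EReal) : ℝ :=
  if l = ⊤ then 1 else if l = ⊥ then -1 else Real.tanh (l.toReal / 2)

namespace MBIOSChannel

variable {𝒴 : Type*} [MeasurableSpace 𝒴]

/-- The law of the output when the input bit equals 1 with probability `q`. -/
noncomputable def mixture (W : MBIOSChannel 𝒴) (q : unitInterval) : Measure 𝒴 :=
  ENNReal.ofReal (1 - q) • W.law 0 + ENNReal.ofReal q • W.law 1

/-- The mutual information (in nats) between input and output when the input bit equals 1 with
probability `q`. -/
noncomputable def mutualInfo (W : MBIOSChannel 𝒴) (q : unitInterval) : ℝ≥0∞ :=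
  ENNReal.ofReal (1 - q) * InformationTheory.klDiv (W.law 0) (W.mixture q) +
    ENNReal.ofReal q * InformationTheory.klDiv (W.law 1) (W.mixture q)

/-- The channel capacity in bits per channel use. -/
noncomputable def capacity (W : MBIOSChannel 𝒴) : ℝ :=
  (⨆ q : unitInterval, W.mutualInfo q).toReal / Real.log 2

/-- The log-likelihood ratio of an output symbol (infinite values are allowed); the densities
are taken with respect to the sum of the two output laws. -/
noncomputable def llr (W : MBIOSChannel 𝒴) (y : 𝒴) : EReal :=
  ENNReal.log ((W.law 0).rnDeriv (W.law 0 + W.law 1) y / (W.law 1).rnDeriv (W.law 0 + W.law 1) y)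

/-- The conditional law `a` of the log-likelihood ratio given that the input is zero. -/
noncomputable def llrLaw (W : MBIOSChannel 𝒴) : Measure EReal := (W.law 0).map W.llr

/-- `g₁ = ∫₀^∞ a(l) (1 + e^{-l}) tanh²(l/2) dl`. The law `a` may have atoms, also at `+∞`. -/
noncomputable def g₁ (W : MBIOSChannel 𝒴) : ℝ :=
  ∫ l in Set.Ici (0 : EReal), (1 + (EReal.exp (-l)).toReal) * tanhHalf l ^ 2 ∂W.llrLaw

/-- The law of the received word given the transmitted word (memoryless use of the channel). -/
noncomputable def wordLaw (W : MBIOSChannel 𝒴) {n : ℕ} (x : Fin n → ZMod 2) :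
    Measure (Fin n → 𝒴) :=
  haveI := W.isProb
  Measure.pi fun i => W.law (x i)

open Classical in
/-- The bit error probability of a (possibly randomized) decoder `D`, averaged over the `n` bits
and over equiprobable codewords. -/
noncomputable def bitErrorProb (W : MBIOSChannel 𝒴) {n : ℕ}
    (𝒞 : Submodule (ZMod 2) (Fin n → ZMod 2)) (D : Kernel (Fin n → 𝒴) (Fin n → ZMod 2)) : ℝ :=
  (∑ i : Fin n, (∑ x : 𝒞, ((W.wordLaw x.1).bind D).real {z | z i ≠ x.1 i}) / Nat.card 𝒞) / n

end MBIOSChannel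

/-! ### The binary erasure channel -/

/-- Output alphabet of the binary erasure channel; `none` is the erasure. -/
abbrev BECOutput : Type := Option (ZMod 2)

instance : MeasurableSpace BECOutput := ⊤

/-- The binary erasure channel with erasure probability `p`. -/
noncomputable def bec (p : ℝ) (hp : p ∈ Set.Icc (0 : ℝ) 1) : MBIOSChannel BECOutput where
  law x := ENNReal.ofReal (1 - p) • Measure.dirac (some x) + ENNReal.ofReal p • Measure.dirac none
  isProb x := by
    refine ⟨?_⟩
    simp only [Measure.add_apply, Measure.smul_apply, measure_univ, smul_eq_mul, mul_one]
    rw [← ENNReal.ofReal_add (by linarith [hp.2]) hp.1]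
    simp
  flip := Option.map fun b => b + 1
  measurable_flip := measurable_from_top
  flip_flip y := by
    cases y with
    | none => rfl
    | some b => revert b; decide
  map_flip := by
    have h : Measurable (Option.map fun b : ZMod 2 => b + 1 : BECOutput → BECOutput) :=
      measurable_from_top
    rw [Measure.map_add _ _ h, Measure.map_smul, Measure.map_smul, Measure.map_dirac' h,
      Measure.map_dirac' h]
    simp

/-- A (possibly randomized) decoder for the binary erasure channel, which decides each bit or
declares it erased, is errorless if its decisions are almost surely correct. -/
def IsErrorless (p : ℝ) (hp : p ∈ Set.Icc (0 : ℝ) 1) {n : ℕ}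
    (𝒞 : Submodule (ZMod 2) (Fin n → ZMod 2))
    (D : Kernel (Fin n → BECOutput) (Fin n → BECOutput)) : Prop :=
  ∀ x ∈ 𝒞, ∀ i, (((bec p hp).wordLaw x).bind D) {z | ∃ b, z i = some b ∧ b ≠ x i} = 0

open Classical in
/-- The erasure probability of a code over the binary erasure channel under the decoder `D`: the
probability that a bit is erased after decoding, averaged over the `n` bits and over equiprobable
codewords. -/
noncomputable def erasureProb (p : ℝ) (hp : p ∈ Set.Icc (0 : ℝ) 1) {n : ℕ}
    (𝒞 : Submodule (ZMod 2) (Fin n → ZMod 2))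
    (D : Kernel (Fin n → BECOutput) (Fin n → BECOutput)) : ℝ :=
  (∑ i : Fin n, (∑ x : 𝒞, (((bec p hp).wordLaw x.1).bind D).real {z | z i = none}) /
    Nat.card 𝒞) / n

/-! ### The lower bounds on the average right degree -/

/-- The lower bound on `a_R` for a general MBIOS channel of capacity `C` with parameter `g`, gap to
capacity `ε` and bit error probability `Pb`. -/
noncomputable def degreeBound (C g ε Pb : ℝ) : ℝ :=
  2 * Real.log (1 / (1 - 2 * h₂Inv ((1 - C - h₂ Pb) / (1 - (1 - ε) * C)))) / Real.log (1 / g)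

/-- The lower bound on `a_R` for the binary erasure channel with erasure probability `p`, gap to
capacity `ε` and erasure probability `Pb` after decoding. -/
noncomputable def degreeBoundBEC (p ε Pb : ℝ) : ℝ :=
  Real.log (1 + (p - Pb) / ((1 - p) * ε + Pb)) / Real.log (1 / (1 - p))

/-! ### Cycle rank and fundamental cycles of a finite graph. -/

section Graphs

open SimpleGraph

variable {V : Type*}

/-! The graph half is an Euler count. Deleting a bridge creates one component and deleting any other
edge creates none, so β = |E| - |V| + C(G), and each edge outside `F` closes exactly one cycle. In a
Tanner graph |E| = m a_R, |V| = n + m, m = n(1-R) and C(G) ≥ 1, which gives the strict bound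
(`lt_ncard_fundamentalSystem`). That bound is monotone in a_R, so the rest is about lower bounds on
a_R.

For a symmetric channel, write the two output laws as densities 1 ± t against a flip-invariant
measure ν. Then t = tanh(LLR/2) and g₁ = ∫ t² dν. A check with support S has bias u_S = ∏ t(y_i)
over S, and 1 + u_S is the output density for a uniformly random word satisfying that check. Full
rank makes w = ∏_j (1 + u_{S_j}) a probability density. Non-negativity of relative entropy is
applied to the true law of (codeword, output, decision) against a test law in which the output has
density w and the codeword is the decision with each bit flipped with probability ρ
(`gibbs_integrated`). This single inequality combines Fano's inequality with an upper bound on the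
output entropy. The expectation of log(1 + u_S) equals that of φ(u_S²), with φ = `entropyDeficit`
convex. Independence and Jensen bound it below by φ(g₁^|S|), and Jensen over the checks replaces |S|
by a_R. The outcome is `MBIOSChannel.entropyDeficit_rpow_le`, which is then solved for a_R.

For the erasure channel, linear algebra replaces entropy: the number of erasures is at most the
number of checks touching an erasure plus the number of positions the output leaves undetermined. An
errorless decoder has to erase the latter. Taking expectations gives `le_erasureProb`.

When the error terms are O(ε), both trade-offs give R ≤ C + O(ε) and (1-R) g^a_R = O(ε), with g = g₁
or 1-p. Hence a_R grows at least like ln(1/ε) (`exists_log_bound`). -/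

theorem SimpleGraph.Reachable.of_forall_adj {G G' : SimpleGraph V}
    (h : ∀ a b, G.Adj a b → G'.Reachable a b) {a b : V} (hab : G.Reachable a b) :
    G'.Reachable a b := by
  obtain ⟨w⟩ := hab
  induction w with
  | nil => exact .rfl
  | cons hadj _ ih => exact (h _ _ hadj).trans ih

/-- The inclusion induces a surjection on components; finiteness and the count make it injective. -/
theorem reachable_of_numComponents_le [Finite V] {F G : SimpleGraph V} (hFG : F ≤ G)
    (hc : numComponents F ≤ numComponents G) {a b : V} (hab : G.Reachable a b) :
    F.Reachable a b := by
  have hs := ConnectedComponent.surjective_map_ofLE hFG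
  have hb := (Nat.bijective_iff_surjective_and_card _).2
    ⟨hs, le_antisymm hc (Nat.card_le_card_of_surjective _ hs)⟩
  rw [← ConnectedComponent.eq]
  apply hb.1
  simpa [ConnectedComponent.map_mk] using ConnectedComponent.eq.2 hab

theorem numComponents_anti [Finite V] {F G : SimpleGraph V} (hFG : F ≤ G) :
    numComponents G ≤ numComponents F :=
  Nat.card_le_card_of_surjective _ (ConnectedComponent.surjective_map_ofLE hFG)

theorem numComponents_le_of_reachable [Finite V] {F G : SimpleGraph V}
    (h : ∀ a b, G.Reachable a b → F.Reachable a b) : numComponents F ≤ numComponents G := by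
  let g : G.ConnectedComponent → F.ConnectedComponent :=
    fun c => c.lift F.connectedComponentMk fun a b w _ => ConnectedComponent.eq.2 (h a b ⟨w⟩)
  refine Nat.card_le_card_of_surjective g fun c => ?_
  induction c using ConnectedComponent.ind with
  | _ v => exact ⟨G.connectedComponentMk v, rfl⟩

theorem numComponents_deleteEdges_of_not_isBridge [Finite V] {G : SimpleGraph V} {e : Sym2 V}
    (h : ¬ G.IsBridge e) : numComponents (G.deleteEdges {e}) = numComponents G := by
  refine le_antisymm ?_ (numComponents_anti (deleteEdges_le _))
  refine numComponents_le_of_reachable fun a b => Reachable.of_forall_adj fun a b hab => ?_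
  by_cases hs : s(a, b) = e
  · subst hs
    rwa [isBridge_iff, not_not] at h
  · exact Adj.reachable (by simp [deleteEdges_adj, hab, hs])

theorem numComponents_deleteEdges_of_isBridge [Finite V] {G : SimpleGraph V} {e : Sym2 V}
    (he : e ∈ G.edgeSet) (h : G.IsBridge e) :
    numComponents (G.deleteEdges {e}) = numComponents G + 1 := by
  classical
  induction e with | _ u v
  rw [isBridge_iff] at h
  have hG : G.Adj u v := he
  set G' := G.deleteEdges {s(u, v)} with hG'
  -- `f` redirects the component of `v` to that of `u`, so it is constant along every edge of `G`,
  -- the deleted one included. It induces a bijection from the components of `G` to those of `G'`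
  -- other than the component of `v`.
  let f : V → G'.ConnectedComponent := fun a =>
    if G'.connectedComponentMk a = G'.connectedComponentMk v then G'.connectedComponentMk u
    else G'.connectedComponentMk a
  have hf : ∀ a b, G.Adj a b → f a = f b := by
    intro a b hab
    by_cases hs : s(a, b) = s(u, v)
    · rcases Sym2.eq_iff.1 hs with ⟨rfl, rfl⟩ | ⟨rfl, rfl⟩ <;> simp [f]
    · have : G'.connectedComponentMk a = G'.connectedComponentMk b :=
        ConnectedComponent.eq.2 (Adj.reachable (by simp [hG', deleteEdges_adj, hab, hs]))
      simp only [f, this]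
  have hfw : ∀ a b, G.Reachable a b → f a = f b := by
    rintro a b ⟨w⟩
    induction w with
    | nil => rfl
    | cons hadj _ ih => exact (hf _ _ hadj).trans ih
  have hne : ∀ a, f a ≠ G'.connectedComponentMk v := by
    intro a
    by_cases ha : G'.connectedComponentMk a = G'.connectedComponentMk v
    · simp only [f, if_pos ha]
      exact fun h' => h (ConnectedComponent.eq.1 h')
    · simp only [f, if_neg ha]
      exact ha
  let g : G.ConnectedComponent → {c : G'.ConnectedComponent // c ≠ G'.connectedComponentMk v} :=
    fun c => ⟨c.lift f fun a b w _ => hfw a b ⟨w⟩, by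
      induction c using ConnectedComponent.ind with
      | _ a => exact hne a⟩
  have hg : Function.Bijective g := by
    constructor
    · intro c d hcd
      induction c using ConnectedComponent.ind with | _ a
      induction d using ConnectedComponent.ind with | _ b
      have hab : f a = f b := congrArg Subtype.val hcd
      have key : ∀ x, ConnectedComponent.map (Hom.ofLE (deleteEdges_le _)) (f x) =
          G.connectedComponentMk x := by
        intro x
        by_cases hx : G'.connectedComponentMk x = G'.connectedComponentMk v
        · simp only [f, hx, if_true]
          have h1 : G.Reachable x v := (ConnectedComponent.eq.1 hx).mono (deleteEdges_le _)
          exact ConnectedComponent.eq.2 (hG.reachable.trans h1.symm)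
        · simp only [f, hx, if_false]
          rfl
      rw [← key, ← key, hab]
    · rintro ⟨c, hc⟩
      induction c using ConnectedComponent.ind with
      | _ a => exact ⟨G.connectedComponentMk a, Subtype.ext (if_neg hc)⟩
  have h1 := Nat.card_congr (Equiv.ofBijective g hg)
  have h2 := Nat.card_congr (Equiv.sumCompl fun c => c = G'.connectedComponentMk v)
  rw [Nat.card_sum] at h2
  simp only [Nat.card_unique] at h2
  unfold numComponents
  rw [← h2, h1, add_comm]

theorem ncard_edgeSet_deleteEdges_singleton [Finite V] {G : SimpleGraph V} {e : Sym2 V}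
    (he : e ∈ G.edgeSet) : (G.deleteEdges {e}).edgeSet.ncard + 1 = G.edgeSet.ncard := by
  rw [edgeSet_deleteEdges]
  exact Set.ncard_sdiff_singleton_add_one he (Set.toFinite _)

/-- Delete edges one at a time: a bridge leaves |E| + C unchanged, any other edge lowers it by one,
and the empty graph has equality. In an acyclic graph all edges are bridges. -/
theorem card_le_ncard_edgeSet_add_numComponents [Finite V] (G : SimpleGraph V) :
    Nat.card V ≤ G.edgeSet.ncard + numComponents G ∧
      (G.IsAcyclic → Nat.card V = G.edgeSet.ncard + numComponents G) := by
  induction hk : G.edgeSet.ncard generalizing G with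
  | zero =>
    have hG : G = ⊥ := by
      rw [Set.ncard_eq_zero (Set.toFinite _)] at hk
      exact edgeSet_eq_empty.1 hk
    have : Nat.card V = numComponents G := by
      refine Nat.card_congr (Equiv.ofBijective G.connectedComponentMk ⟨fun a b hab => ?_,
        fun c => ?_⟩)
      · simpa [hG] using ConnectedComponent.eq.1 hab
      · induction c using ConnectedComponent.ind with
        | _ v => exact ⟨v, rfl⟩
    omega
  | succ k ih =>
    obtain ⟨e, he⟩ : G.edgeSet.Nonempty := by
      rw [← Set.ncard_pos (Set.toFinite _)]; omega
    have h1 := ncard_edgeSet_deleteEdges_singleton he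
    obtain ⟨h2, h3⟩ := ih (G.deleteEdges {e}) (by omega)
    by_cases hb : G.IsBridge e
    · rw [numComponents_deleteEdges_of_isBridge he hb] at h2 h3
      exact ⟨by omega, fun h => by have := h3 (h.anti (deleteEdges_le _)); omega⟩
    · rw [numComponents_deleteEdges_of_not_isBridge hb] at h2
      exact ⟨by omega, fun h => absurd (isAcyclic_iff_forall_isBridge.1 h he) hb⟩

/-- Deleting a non-bridge would violate the previous inequality for the smaller graph. -/
theorem isAcyclic_of_ncard_edgeSet_add_numComponents_le [Finite V] {G : SimpleGraph V}
    (h : G.edgeSet.ncard + numComponents G ≤ Nat.card V) : G.IsAcyclic := by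
  rw [isAcyclic_iff_forall_isBridge]
  intro e he
  by_contra hb
  have h1 := ncard_edgeSet_deleteEdges_singleton he
  have h2 := (card_le_ncard_edgeSet_add_numComponents (G.deleteEdges {e})).1
  rw [numComponents_deleteEdges_of_not_isBridge hb] at h2
  omega

theorem cycleRank_add_card [Finite V] (G : SimpleGraph V) :
    cycleRank G + Nat.card V = G.edgeSet.ncard + numComponents G := by
  have hle := (card_le_ncard_edgeSet_add_numComponents G).1
  suffices h : cycleRank G = G.edgeSet.ncard + numComponents G - Nat.card V by omega
  refine IsGreatest.csSup_eq ⟨?_, ?_⟩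
  -- The maximum is attained by removing the complement of a spanning forest; the upper bound is the
  -- Euler inequality for what remains.
  · obtain ⟨F, hF, hac, hr⟩ := exists_isAcyclic_reachable_eq_le (G := G)
    refine ⟨G.edgeSet \ F.edgeSet, Set.sdiff_subset, ?_, ?_⟩
    · have h1 := (card_le_ncard_edgeSet_add_numComponents F).2 hac
      have h2 : numComponents F = numComponents G :=
        le_antisymm (numComponents_le_of_reachable fun a b h => by rw [hr]; exact h)
          (numComponents_anti hF)
      have h3 := Set.ncard_sdiff_add_ncard_of_subset (edgeSet_subset_edgeSet.2 hF)
        (Set.toFinite _)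
      omega
    · refine numComponents_le_of_reachable fun a b h => ?_
      rw [← hr] at h
      refine h.mono fun x y hxy => ?_
      simp only [deleteEdges_adj, Set.mem_sdiff, mem_edgeSet, not_and, not_not]
      exact ⟨hF hxy, fun _ => hxy⟩
  · rintro k ⟨S, hS, rfl, hc⟩
    have h1 := (card_le_ncard_edgeSet_add_numComponents (G.deleteEdges S)).1
    rw [edgeSet_deleteEdges] at h1
    have h3 := Set.ncard_sdiff_add_ncard_of_subset hS (Set.toFinite _)
    omega

theorem IsFullSpanningForest.le {G F : SimpleGraph V} (h : IsFullSpanningForest G F) : F ≤ G := by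
  obtain ⟨S, -, -, -, rfl⟩ := h
  exact deleteEdges_le _

theorem IsFullSpanningForest.numComponents_le {G F : SimpleGraph V}
    (h : IsFullSpanningForest G F) : numComponents F ≤ numComponents G := by
  obtain ⟨S, -, -, h, rfl⟩ := h
  exact h

theorem IsFullSpanningForest.ncard_edgeSet_diff {G F : SimpleGraph V}
    (h : IsFullSpanningForest G F) : (G.edgeSet \ F.edgeSet).ncard = cycleRank G := by
  obtain ⟨S, hS, hc, -, rfl⟩ := h
  rw [edgeSet_deleteEdges, Set.sdiff_sdiff_cancel_left hS, hc]

theorem IsFullSpanningForest.ncard_edgeSet_add [Finite V] {G F : SimpleGraph V}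
    (h : IsFullSpanningForest G F) : F.edgeSet.ncard + numComponents F = Nat.card V := by
  have h1 := Set.ncard_sdiff_add_ncard_of_subset (edgeSet_subset_edgeSet.2 h.le) (Set.toFinite _)
  have h2 := h.ncard_edgeSet_diff
  have h3 := cycleRank_add_card G
  have h4 := h.numComponents_le
  have h5 := numComponents_anti h.le
  omega

/-- With at most one edge in excess of a forest, deleting a non-bridge leaves a forest, so no cycle
can avoid that edge. The right side does not mention `w`, whence all cycles have the same edge set.
-/
theorem edges_of_isCycle_eq [Finite V] {F' : SimpleGraph V}
    (hcard : F'.edgeSet.ncard + numComponents F' ≤ Nat.card V + 1) {v : V} {w : F'.Walk v v}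
    (hw : w.IsCycle) : {f | f ∈ w.edges} = {f ∈ F'.edgeSet | ¬ F'.IsBridge f} := by
  ext f
  refine ⟨fun hf => ⟨w.edges_subset_edgeSet hf, fun hb => hb.notMem_edges_of_isCycle hw hf⟩, ?_⟩
  rintro ⟨hf, hb⟩
  by_contra hfw
  have h1 := ncard_edgeSet_deleteEdges_singleton hf
  have hac : (F'.deleteEdges {f}).IsAcyclic := isAcyclic_of_ncard_edgeSet_add_numComponents_le (by
    rw [numComponents_deleteEdges_of_not_isBridge hb]; omega)
  refine hac (w.toDeleteEdges {f} fun e he hef => hfw ?_) (hw.toDeleteEdges _ _ _)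
  rw [← Set.mem_singleton_iff.1 hef]
  exact he

theorem IsFullSpanningForest.ncard_fundamentalSystem [Finite V] {G F : SimpleGraph V}
    (h : IsFullSpanningForest G F) : (fundamentalSystem G F).ncard = cycleRank G := by
  set D : Sym2 V → Set (Sym2 V) := fun e =>
    {f ∈ (F ⊔ fromEdgeSet {e}).edgeSet | ¬ (F ⊔ fromEdgeSet {e}).IsBridge f} with hD
  have hedge : ∀ e ∈ G.edgeSet, (F ⊔ fromEdgeSet {e}).edgeSet = insert e F.edgeSet := by
    intro e he
    rw [edgeSet_sup, edgeSet_fromEdgeSet, Set.union_comm, Set.insert_eq]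
    congr 1
    rw [sdiff_eq_left, Set.disjoint_left]
    rintro x rfl
    exact G.not_isDiag_of_mem_edgeSet he
  have hmem : ∀ e ∈ G.edgeSet \ F.edgeSet, e ∈ D e := by
    rintro e ⟨he, heF⟩
    refine ⟨by rw [hedge e he]; exact Set.mem_insert _ _, ?_⟩
    induction e with | _ u v
    rw [isBridge_iff, not_not]
    refine (reachable_of_numComponents_le h.le h.numComponents_le
      (Adj.reachable (G := G) he)).mono fun a b hab => ?_
    rw [deleteEdges_adj]
    refine ⟨Or.inl hab, fun hs => heF ?_⟩
    rw [← Set.mem_singleton_iff.1 hs]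
    exact hab
  have himage : fundamentalSystem G F = D '' (G.edgeSet \ F.edgeSet) := by
    have hcard : ∀ e ∈ G.edgeSet \ F.edgeSet, (F ⊔ fromEdgeSet {e}).edgeSet.ncard +
        numComponents (F ⊔ fromEdgeSet {e}) ≤ Nat.card V + 1 := by
      intro e he
      have h1 := h.ncard_edgeSet_add
      have h2 := numComponents_anti (le_sup_left : F ≤ F ⊔ fromEdgeSet {e})
      have h3 := Set.ncard_insert_le e F.edgeSet
      rw [hedge e he.1]
      omega
    ext c
    constructor
    · rintro ⟨e, he, v, w, hw, rfl⟩
      exact ⟨e, he, (edges_of_isCycle_eq (hcard e he) hw).symm⟩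
    · rintro ⟨e, he, rfl⟩
      obtain ⟨h1, h2⟩ := hmem e he
      rw [isBridge_iff_forall_cycle_notMem h1] at h2
      push Not at h2
      obtain ⟨v, w, hw, -⟩ := h2
      exact ⟨e, he, v, w, hw, (edges_of_isCycle_eq (hcard e he) hw).symm⟩
  rw [himage, Set.InjOn.ncard_image, h.ncard_edgeSet_diff]
  -- Injectivity: `e` lies in `D e`, and the only edge of `D e'` outside `F` is `e'`.
  intro e he e' he' hee
  have h1 := hmem e he
  rw [hee] at h1
  have h2 := h1.1
  rw [hedge e' he'.1] at h2
  exact h2.resolve_right he.2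

end Graphs

/-! ### Edge and vertex counts of Tanner graphs. -/

section Tanner

variable {n m : ℕ}

/-- The set of symbols involved in the `j`-th parity-check equation. -/
def rowSupport (H : Matrix (Fin m) (Fin n) (ZMod 2)) (j : Fin m) : Finset (Fin n) :=
  Finset.univ.filter fun i => H j i ≠ 0

theorem mem_rowSupport {H : Matrix (Fin m) (Fin n) (ZMod 2)} {j : Fin m} {i : Fin n} :
    i ∈ rowSupport H j ↔ H j i ≠ 0 := by
  simp [rowSupport]

theorem tannerGraph_adj_inl_inr {H : Matrix (Fin m) (Fin n) (ZMod 2)} {i : Fin n} {j : Fin m} :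
    (tannerGraph H).Adj (Sum.inl i) (Sum.inr j) ↔ H j i ≠ 0 := by
  simp [tannerGraph]

theorem tannerGraph_isBipartiteWith (H : Matrix (Fin m) (Fin n) (ZMod 2)) :
    (tannerGraph H).IsBipartiteWith (Set.range Sum.inl) (Set.range Sum.inr) where
  disjoint := Set.isCompl_range_inl_range_inr.disjoint
  mem_of_adj := by
    rintro (i | j) (i' | j') h <;> simp_all [tannerGraph]

theorem ncard_neighborSet_inr (H : Matrix (Fin m) (Fin n) (ZMod 2)) (j : Fin m) :
    ((tannerGraph H).neighborSet (Sum.inr j)).ncard = (rowSupport H j).card := by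
  have : (tannerGraph H).neighborSet (Sum.inr j) = Sum.inl '' (rowSupport H j : Set (Fin n)) := by
    ext (i | i)
    · simp [SimpleGraph.adj_comm _ (Sum.inr j), tannerGraph_adj_inl_inr, mem_rowSupport]
    · simp [tannerGraph]
  rw [this, Set.ncard_image_of_injective _ Sum.inl_injective, Set.ncard_coe_finset]

theorem ncard_edgeSet_tannerGraph (H : Matrix (Fin m) (Fin n) (ZMod 2)) :
    (tannerGraph H).edgeSet.ncard = ∑ j, (rowSupport H j).card := by
  classical
  have hb : (tannerGraph H).IsBipartiteWith
      ((Finset.univ.map Function.Embedding.inl : Finset (Fin n ⊕ Fin m)) : Set (Fin n ⊕ Fin m))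
      ((Finset.univ.map Function.Embedding.inr : Finset (Fin n ⊕ Fin m)) :
        Set (Fin n ⊕ Fin m)) := by
    simpa using tannerGraph_isBipartiteWith H
  have h := SimpleGraph.isBipartiteWith_sum_degrees_eq_card_edges' hb
  rw [Finset.sum_map] at h
  rw [← SimpleGraph.coe_edgeFinset, Set.ncard_coe_finset, ← h]
  refine Finset.sum_congr rfl fun j _ => ?_
  rw [← ncard_neighborSet_inr, ← SimpleGraph.card_neighborSet_eq_degree, Set.ncard_eq_toFinset_card',
    Set.toFinset_card]
  rfl

theorem avgRightDegree_eq (H : Matrix (Fin m) (Fin n) (ZMod 2)) :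
    avgRightDegree H = (∑ j, ((rowSupport H j).card : ℝ)) / m := by
  simp only [avgRightDegree, ncard_neighborSet_inr]

theorem mul_avgRightDegree (H : Matrix (Fin m) (Fin n) (ZMod 2)) :
    m * avgRightDegree H = (tannerGraph H).edgeSet.ncard := by
  rw [avgRightDegree_eq, ncard_edgeSet_tannerGraph]
  rcases Nat.eq_zero_or_pos m with rfl | hm
  · simp
  · push_cast
    field_simp

variable {𝒞 : Submodule (ZMod 2) (Fin n → ZMod 2)} {H : Matrix (Fin m) (Fin n) (ZMod 2)}

/-- This is the form in which full rank is used later: for each check there is a word violating that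
check and no other. -/
theorem IsFullRankParityCheck.surjective (h : IsFullRankParityCheck 𝒞 H) :
    Function.Surjective H.mulVec := by
  have h1 : LinearMap.range H.mulVecLin = ⊤ := by
    apply Submodule.eq_top_of_finrank_eq
    rw [Module.finrank_fin_fun]
    exact h.fullRank
  exact LinearMap.range_eq_top.1 h1

theorem IsFullRankParityCheck.finrank_add (h : IsFullRankParityCheck 𝒞 H) :
    Module.finrank (ZMod 2) 𝒞 + m = n := by
  have h1 : 𝒞 = LinearMap.ker H.mulVecLin := by
    ext x
    rw [h.mem_iff, LinearMap.mem_ker, Matrix.mulVecLin_apply]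
  have h2 := LinearMap.finrank_range_add_finrank_ker H.mulVecLin
  rw [Module.finrank_fin_fun, ← h1] at h2
  have h3 : Module.finrank (ZMod 2) (LinearMap.range H.mulVecLin) = m := h.fullRank
  omega

theorem IsFullRankParityCheck.mul_one_sub_codeRate (h : IsFullRankParityCheck 𝒞 H) (hn : 0 < n) :
    (n : ℝ) * (1 - codeRate 𝒞) = m := by
  have h1 : (Module.finrank (ZMod 2) 𝒞 : ℝ) + m = n := by exact_mod_cast h.finrank_add
  have h2 : (n : ℝ) ≠ 0 := by positivity
  rw [codeRate]
  field_simp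
  linarith

theorem IsFullRankParityCheck.rowSupport_nonempty (h : IsFullRankParityCheck 𝒞 H) (j : Fin m) :
    (rowSupport H j).Nonempty := by
  by_contra hne
  rw [Finset.not_nonempty_iff_eq_empty, Finset.eq_empty_iff_forall_notMem] at hne
  obtain ⟨x, hx⟩ := h.surjective (Pi.single j 1)
  have h1 := congrFun hx j
  have h2 : ∀ i, H j i = 0 := fun i => by simpa [mem_rowSupport] using hne i
  simp [Matrix.mulVec, dotProduct, h2] at h1

/-- Drops the component count, which is at least 1. Any lower bound `a` on the average degree may be
inserted. None is required for m = 0, where the degree is the default 0/0 and its coefficient 1 - R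
vanishes. -/
theorem lt_ncard_fundamentalSystem {F : SimpleGraph (Fin n ⊕ Fin m)} (hn : 0 < n)
    (h : IsFullRankParityCheck 𝒞 H) (hF : IsFullSpanningForest (tannerGraph H) F) {a : ℝ}
    (ha : 0 < m → a ≤ avgRightDegree H) :
    (n : ℝ) * ((1 - codeRate 𝒞) * (a - 1) - 1) < (fundamentalSystem (tannerGraph H) F).ncard := by
  have h1 := cycleRank_add_card (tannerGraph H)
  have h2 : 0 < numComponents (tannerGraph H) := by
    have : Nonempty (tannerGraph H).ConnectedComponent :=
      ⟨(tannerGraph H).connectedComponentMk (Sum.inl ⟨0, hn⟩)⟩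
    exact Nat.card_pos
  rw [Nat.card_eq_fintype_card, Fintype.card_sum, Fintype.card_fin, Fintype.card_fin] at h1
  have h3 : ((tannerGraph H).edgeSet.ncard : ℝ) < cycleRank (tannerGraph H) + (n + m) := by
    exact_mod_cast (by omega :
      (tannerGraph H).edgeSet.ncard < cycleRank (tannerGraph H) + (n + m))
  rw [← mul_avgRightDegree] at h3
  have h4 : (m : ℝ) * a ≤ m * avgRightDegree H := by
    rcases Nat.eq_zero_or_pos m with rfl | hm
    · simp
    · exact mul_le_mul_of_nonneg_left (ha hm) (by positivity)
  rw [hF.ncard_fundamentalSystem]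
  have h5 := h.mul_one_sub_codeRate hn
  calc (n : ℝ) * ((1 - codeRate 𝒞) * (a - 1) - 1)
      = (n * (1 - codeRate 𝒞)) * (a - 1) - n := by ring
    _ < _ := by rw [h5]; linarith

end Tanner

/-! ### Convexity of the entropy deficit, and two Jensen inequalities. -/

section EntropyDeficit

open Real

theorem hasSum_log_sub_log_div {v : ℝ} (h0 : 0 < v) (h1 : v < 1) :
    HasSum (fun k : ℕ => (2 : ℝ) * (1 / (2 * k + 1)) * v ^ (2 * k))
      ((log (1 + v) - log (1 - v)) / v) := by
  have h := (hasSum_log_sub_log_of_abs_lt_one (x := v) (by rwa [abs_of_pos h0])).div_const v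
  have e : (fun k : ℕ => (2 : ℝ) * (1 / (2 * k + 1)) * v ^ (2 * k)) =
      fun k : ℕ => (2 : ℝ) * (1 / (2 * k + 1)) * v ^ (2 * k + 1) / v := by
    ext k
    rw [pow_succ, ← mul_assoc, mul_div_cancel_right₀ _ h0.ne']
  rw [e]
  exact h

/-- Termwise comparison: the series in v² has positive coefficients. -/
theorem log_sub_log_div_mono {v w : ℝ} (h0 : 0 < v) (hvw : v ≤ w) (h1 : w < 1) :
    (log (1 + v) - log (1 - v)) / v ≤ (log (1 + w) - log (1 - w)) / w :=
  hasSum_le (fun k => by gcongr) (hasSum_log_sub_log_div h0 (hvw.trans_lt h1))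
    (hasSum_log_sub_log_div (h0.trans_le hvw) h1)

theorem two_le_log_sub_log_div {v : ℝ} (h0 : 0 < v) (h1 : v < 1) :
    2 ≤ (log (1 + v) - log (1 - v)) / v := by
  have := (hasSum_log_sub_log_div h0 h1).summable.sum_le_tsum {0} (fun i _ => by positivity)
  rw [(hasSum_log_sub_log_div h0 h1).tsum_eq] at this
  simpa using this

/-- The capacity deficit (in nats) of a symmetric bit whose squared bias is `s`. -/
noncomputable def entropyDeficit (s : ℝ) : ℝ := log 2 - binEntropy ((1 - √s) / 2)

theorem entropyDeficit_zero : entropyDeficit 0 = 0 := by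
  simp [entropyDeficit]

theorem continuous_entropyDeficit : Continuous entropyDeficit := by
  unfold entropyDeficit
  fun_prop

/-- Removes the square root. The symmetrised form on the right is what averaging over the sign of a
check bias produces. -/
theorem entropyDeficit_sq (u : ℝ) :
    entropyDeficit (u ^ 2) = ((1 + u) * log (1 + u) + (1 - u) * log (1 - u)) / 2 := by
  have key : ∀ x : ℝ, negMulLog (x / 2) = (x * log 2 - x * log x) / 2 := by
    intro x
    rw [div_eq_mul_inv, negMulLog_mul]
    simp only [negMulLog, log_inv]
    ring
  have h : binEntropy ((1 - |u|) / 2) = binEntropy ((1 - u) / 2) := by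
    rcases abs_cases u with ⟨h, -⟩ | ⟨h, -⟩ <;> rw [h]
    rw [← binEntropy_one_sub]
    congr 1
    ring
  rw [entropyDeficit, sqrt_sq_eq_abs, h, binEntropy_eq_negMulLog_add_negMulLog_one_sub,
    show 1 - (1 - u) / 2 = (1 + u) / 2 by ring, key, key]
  ring

theorem hasDerivAt_entropyDeficit {s : ℝ} (hs : s ∈ Set.Ioo (0 : ℝ) 1) :
    HasDerivAt entropyDeficit ((log (1 + √s) - log (1 - √s)) / √s / 4) s := by
  have h0 : 0 < √s := sqrt_pos.2 hs.1
  have h1 : √s < 1 := by rw [sqrt_lt' one_pos]; simpa using hs.2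
  have hp : HasDerivAt (fun s => (1 - √s) / 2) (-(1 / (2 * √s)) / 2) s :=
    ((hasDerivAt_sqrt hs.1.ne').const_sub 1).div_const 2
  have h := ((hasDerivAt_binEntropy (p := (1 - √s) / 2) (by linarith) (by linarith)).comp s
    hp).const_sub (log 2)
  refine h.congr_deriv ?_
  rw [show 1 - (1 - √s) / 2 = (1 + √s) / 2 by ring, log_div (by linarith) two_ne_zero,
    log_div (by linarith) two_ne_zero]
  field_simp
  ring

/-- The variable is the squared bias because second moments of check biases factor over the symbols.
The derivative is (log(1+√s) - log(1-√s))/(4√s), increasing by the series above. -/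
theorem convexOn_entropyDeficit : ConvexOn ℝ (Set.Icc 0 1) entropyDeficit := by
  refine MonotoneOn.convexOn_of_deriv (convex_Icc 0 1) continuous_entropyDeficit.continuousOn
    ?_ ?_ <;> rw [interior_Icc]
  · exact fun s hs => (hasDerivAt_entropyDeficit hs).differentiableAt.differentiableWithinAt
  · intro s hs t ht hst
    rw [(hasDerivAt_entropyDeficit hs).deriv, (hasDerivAt_entropyDeficit ht).deriv]
    have h1 : √t < 1 := by rw [sqrt_lt' one_pos]; simpa using ht.2
    have := log_sub_log_div_mono (sqrt_pos.2 hs.1) (sqrt_le_sqrt hst) h1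
    linarith

/-- The slope is at least 1/2, its leading series term. This yields both monotonicity and the linear
lower bound `half_le_entropyDeficit`. -/
theorem monotoneOn_entropyDeficit_sub :
    MonotoneOn (fun s => entropyDeficit s - s / 2) (Set.Icc 0 1) := by
  have hd : ∀ s ∈ Set.Ioo (0 : ℝ) 1, HasDerivAt (fun s => entropyDeficit s - s / 2)
      ((log (1 + √s) - log (1 - √s)) / √s / 4 - 1 / 2) s := fun s hs =>
    (hasDerivAt_entropyDeficit hs).sub ((hasDerivAt_id s).div_const 2)
  refine monotoneOn_of_deriv_nonneg (convex_Icc 0 1)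
    (continuous_entropyDeficit.sub (continuous_id.div_const 2)).continuousOn ?_ ?_ <;>
    rw [interior_Icc]
  · exact fun s hs => (hd s hs).differentiableAt.differentiableWithinAt
  · intro s hs
    rw [(hd s hs).deriv]
    have h1 : √s < 1 := by rw [sqrt_lt' one_pos]; simpa using hs.2
    have := two_le_log_sub_log_div (sqrt_pos.2 hs.1) h1
    linarith

theorem monotoneOn_entropyDeficit : MonotoneOn entropyDeficit (Set.Icc 0 1) := by
  intro s hs t ht hst
  have := monotoneOn_entropyDeficit_sub hs ht hst
  simp only at this
  linarith

theorem half_le_entropyDeficit {s : ℝ} (hs : s ∈ Set.Icc (0 : ℝ) 1) :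
    s / 2 ≤ entropyDeficit s := by
  have := monotoneOn_entropyDeficit_sub (Set.left_mem_Icc.2 zero_le_one) hs hs.1
  simp only [entropyDeficit_zero] at this
  linarith

theorem rpow_avg_le_avg_pow {m : ℕ} (hm : 0 < m) {g : ℝ} (hg : 0 < g) (d : Fin m → ℕ) :
    g ^ ((∑ j, (d j : ℝ)) / m) ≤ (∑ j, g ^ d j) / m := by
  have hm' : (m : ℝ) ≠ 0 := by positivity
  have h := (convexOn_exp).map_sum_le (t := Finset.univ) (w := fun _ : Fin m => (1 / m : ℝ))
    (p := fun j => (d j : ℝ) * log g) (fun _ _ => by positivity) (by simp [hm'])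
    (fun _ _ => Set.mem_univ _)
  simp only [smul_eq_mul] at h
  calc g ^ ((∑ j, (d j : ℝ)) / m) = exp (∑ j, 1 / (m : ℝ) * (d j * log g)) := by
        rw [rpow_def_of_pos hg, ← Finset.mul_sum, ← Finset.sum_mul]
        congr 1
        field_simp
    _ ≤ _ := h
    _ = _ := by
        rw [← Finset.mul_sum, one_div, inv_mul_eq_div]
        congr 1
        refine Finset.sum_congr rfl fun j _ => ?_
        rw [← rpow_natCast, rpow_def_of_pos hg, mul_comm]

/-- Jensen twice: for d ↦ g^d, then for the deficit, which is also monotone. -/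
theorem mul_entropyDeficit_rpow_avg_le {m : ℕ} (hm : 0 < m) {g : ℝ} (hg : 0 < g) (hg1 : g ≤ 1)
    (d : Fin m → ℕ) :
    m * entropyDeficit (g ^ ((∑ j, (d j : ℝ)) / m)) ≤ ∑ j, entropyDeficit (g ^ d j) := by
  have hm' : (0 : ℝ) < m := by positivity
  have hmem : ∀ j, g ^ d j ∈ Set.Icc (0 : ℝ) 1 := fun j =>
    ⟨by positivity, pow_le_one₀ hg.le hg1⟩
  have h := convexOn_entropyDeficit.map_sum_le (t := Finset.univ)
    (w := fun _ : Fin m => (1 / m : ℝ)) (p := fun j => g ^ d j) (fun _ _ => by positivity)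
    (by simp [hm'.ne']) (fun j _ => hmem j)
  simp only [smul_eq_mul, ← Finset.mul_sum] at h
  have h1 := rpow_avg_le_avg_pow hm hg d
  have h2 : (∑ j, g ^ d j) / m ≤ 1 := by
    rw [div_le_one hm']
    calc ∑ j, g ^ d j ≤ ∑ _j : Fin m, (1 : ℝ) := Finset.sum_le_sum fun j _ => (hmem j).2
      _ = m := by simp
  have h3 := monotoneOn_entropyDeficit ⟨by positivity, h1.trans h2⟩ ⟨by positivity, h2⟩ h1
  rw [one_div, inv_mul_eq_div, inv_mul_eq_div] at h
  rw [← le_div_iff₀' hm']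
  exact h3.trans h

/-- The cross-entropy is smallest at ρ = p. Since ρ stays in the open interval, p = 0 and p = 1 are
reached as limits. -/
theorem le_binEntropy_of_forall {A p : ℝ} (hp0 : 0 ≤ p) (hp1 : p ≤ 1)
    (h : ∀ ρ ∈ Set.Ioo (0 : ℝ) 1, A ≤ -(p * log ρ + (1 - p) * log (1 - ρ))) :
    A ≤ binEntropy p := by
  rcases hp0.eq_or_lt with rfl | hp0
  · rw [binEntropy_zero]
    have ht : Filter.Tendsto (fun ρ : ℝ => -log (1 - ρ)) (nhdsWithin 0 (Set.Ioi 0)) (nhds 0) := by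
      have : ContinuousAt (fun ρ : ℝ => -log (1 - ρ)) 0 := by
        refine ContinuousAt.neg (ContinuousAt.log (by fun_prop) (by norm_num))
      simpa using this.tendsto.mono_left nhdsWithin_le_nhds
    refine ge_of_tendsto ht ?_
    filter_upwards [Ioo_mem_nhdsGT (zero_lt_one' ℝ)] with ρ hρ
    simpa using h ρ hρ
  rcases hp1.eq_or_lt with rfl | hp1
  · rw [binEntropy_one]
    have ht : Filter.Tendsto (fun ρ : ℝ => -log ρ) (nhdsWithin 1 (Set.Iio 1)) (nhds 0) := by
      have : ContinuousAt (fun ρ : ℝ => -log ρ) 1 := by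
        refine ContinuousAt.neg (ContinuousAt.log (by fun_prop) (by norm_num))
      simpa using this.tendsto.mono_left nhdsWithin_le_nhds
    refine ge_of_tendsto ht ?_
    filter_upwards [Ioo_mem_nhdsLT (zero_lt_one' ℝ)] with ρ hρ
    simpa using h ρ hρ
  refine (h p ⟨hp0, hp1⟩).trans_eq ?_
  rw [binEntropy_eq_negMulLog_add_negMulLog_one_sub]
  simp only [negMulLog]
  ring

end EntropyDeficit

/-! ### Symmetric channels as densities 1 ± t. -/

section Channel

theorem eq_zero_or_eq_one_of_zmod_two (b : ZMod 2) : b = 0 ∨ b = 1 := by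
  revert b
  decide

/-- The sign `(-1)^b` of a bit `b`. -/
def bitSign (b : ZMod 2) : ℝ := if b = 0 then 1 else -1

@[simp] theorem bitSign_zero : bitSign 0 = 1 := rfl

@[simp] theorem bitSign_one : bitSign 1 = -1 := rfl

theorem bitSign_eq (b : ZMod 2) : bitSign b = 1 ∨ bitSign b = -1 := by
  unfold bitSign
  split_ifs <;> simp

theorem bitSign_add (a b : ZMod 2) : bitSign (a + b) = bitSign a * bitSign b := by
  have h : (1 : ZMod 2) + 1 = 0 := by decide
  rcases eq_zero_or_eq_one_of_zmod_two a with rfl | rfl <;>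
    rcases eq_zero_or_eq_one_of_zmod_two b with rfl | rfl <;> simp [h]

theorem abs_bitSign (b : ZMod 2) : |bitSign b| = 1 := by
  rcases bitSign_eq b with h | h <;> rw [h] <;> norm_num

theorem bitSign_sum {ι : Type*} (s : Finset ι) (f : ι → ZMod 2) :
    bitSign (∑ i ∈ s, f i) = ∏ i ∈ s, bitSign (f i) := by
  classical
  induction s using Finset.induction_on with
  | empty => simp
  | insert a s ha ih => rw [Finset.sum_insert ha, Finset.prod_insert ha, bitSign_add, ih]

variable {𝒴 : Type*} [MeasurableSpace 𝒴]

/-- The two output laws of the channel `W` have the densities `1 ± t` with respect to the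
flip-invariant probability measure `ν`, where `t` is antisymmetric under the flip. -/
structure IsBias (W : MBIOSChannel 𝒴) (ν : Measure 𝒴) (t : 𝒴 → ℝ) : Prop where
  isProb : IsProbabilityMeasure ν
  map_flip : ν.map W.flip = ν
  measurable : Measurable t
  abs_bias_le : ∀ y, |t y| ≤ 1
  flip : ∀ y, t (W.flip y) = -t y
  law : ∀ b, W.law b = ν.withDensity fun y => ENNReal.ofReal (1 + bitSign b * t y)

namespace MBIOSChannel

theorem map_flip_one (W : MBIOSChannel 𝒴) : (W.law 1).map W.flip = W.law 0 := by
  rw [← W.map_flip, Measure.map_map W.measurable_flip W.measurable_flip]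
  have : W.flip ∘ W.flip = id := funext W.flip_flip
  rw [this, Measure.map_id]

/-- ν is the mean of the two output laws, and t is half the difference of their densities with
respect to it. -/
theorem exists_isBias (W : MBIOSChannel 𝒴) : ∃ ν t, IsBias W ν t := by
  have := W.isProb
  set μ := W.law 0 + W.law 1 with hμ
  have hμflip : μ.map W.flip = μ := by
    rw [hμ, Measure.map_add _ _ W.measurable_flip, W.map_flip, W.map_flip_one, add_comm]
  let e : 𝒴 ≃ᵐ 𝒴 :=
    { toFun := W.flip, invFun := W.flip, left_inv := W.flip_flip, right_inv := W.flip_flip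
      measurable_toFun := W.measurable_flip, measurable_invFun := W.measurable_flip }
  have hemb : MeasurableEmbedding W.flip := e.measurableEmbedding
  set a := (W.law 0).rnDeriv μ with ha
  set b := (W.law 1).rnDeriv μ with hb
  have hab : ∀ᵐ y ∂μ, a y + b y = 1 := by
    filter_upwards [Measure.rnDeriv_add' (W.law 0) (W.law 1) μ, Measure.rnDeriv_self μ]
      with y h1 h2
    rw [← h2, ← Pi.add_apply, ← h1]
  have hflip : ∀ᵐ y ∂μ, b (W.flip y) = a y := by
    have := hemb.rnDeriv_map (W.law 0) μ
    rwa [W.map_flip, hμflip] at this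
  have hflip' : ∀ᵐ y ∂μ, a (W.flip y) = b y := by
    have := hemb.rnDeriv_map (W.law 1) μ
    rwa [W.map_flip_one, hμflip] at this
  -- Densities are determined only almost everywhere. Truncating, then antisymmetrising under the
  -- flip, makes |t| ≤ 1 and the flip rule hold at every point.
  let c : 𝒴 → ℝ := fun y => max (-1) (min 1 ((a y).toReal - (b y).toReal))
  let t : 𝒴 → ℝ := fun y => (c y - c (W.flip y)) / 2
  have hcm : Measurable c := by
    have h1 : Measurable a := Measure.measurable_rnDeriv _ _
    have h2 : Measurable b := Measure.measurable_rnDeriv _ _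
    fun_prop
  have hc : ∀ y, -1 ≤ c y ∧ c y ≤ 1 := fun y =>
    ⟨le_max_left _ _, max_le (by norm_num) (min_le_left _ _)⟩
  have ht : ∀ᵐ y ∂μ, a y = ENNReal.ofReal ((1 + t y) / 2) ∧
      b y = ENNReal.ofReal ((1 - t y) / 2) := by
    filter_upwards [hab, hflip, hflip'] with y h1 h2 h3
    have ha1 : a y ≤ 1 := h1 ▸ le_self_add
    have hb1 : b y ≤ 1 := h1 ▸ le_add_self
    have ha2 : a y ≠ ∞ := ne_top_of_le_ne_top ENNReal.one_ne_top ha1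
    have hb2 : b y ≠ ∞ := ne_top_of_le_ne_top ENNReal.one_ne_top hb1
    have hr : (a y).toReal + (b y).toReal = 1 := by
      rw [← ENNReal.toReal_add ha2 hb2, h1, ENNReal.toReal_one]
    have ha3 : 0 ≤ (a y).toReal := ENNReal.toReal_nonneg
    have hb3 : 0 ≤ (b y).toReal := ENNReal.toReal_nonneg
    have hty : t y = (a y).toReal - (b y).toReal := by
      simp only [t, c, h2, h3]
      rw [min_eq_right (by linarith), min_eq_right (by linarith), max_eq_right (by linarith),
        max_eq_right (by linarith)]
      ring
    constructor
    · rw [hty, ← ENNReal.ofReal_toReal ha2]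
      congr 1
      rw [ENNReal.ofReal_toReal ha2]
      linarith
    · rw [hty, ← ENNReal.ofReal_toReal hb2]
      congr 1
      rw [ENNReal.ofReal_toReal hb2]
      linarith
  have htm : Measurable t := (hcm.sub (hcm.comp W.measurable_flip)).div_const 2
  have hdens : ∀ f : 𝒴 → ℝ, Measurable f →
      μ.withDensity (fun y => ENNReal.ofReal (f y / 2)) =
        ((2 : ℝ≥0∞)⁻¹ • μ).withDensity fun y => ENNReal.ofReal (f y) := by
    intro f hf
    rw [withDensity_smul_measure, ← withDensity_smul _ (by fun_prop)]
    congr 1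
    ext y
    rw [Pi.smul_apply, smul_eq_mul, div_eq_inv_mul, ENNReal.ofReal_mul (by norm_num),
      ENNReal.ofReal_inv_of_pos two_pos, ENNReal.ofReal_ofNat]
  refine ⟨(2 : ℝ≥0∞)⁻¹ • μ, t, ⟨?_, ?_, htm, ?_, ?_, ?_⟩⟩
  · constructor
    rw [Measure.smul_apply, hμ, Measure.add_apply, measure_univ, measure_univ, one_add_one_eq_two,
      smul_eq_mul, ENNReal.inv_mul_cancel two_ne_zero ENNReal.ofNat_ne_top]
  · rw [Measure.map_smul, hμflip]
  · intro y
    rw [abs_le]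
    have h1 := hc y
    have h2 := hc (W.flip y)
    constructor <;> simp only [t] <;> linarith
  · intro y
    simp only [t, W.flip_flip]
    ring
  · intro x
    have h0 : W.law 0 ≪ μ := Measure.absolutelyContinuous_of_le (Measure.le_add_right le_rfl)
    have h1 : W.law 1 ≪ μ := Measure.absolutelyContinuous_of_le (Measure.le_add_left le_rfl)
    rcases eq_zero_or_eq_one_of_zmod_two x with rfl | rfl
    · simp only [bitSign_zero, one_mul]
      rw [← hdens _ (by fun_prop)]
      refine (Measure.withDensity_rnDeriv_eq _ _ h0).symm.trans (withDensity_congr_ae ?_)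
      filter_upwards [ht] with y hy using hy.1
    · simp only [bitSign_one, neg_one_mul, ← sub_eq_add_neg]
      rw [← hdens _ (by fun_prop)]
      refine (Measure.withDensity_rnDeriv_eq _ _ h1).symm.trans (withDensity_congr_ae ?_)
      filter_upwards [ht] with y hy using hy.2

end MBIOSChannel

end Channel

/-! ### Mutual information, capacity and the second moment of the bias. -/

section SingleLetter

variable {𝒴 : Type*} [MeasurableSpace 𝒴]

theorem mul_log_one_add_abs_le {x : ℝ} (hx : |x| ≤ 1) : |(1 + x) * Real.log (1 + x)| ≤ 2 := by
  rw [abs_le] at hx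
  have h0 : 0 ≤ 1 + x := by linarith
  have h1 := Real.one_sub_inv_le_log_of_pos (x := 1 + x)
  rw [abs_le]
  rcases h0.eq_or_lt with h | h
  · rw [← h]; norm_num
  have h2 := Real.log_le_sub_one_of_pos h
  have h3 := mul_le_mul_of_nonneg_left (h1 h) h0
  have h4 := mul_le_mul_of_nonneg_left h2 h0
  rw [mul_sub, mul_inv_cancel₀ h.ne'] at h3
  constructor <;> nlinarith

theorem klFun_le_sq_add_one {x : ℝ} (hx : 0 ≤ x) : InformationTheory.klFun x ≤ x * x + 1 := by
  rw [InformationTheory.klFun_apply]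
  rcases hx.eq_or_lt with rfl | h
  · simp
  · nlinarith [mul_le_mul_of_nonneg_left (Real.log_le_sub_one_of_pos h) hx]

/-- The density x is at most c, so `klFun` is at most x² + 1 ≤ cx + 1, which integrates to c + 1. -/
theorem klDiv_le_of_le_smul {α : Type*} [MeasurableSpace α] {μ ν : Measure α}
    [IsProbabilityMeasure μ] [IsProbabilityMeasure ν] {c : ℝ} (hc : 0 < c)
    (h : μ ≤ ENNReal.ofReal c • ν) :
    InformationTheory.klDiv μ ν ≤ ENNReal.ofReal (c + 1) := by
  have hac : μ ≪ ν := (Measure.absolutelyContinuous_of_le h).trans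
    Measure.smul_absolutelyContinuous
  have hc0 : ENNReal.ofReal c ≠ 0 := by simpa using hc
  have hfin : IsFiniteMeasure (ENNReal.ofReal c • ν) := Measure.smul_finite ν ENNReal.ofReal_ne_top
  have hle : ∀ᵐ y ∂ν, μ.rnDeriv ν y ≤ ENNReal.ofReal c := by
    have h1 : ∀ᵐ y ∂ν, μ.rnDeriv (ENNReal.ofReal c • ν) y ≤ 1 :=
      (Measure.ae_ennreal_smul_measure_iff hc0).1 (Measure.rnDeriv_le_one_of_le h)
    filter_upwards [h1, Measure.rnDeriv_smul_right_of_ne_top' μ ν hc0 ENNReal.ofReal_ne_top]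
      with y h2 h3
    rw [h3, Pi.smul_apply, smul_eq_mul, mul_comm, ← div_eq_mul_inv] at h2
    simpa using (ENNReal.div_le_iff hc0 ENNReal.ofReal_ne_top).1 h2
  rw [InformationTheory.klDiv_eq_lintegral_klFun_of_ac hac]
  calc ∫⁻ x, ENNReal.ofReal (InformationTheory.klFun (μ.rnDeriv ν x).toReal) ∂ν
      ≤ ∫⁻ x, (ENNReal.ofReal c * μ.rnDeriv ν x + 1) ∂ν := by
        refine lintegral_mono_ae ?_
        filter_upwards [hle] with y hy
        have hy' : μ.rnDeriv ν y ≠ ∞ := ne_top_of_le_ne_top ENNReal.ofReal_ne_top hy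
        have h2 : (μ.rnDeriv ν y).toReal ≤ c := ENNReal.toReal_le_of_le_ofReal hc.le hy
        have h3 : (0 : ℝ) ≤ (μ.rnDeriv ν y).toReal := ENNReal.toReal_nonneg
        calc ENNReal.ofReal (InformationTheory.klFun (μ.rnDeriv ν y).toReal)
            ≤ ENNReal.ofReal (c * (μ.rnDeriv ν y).toReal + 1) := by
              refine ENNReal.ofReal_le_ofReal ((klFun_le_sq_add_one h3).trans ?_)
              gcongr
          _ = _ := by
              rw [ENNReal.ofReal_add (by positivity) zero_le_one, ENNReal.ofReal_mul hc.le,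
                ENNReal.ofReal_toReal hy', ENNReal.ofReal_one]
    _ = ENNReal.ofReal (c + 1) := by
        rw [lintegral_add_right _ measurable_const,
          lintegral_const_mul _ (Measure.measurable_rnDeriv _ _), Measure.lintegral_rnDeriv hac,
          measure_univ, lintegral_one, measure_univ, mul_one,
          ENNReal.ofReal_add hc.le zero_le_one, ENNReal.ofReal_one]

namespace MBIOSChannel

theorem isProbabilityMeasure_mixture (W : MBIOSChannel 𝒴) (q : unitInterval) :
    IsProbabilityMeasure (W.mixture q) := by
  have := W.isProb
  constructor
  rw [mixture, Measure.add_apply, Measure.smul_apply, Measure.smul_apply, measure_univ,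
    measure_univ, smul_eq_mul, smul_eq_mul, mul_one, mul_one,
    ← ENNReal.ofReal_add (by linarith [q.2.2]) q.2.1]
  simp

theorem ofReal_mul_klDiv_le {μ ν : Measure 𝒴} [IsProbabilityMeasure μ] [IsProbabilityMeasure ν]
    {r : ℝ} (hr : 0 ≤ r) (hr1 : r ≤ 1) (h : ENNReal.ofReal r • μ ≤ ν) :
    ENNReal.ofReal r * InformationTheory.klDiv μ ν ≤ 2 := by
  rcases hr.eq_or_lt with rfl | hr
  · simp
  have hle : μ ≤ ENNReal.ofReal r⁻¹ • ν := by
    intro s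
    have h1 := h s
    rw [Measure.smul_apply, smul_eq_mul] at h1 ⊢
    rw [ENNReal.ofReal_inv_of_pos hr, mul_comm, ← div_eq_mul_inv,
      ENNReal.le_div_iff_mul_le (by simp [hr]) (by simp), mul_comm]
    exact h1
  calc ENNReal.ofReal r * InformationTheory.klDiv μ ν
      ≤ ENNReal.ofReal r * ENNReal.ofReal (r⁻¹ + 1) := by
        gcongr
        exact klDiv_le_of_le_smul (by positivity) hle
    _ = ENNReal.ofReal (1 + r) := by
        rw [← ENNReal.ofReal_mul hr.le, mul_add, mul_inv_cancel₀ hr.ne', mul_one]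
    _ ≤ ENNReal.ofReal 2 := ENNReal.ofReal_le_ofReal (by linarith)
    _ = 2 := by simp

/-- Otherwise the `toReal` in `capacity` would return its default 0 and bound nothing. Each output
law weighted by its input probability r is below the mixture, so its divergence is at most 1/r + 1,
which the weight r compensates. -/
theorem iSup_mutualInfo_ne_top (W : MBIOSChannel 𝒴) : ⨆ q, W.mutualInfo q ≠ ∞ := by
  have := W.isProb
  refine ne_top_of_le_ne_top (b := 4) (by simp) (iSup_le fun q => ?_)
  have := W.isProbabilityMeasure_mixture q
  rw [mutualInfo, show (4 : ℝ≥0∞) = 2 + 2 by norm_num]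
  refine add_le_add (ofReal_mul_klDiv_le (by linarith [q.2.2]) (by linarith [q.2.1]) ?_)
    (ofReal_mul_klDiv_le q.2.1 q.2.2 ?_)
  · exact Measure.le_add_right le_rfl
  · exact Measure.le_add_left le_rfl

end MBIOSChannel

namespace IsBias

variable {W : MBIOSChannel 𝒴} {ν : Measure 𝒴} {t : 𝒴 → ℝ}

theorem abs_sign_mul_le (h : IsBias W ν t) (b : ZMod 2) (y : 𝒴) : |bitSign b * t y| ≤ 1 := by
  rw [abs_mul, abs_bitSign, one_mul]
  exact h.abs_bias_le y

theorem density_nonneg (h : IsBias W ν t) (b : ZMod 2) (y : 𝒴) : 0 ≤ 1 + bitSign b * t y := by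
  linarith [(abs_le.1 (h.abs_sign_mul_le b y)).1]

theorem density_le_two (h : IsBias W ν t) (b : ZMod 2) (y : 𝒴) : 1 + bitSign b * t y ≤ 2 := by
  linarith [(abs_le.1 (h.abs_sign_mul_le b y)).2]

theorem measurable_density (h : IsBias W ν t) (b : ZMod 2) :
    Measurable fun y => 1 + bitSign b * t y :=
  measurable_const.add (h.measurable.const_mul _)

theorem integral_law (h : IsBias W ν t) (b : ZMod 2) (G : 𝒴 → ℝ) :
    ∫ y, G y ∂W.law b = ∫ y, (1 + bitSign b * t y) * G y ∂ν := by
  rw [h.law, integral_withDensity_eq_integral_toReal_smul (h.measurable_density b).ennreal_ofReal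
    (Filter.Eventually.of_forall fun _ => ENNReal.ofReal_lt_top)]
  simp only [ENNReal.toReal_ofReal (h.density_nonneg b _), smul_eq_mul]

theorem integral_flip (h : IsBias W ν t) {G : 𝒴 → ℝ} (hG : Measurable G) :
    ∫ y, G (W.flip y) ∂ν = ∫ y, G y ∂ν := by
  conv_rhs => rw [← h.map_flip]
  rw [integral_map W.measurable_flip.aemeasurable hG.aestronglyMeasurable]

theorem integrable_comp (h : IsBias W ν t) {G : ℝ → ℝ} (hG : Measurable G) {c : ℝ}
    (hc : ∀ x, |x| ≤ 1 → |G x| ≤ c) : Integrable (fun y => G (t y)) ν := by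
  have := h.isProb
  exact Integrable.of_bound (hG.comp h.measurable).aestronglyMeasurable c
    (Filter.Eventually.of_forall fun y => hc _ (h.abs_bias_le y))

theorem integral_bitSign (h : IsBias W ν t) {G : ℝ → ℝ} (hG : Measurable G) (b : ZMod 2) :
    ∫ y, G (bitSign b * t y) ∂ν = ∫ y, G (t y) ∂ν := by
  rcases bitSign_eq b with hb | hb
  · simp [hb]
  · rw [← h.integral_flip (G := fun y => G (t y)) (hG.comp h.measurable)]
    simp [hb, h.flip]

theorem integral_bias (h : IsBias W ν t) : ∫ y, t y ∂ν = 0 := by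
  have h1 := h.integral_bitSign measurable_id 1
  simp only [bitSign_one, neg_mul, one_mul, id, integral_neg] at h1
  linarith

end IsBias

/-- The mutual information (in nats) of the channel with output densities `1 ± t` under the uniform
input distribution. -/
noncomputable def biasInfo (ν : Measure 𝒴) (t : 𝒴 → ℝ) : ℝ :=
  ∫ y, (1 + t y) * Real.log (1 + t y) ∂ν

namespace IsBias

variable {W : MBIOSChannel 𝒴} {ν : Measure 𝒴} {t : 𝒴 → ℝ}

theorem integrable_mul_log (h : IsBias W ν t) :
    Integrable (fun y => (1 + t y) * Real.log (1 + t y)) ν :=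
  h.integrable_comp (G := fun x => (1 + x) * Real.log (1 + x)) (by fun_prop)
    fun _ hx => mul_log_one_add_abs_le hx

theorem integrable_bias (h : IsBias W ν t) : Integrable t ν :=
  h.integrable_comp measurable_id (c := 1) fun _ hx => hx

theorem integral_klFun (h : IsBias W ν t) (b : ZMod 2) :
    ∫ y, InformationTheory.klFun (1 + bitSign b * t y) ∂ν = biasInfo ν t := by
  have hm : Measurable fun x : ℝ => InformationTheory.klFun (1 + x) :=
    InformationTheory.measurable_klFun.comp (by fun_prop)
  rw [h.integral_bitSign hm b, biasInfo]
  have : ∀ y, InformationTheory.klFun (1 + t y) = (1 + t y) * Real.log (1 + t y) - t y := by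
    intro y
    rw [InformationTheory.klFun_apply]
    ring
  simp_rw [this]
  rw [integral_sub h.integrable_mul_log h.integrable_bias, h.integral_bias, sub_zero]

theorem klDiv_law (h : IsBias W ν t) (b : ZMod 2) :
    InformationTheory.klDiv (W.law b) ν = ENNReal.ofReal (biasInfo ν t) := by
  have := h.isProb
  have := W.isProb
  have hac : W.law b ≪ ν := by
    rw [h.law]
    exact withDensity_absolutelyContinuous _ _
  have hm : Measurable fun x : ℝ => InformationTheory.klFun (1 + bitSign b * x) :=
    InformationTheory.measurable_klFun.comp (by fun_prop)
  have hnn : ∀ y, 0 ≤ InformationTheory.klFun (1 + bitSign b * t y) :=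
    fun y => InformationTheory.klFun_nonneg (h.density_nonneg b y)
  have hint : Integrable (fun y => InformationTheory.klFun (1 + bitSign b * t y)) ν := by
    refine h.integrable_comp hm (c := 5) fun x hx => ?_
    have hx' : |bitSign b * x| ≤ 1 := by rwa [abs_mul, abs_bitSign, one_mul]
    rw [abs_le] at hx'
    have h0 : 0 ≤ 1 + bitSign b * x := by linarith
    rw [abs_of_nonneg (InformationTheory.klFun_nonneg h0)]
    refine (klFun_le_sq_add_one h0).trans ?_
    nlinarith
  rw [InformationTheory.klDiv_eq_lintegral_klFun_of_ac hac, ← h.integral_klFun b,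
    ofReal_integral_eq_lintegral_ofReal hint (Filter.Eventually.of_forall hnn)]
  refine lintegral_congr_ae ?_
  have h1 := Measure.rnDeriv_withDensity ν (h.measurable_density b).ennreal_ofReal
  rw [← h.law] at h1
  filter_upwards [h1] with y hy
  rw [hy, ENNReal.toReal_ofReal (h.density_nonneg b y)]

theorem law_add_law (h : IsBias W ν t) : W.law 0 + W.law 1 = (2 : ℝ≥0∞) • ν := by
  rw [h.law, h.law, ← withDensity_add_left (h.measurable_density 0).ennreal_ofReal,
    ← withDensity_const]
  congr 1
  ext y
  rw [Pi.add_apply, ← ENNReal.ofReal_add (h.density_nonneg _ _) (h.density_nonneg _ _),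
    bitSign_zero, bitSign_one, show (1 + 1 * t y + (1 + -1 * t y)) = 2 by ring,
    ENNReal.ofReal_ofNat]

theorem mutualInfo_half (h : IsBias W ν t) :
    W.mutualInfo ⟨1 / 2, by norm_num, by norm_num⟩ = ENNReal.ofReal (biasInfo ν t) := by
  have hmix : W.mixture ⟨1 / 2, by norm_num, by norm_num⟩ = ν := by
    have : (1 : ℝ) - 1 / 2 = 1 / 2 := by norm_num
    rw [MBIOSChannel.mixture]
    simp only [this]
    rw [← smul_add, h.law_add_law, smul_smul, one_div, ENNReal.ofReal_inv_of_pos two_pos,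
      ENNReal.ofReal_ofNat, ENNReal.inv_mul_cancel two_ne_zero ENNReal.ofNat_ne_top, one_smul]
  rw [MBIOSChannel.mutualInfo, hmix, h.klDiv_law, h.klDiv_law, ← add_mul,
    ← ENNReal.ofReal_add (by norm_num) (by norm_num)]
  norm_num

theorem biasInfo_nonneg (h : IsBias W ν t) : 0 ≤ biasInfo ν t := by
  rw [← h.integral_klFun 0]
  exact integral_nonneg fun y => InformationTheory.klFun_nonneg (h.density_nonneg 0 y)

/-- The uniform input is one competitor in the supremum; its optimality is not needed. -/
theorem biasInfo_le (h : IsBias W ν t) : biasInfo ν t ≤ W.capacity * Real.log 2 := by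
  have h2 : Real.log 2 ≠ 0 := (Real.log_pos one_lt_two).ne'
  rw [MBIOSChannel.capacity, div_mul_cancel₀ _ h2, ← ENNReal.toReal_ofReal h.biasInfo_nonneg,
    ← h.mutualInfo_half]
  exact ENNReal.toReal_mono W.iSup_mutualInfo_ne_top (le_iSup W.mutualInfo _)

theorem integrable_sq (h : IsBias W ν t) : Integrable (fun y => t y ^ 2) ν :=
  h.integrable_comp (G := fun x => x ^ 2) (by fun_prop) (c := 1) fun x hx => by
    rwa [abs_pow, sq_le_one_iff₀ (abs_nonneg x)]

theorem integral_sq_le_one (h : IsBias W ν t) : ∫ y, t y ^ 2 ∂ν ≤ 1 := by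
  have := h.isProb
  calc ∫ y, t y ^ 2 ∂ν ≤ ∫ _, (1 : ℝ) ∂ν :=
        integral_mono h.integrable_sq (integrable_const 1) fun y =>
          (sq_le_one_iff_abs_le_one _).2 (h.abs_bias_le y)
    _ = 1 := by simp

/-- If t vanishes almost surely, both output laws equal ν and every mutual information is 0. -/
theorem integral_sq_pos (h : IsBias W ν t) (hC : 0 < W.capacity) : 0 < ∫ y, t y ^ 2 ∂ν := by
  have := W.isProb
  refine (integral_nonneg fun y => sq_nonneg (t y)).lt_of_ne' fun h0 => hC.ne' ?_
  rw [integral_eq_zero_iff_of_nonneg (fun y => sq_nonneg (t y)) h.integrable_sq] at h0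
  have hlaw : ∀ b, W.law b = ν := by
    intro b
    rw [h.law]
    conv_rhs => rw [← withDensity_one (μ := ν)]
    refine withDensity_congr_ae ?_
    filter_upwards [h0] with y hy
    have : t y = 0 := by simpa using hy
    simp [this]
  have hI : ∀ q, W.mutualInfo q = 0 := by
    intro q
    have hmix : W.mixture q = ν := by
      rw [MBIOSChannel.mixture, hlaw, hlaw, ← add_smul,
        ← ENNReal.ofReal_add (by linarith [q.2.2]) q.2.1]
      simp
    have := h.isProb
    rw [MBIOSChannel.mutualInfo, hmix, hlaw, hlaw, InformationTheory.klDiv_self]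
    simp
  simp [MBIOSChannel.capacity, hI]

/-- If t = ±1 almost surely, the output reveals the input and the uniform input already transmits
one bit. -/
theorem integral_sq_lt_one (h : IsBias W ν t) (hC : W.capacity < 1) : ∫ y, t y ^ 2 ∂ν < 1 := by
  have := h.isProb
  refine h.integral_sq_le_one.lt_of_ne fun h1 => hC.not_ge ?_
  have h0 : ∫ y, (1 - t y ^ 2) ∂ν = 0 := by
    rw [integral_sub (integrable_const 1) h.integrable_sq, h1]
    simp
  rw [integral_eq_zero_iff_of_nonneg
    (fun y => sub_nonneg.2 ((sq_le_one_iff_abs_le_one _).2 (h.abs_bias_le y)))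
    ((integrable_const 1).sub h.integrable_sq)] at h0
  have h2 : biasInfo ν t = Real.log 2 := by
    calc biasInfo ν t = ∫ y, (1 + t y) * Real.log 2 ∂ν := by
          refine integral_congr_ae ?_
          filter_upwards [h0] with y hy
          have : t y ^ 2 = 1 := by simp only [Pi.zero_apply] at hy; linarith
          -- At t = -1 both sides vanish because of the factor 1 + t.
          rcases (sq_eq_sq_iff_eq_or_eq_neg.1 (this.trans (one_pow 2).symm)) with hy | hy
          · rw [hy]; norm_num
          · rw [hy]; norm_num
      _ = Real.log 2 := by
          rw [integral_mul_const, integral_add (integrable_const 1) h.integrable_bias,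
            h.integral_bias]
          simp
  have h3 := h.biasInfo_le
  rw [h2] at h3
  exact (le_mul_iff_one_le_left (Real.log_pos one_lt_two)).1 h3

end IsBias

end SingleLetter

/-! ### Identification of `g₁` with the second moment of the bias. -/

section LogLikelihood

variable {𝒴 : Type*} [MeasurableSpace 𝒴]

/-- The log-likelihood ratio of a bit with bias `x`. -/
noncomputable def biasLlr (x : ℝ) : EReal :=
  ENNReal.log (ENNReal.ofReal ((1 + x) / 2) / ENNReal.ofReal ((1 - x) / 2))

theorem biasLlr_one : biasLlr 1 = ⊤ := by
  norm_num [biasLlr]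

theorem biasLlr_neg_one : biasLlr (-1) = ⊥ := by
  norm_num [biasLlr]

theorem biasLlr_of_mem {x : ℝ} (h0 : -1 < x) (h1 : x < 1) :
    biasLlr x = Real.log ((1 + x) / (1 - x)) := by
  have h2 : 0 < (1 - x) / 2 := by linarith
  rw [biasLlr, ← ENNReal.ofReal_div_of_pos h2, div_div_div_cancel_right₀ two_ne_zero,
    ENNReal.log_ofReal_of_pos (div_pos (by linarith) (by linarith))]

theorem tanhHalf_biasLlr {x : ℝ} (hx : |x| ≤ 1) : tanhHalf (biasLlr x) = x := by
  rw [abs_le] at hx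
  rcases hx.2.eq_or_lt with rfl | h1
  · simp [biasLlr_one, tanhHalf]
  rcases hx.1.eq_or_lt with rfl | h0
  · simp [biasLlr_neg_one, tanhHalf]
  rw [biasLlr_of_mem h0 h1, tanhHalf, if_neg (EReal.coe_ne_top _), if_neg (EReal.coe_ne_bot _),
    EReal.toReal_coe, div_eq_inv_mul, ← one_div, ← Real.artanh_eq_half_log ⟨hx.1, hx.2⟩,
    Real.tanh_artanh ⟨h0, h1⟩]

theorem biasLlr_nonneg_iff {x : ℝ} (hx : |x| ≤ 1) : 0 ≤ biasLlr x ↔ 0 ≤ x := by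
  rw [abs_le] at hx
  rcases hx.2.eq_or_lt with rfl | h1
  · simp [biasLlr_one]
  rcases hx.1.eq_or_lt with rfl | h0
  · simp [biasLlr_neg_one]
  rw [biasLlr_of_mem h0 h1, EReal.coe_nonneg,
    Real.log_nonneg_iff (div_pos (by linarith) (by linarith)), one_le_div (by linarith)]
  constructor <;> intro h <;> linarith

/-- Here e^{-l} = (1-x)/(1+x), so the factor 1 + e^{-l} in `g₁` cancels the density 1 + t of the law
given input 0. -/
theorem one_add_mul_one_add_exp_neg_biasLlr {x : ℝ} (h0 : 0 ≤ x) (h1 : x ≤ 1) :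
    (1 + x) * (1 + (EReal.exp (-biasLlr x)).toReal) = 2 := by
  rcases h1.eq_or_lt with rfl | h1
  · norm_num [biasLlr_one]
  rw [biasLlr_of_mem (by linarith) h1, ← EReal.coe_neg, EReal.exp_coe,
    ENNReal.toReal_ofReal (Real.exp_pos _).le, Real.exp_neg,
    Real.exp_log (div_pos (by linarith) (by linarith))]
  have : 1 - x ≠ 0 := by linarith
  have : 1 + x ≠ 0 := by linarith
  field_simp
  ring

theorem measurable_tanhHalf : Measurable tanhHalf := by
  unfold tanhHalf
  refine Measurable.ite (measurableSet_singleton _) measurable_const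
    (Measurable.ite (measurableSet_singleton _) measurable_const ?_)
  have h : Measurable Real.tanh := by
    rw [funext Real.tanh_eq_sinh_div_cosh]
    exact Real.measurable_sinh.div Real.measurable_cosh
  exact h.comp (measurable_ereal_toReal.div_const 2)

theorem MBIOSChannel.measurable_llr (W : MBIOSChannel 𝒴) : Measurable W.llr :=
  ENNReal.measurable_log.comp
    ((Measure.measurable_rnDeriv _ _).div (Measure.measurable_rnDeriv _ _))

namespace IsBias

variable {W : MBIOSChannel 𝒴} {ν : Measure 𝒴} {t : 𝒴 → ℝ}

theorem rnDeriv_law (h : IsBias W ν t) (b : ZMod 2) :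
    (W.law b).rnDeriv (W.law 0 + W.law 1) =ᵐ[ν]
      fun y => ENNReal.ofReal ((1 + bitSign b * t y) / 2) := by
  have := W.isProb
  have hm : Measurable fun y => ENNReal.ofReal ((1 + bitSign b * t y) / 2) :=
    ((h.measurable_density b).div_const 2).ennreal_ofReal
  have h1 : W.law b = (W.law 0 + W.law 1).withDensity
      fun y => ENNReal.ofReal ((1 + bitSign b * t y) / 2) := by
    rw [h.law_add_law, withDensity_smul_measure, ← withDensity_smul _ hm, h.law]
    congr 1
    ext y
    rw [Pi.smul_apply, smul_eq_mul, ← ENNReal.ofReal_ofNat, ← ENNReal.ofReal_mul (by norm_num)]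
    congr 1
    ring
  have h2 := Measure.rnDeriv_withDensity (W.law 0 + W.law 1) hm
  rw [← h1] at h2
  have hac : ν ≪ W.law 0 + W.law 1 := by
    rw [h.law_add_law]
    exact Measure.absolutelyContinuous_smul two_ne_zero
  exact hac.ae_le h2

theorem llr_ae_eq (h : IsBias W ν t) : W.llr =ᵐ[ν] fun y => biasLlr (t y) := by
  filter_upwards [h.rnDeriv_law 0, h.rnDeriv_law 1] with y h0 h1
  rw [MBIOSChannel.llr, h0, h1, bitSign_zero, bitSign_one, one_mul, neg_one_mul,
    ← sub_eq_add_neg, biasLlr]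

/-- Over ν the integrand becomes 2t² on {t ≥ 0}. By flip symmetry this half carries as much as {t ≤
0}, and the two halves together give 2∫t². -/
theorem g₁_eq (h : IsBias W ν t) : W.g₁ = ∫ y, t y ^ 2 ∂ν := by
  have hm : Measurable fun l : EReal => (1 + (EReal.exp (-l)).toReal) * tanhHalf l ^ 2 :=
    (measurable_const.add
      (EReal.measurable_exp.comp measurable_neg).ennreal_toReal).mul (measurable_tanhHalf.pow_const 2)
  rw [MBIOSChannel.g₁, ← integral_indicator measurableSet_Ici, MBIOSChannel.llrLaw,
    integral_map W.measurable_llr.aemeasurable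
      (hm.indicator measurableSet_Ici).aestronglyMeasurable, h.integral_law]
  have h1 : ∫ y, (1 + bitSign 0 * t y) * (Set.Ici (0 : EReal)).indicator
      (fun l : EReal => (1 + (EReal.exp (-l)).toReal) * tanhHalf l ^ 2) (W.llr y) ∂ν =
      ∫ y, (if 0 ≤ t y then 2 * t y ^ 2 else 0) ∂ν := by
    refine integral_congr_ae ?_
    filter_upwards [h.llr_ae_eq] with y hy
    have hle := h.abs_bias_le y
    rw [hy, bitSign_zero, one_mul]
    by_cases h0 : 0 ≤ t y
    · rw [if_pos h0, Set.indicator_of_mem (Set.mem_Ici.2 ((biasLlr_nonneg_iff hle).2 h0)), ← mul_assoc,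
        one_add_mul_one_add_exp_neg_biasLlr h0 (abs_le.1 hle).2, tanhHalf_biasLlr hle]
    · rw [if_neg h0, Set.indicator_of_notMem
        (fun hmem => h0 ((biasLlr_nonneg_iff hle).1 (Set.mem_Ici.1 hmem))),
        mul_zero]
  rw [h1]
  set G : ℝ → ℝ := fun x => if 0 ≤ x then 2 * x ^ 2 else 0
  have hG : Measurable G := Measurable.ite measurableSet_Ici (by fun_prop) measurable_const
  have hGb : ∀ x, |x| ≤ 1 → |G x| ≤ 2 := by
    intro x hx
    have : x ^ 2 ≤ 1 := (sq_le_one_iff_abs_le_one _).2 hx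
    simp only [G]
    split_ifs
    · rw [abs_of_nonneg (by positivity)]; linarith
    · norm_num
  have hint : Integrable (fun y => G (t y)) ν := h.integrable_comp hG hGb
  have hint' : Integrable (fun y => G (-t y)) ν :=
    h.integrable_comp (G := fun x => G (-x)) (hG.comp measurable_neg)
      fun x hx => hGb _ (by rwa [abs_neg])
  have h2 := h.integral_bitSign hG 1
  simp only [bitSign_one, neg_one_mul] at h2
  have h3 : ∫ y, (G (t y) + G (-t y)) ∂ν = ∫ y, 2 * t y ^ 2 ∂ν := by
    refine integral_congr_ae (Filter.Eventually.of_forall fun y => ?_)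
    simp only [G]
    rcases lt_trichotomy (t y) 0 with h | h | h
    · rw [if_neg (not_le.2 h), if_pos (by linarith)]; ring
    · simp [h]
    · rw [if_pos h.le, if_neg (by linarith)]; ring
  rw [integral_add hint hint', h2, integral_const_mul] at h3
  change ∫ y, G (t y) ∂ν = _
  linarith

end IsBias

end LogLikelihood

/-! ### Product densities, bit flips and check biases. -/

section Words

variable {𝒴 : Type*} [MeasurableSpace 𝒴] {n : ℕ}

theorem MeasureTheory.Measure.pi_withDensity_ofReal {ι : Type*} [Fintype ι] (ν : Measure 𝒴)
    [IsProbabilityMeasure ν] (f : ι → 𝒴 → ℝ) (hf : ∀ i, Integrable (f i) ν)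
    (h0 : ∀ i y, 0 ≤ f i y) :
    Measure.pi (fun i => ν.withDensity fun y => ENNReal.ofReal (f i y)) =
      (Measure.pi fun _ : ι => ν).withDensity fun y => ENNReal.ofReal (∏ i, f i (y i)) := by
  have : ∀ i, IsFiniteMeasure (ν.withDensity fun y => ENNReal.ofReal (f i y)) :=
    fun i => isFiniteMeasure_withDensity_ofReal (hf i).2
  refine (Measure.pi_eq fun s hs => ?_)
  have hind : ∀ y : ι → 𝒴, (Set.univ.pi s).indicator
      (fun y => ENNReal.ofReal (∏ i, f i (y i))) y =
      ENNReal.ofReal (∏ i, (s i).indicator (f i) (y i)) := by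
    intro y
    by_cases hy : y ∈ Set.univ.pi s
    · rw [Set.indicator_of_mem hy]
      congr 1
      exact Finset.prod_congr rfl fun i _ => (Set.indicator_of_mem (hy i trivial) _).symm
    · rw [Set.indicator_of_notMem hy]
      simp only [Set.mem_pi, Set.mem_univ, true_implies, not_forall] at hy
      obtain ⟨i, hi⟩ := hy
      rw [Finset.prod_eq_zero (Finset.mem_univ i) (Set.indicator_of_notMem hi _),
        ENNReal.ofReal_zero]
  have hsint : ∀ i, Integrable ((s i).indicator (f i)) ν := fun i => (hf i).indicator (hs i)
  have hs0 : ∀ i y, 0 ≤ (s i).indicator (f i) y := fun i y =>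
    Set.indicator_nonneg (fun y _ => h0 i y) y
  rw [withDensity_apply _ (MeasurableSet.univ_pi hs),
    ← lintegral_indicator (MeasurableSet.univ_pi hs)]
  simp_rw [hind]
  rw [← ofReal_integral_eq_lintegral_ofReal (Integrable.fintype_prod hsint)
      (Filter.Eventually.of_forall fun y => Finset.prod_nonneg fun i _ => hs0 i _),
    integral_fintype_prod_eq_prod, ENNReal.ofReal_prod_of_nonneg
      (fun i _ => integral_nonneg (hs0 i))]
  refine Finset.prod_congr rfl fun i _ => ?_
  rw [ofReal_integral_eq_lintegral_ofReal (hsint i) (Filter.Eventually.of_forall (hs0 i)),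
    withDensity_apply _ (hs i), ← lintegral_indicator (hs i)]
  refine lintegral_congr fun y => ?_
  by_cases hy : y ∈ s i <;> simp [hy]

/-- The density of the law of the received word given the transmitted word `x`. -/
def wordDensity (t : 𝒴 → ℝ) (x : Fin n → ZMod 2) (y : Fin n → 𝒴) : ℝ :=
  ∏ i, (1 + bitSign (x i) * t (y i))

/-- The bias of the parity of the bits in `S`, given the received word. -/
def checkBias (t : 𝒴 → ℝ) (S : Finset (Fin n)) (y : Fin n → 𝒴) : ℝ := ∏ i ∈ S, t (y i)

/-- The word obtained by flipping the symbols at the support of `σ`. -/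
def MBIOSChannel.flipWord (W : MBIOSChannel 𝒴) (σ : Fin n → ZMod 2) (y : Fin n → 𝒴) :
    Fin n → 𝒴 :=
  fun i => if σ i = 0 then y i else W.flip (y i)

namespace IsBias

variable {W : MBIOSChannel 𝒴} {ν : Measure 𝒴} {t : 𝒴 → ℝ}

theorem bias_flipWord (h : IsBias W ν t) (σ : Fin n → ZMod 2) (y : Fin n → 𝒴) (i : Fin n) :
    t (W.flipWord σ y i) = bitSign (σ i) * t (y i) := by
  unfold MBIOSChannel.flipWord bitSign
  split_ifs
  · rw [one_mul]
  · rw [h.flip, neg_one_mul]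

theorem measurePreserving_flipWord (h : IsBias W ν t) (σ : Fin n → ZMod 2) :
    MeasurePreserving (W.flipWord σ) (Measure.pi fun _ => ν) (Measure.pi fun _ => ν) := by
  have := h.isProb
  refine measurePreserving_pi (fun _ => ν) (fun _ => ν)
    (f := fun i y => if σ i = 0 then y else W.flip y) fun i => ?_
  by_cases hi : σ i = 0
  · simp only [hi, if_true]
    exact MeasurePreserving.id ν
  · simp only [hi, if_false]
    exact ⟨W.measurable_flip, h.map_flip⟩

theorem integral_flipWord (h : IsBias W ν t) (σ : Fin n → ZMod 2) {G : (Fin n → 𝒴) → ℝ}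
    (hG : Measurable G) :
    ∫ y, G (W.flipWord σ y) ∂(Measure.pi fun _ => ν) = ∫ y, G y ∂(Measure.pi fun _ => ν) := by
  have hp := h.measurePreserving_flipWord σ
  conv_rhs => rw [← hp.map_eq]
  rw [integral_map hp.measurable.aemeasurable hG.aestronglyMeasurable]

theorem measurable_wordDensity (h : IsBias W ν t) (x : Fin n → ZMod 2) :
    Measurable (wordDensity t x) := by
  have := h.measurable
  unfold wordDensity
  fun_prop

theorem measurable_checkBias (h : IsBias W ν t) (S : Finset (Fin n)) :
    Measurable (checkBias t S) := by
  have := h.measurable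
  unfold checkBias
  fun_prop

theorem wordDensity_nonneg (h : IsBias W ν t) (x : Fin n → ZMod 2) (y : Fin n → 𝒴) :
    0 ≤ wordDensity t x y :=
  Finset.prod_nonneg fun _ _ => h.density_nonneg _ _

theorem wordDensity_le (h : IsBias W ν t) (x : Fin n → ZMod 2) (y : Fin n → 𝒴) :
    wordDensity t x y ≤ 2 ^ n := by
  calc wordDensity t x y ≤ ∏ _i : Fin n, (2 : ℝ) :=
        Finset.prod_le_prod (fun _ _ => h.density_nonneg _ _) fun _ _ => h.density_le_two _ _
    _ = 2 ^ n := by simp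

theorem abs_checkBias_le (h : IsBias W ν t) (S : Finset (Fin n)) (y : Fin n → 𝒴) :
    |checkBias t S y| ≤ 1 := by
  rw [checkBias, Finset.abs_prod]
  exact Finset.prod_le_one (fun _ _ => abs_nonneg _) fun _ _ => h.abs_bias_le _

theorem checkBias_flipWord (h : IsBias W ν t) (σ : Fin n → ZMod 2) (S : Finset (Fin n))
    (y : Fin n → 𝒴) :
    checkBias t S (W.flipWord σ y) = bitSign (∑ i ∈ S, σ i) * checkBias t S y := by
  simp only [checkBias, h.bias_flipWord, bitSign_sum, Finset.prod_mul_distrib]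

theorem wordDensity_flipWord (h : IsBias W ν t) (σ x : Fin n → ZMod 2) (y : Fin n → 𝒴) :
    wordDensity t x (W.flipWord σ y) = wordDensity t (x + σ) y := by
  simp only [wordDensity, h.bias_flipWord, Pi.add_apply, bitSign_add, mul_assoc]

theorem wordLaw_eq (h : IsBias W ν t) (x : Fin n → ZMod 2) :
    W.wordLaw x =
      (Measure.pi fun _ => ν).withDensity fun y => ENNReal.ofReal (wordDensity t x y) := by
  have := h.isProb
  rw [MBIOSChannel.wordLaw]
  simp only [h.law]
  refine Measure.pi_withDensity_ofReal ν (fun i y => 1 + bitSign (x i) * t y) (fun i => ?_)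
    (fun i y => h.density_nonneg _ _)
  exact (integrable_const 1).add (h.integrable_bias.const_mul _)

theorem integral_wordLaw (h : IsBias W ν t) (x : Fin n → ZMod 2) (G : (Fin n → 𝒴) → ℝ) :
    ∫ y, G y ∂W.wordLaw x = ∫ y, wordDensity t x y * G y ∂(Measure.pi fun _ => ν) := by
  rw [h.wordLaw_eq, integral_withDensity_eq_integral_toReal_smul
    (h.measurable_wordDensity x).ennreal_ofReal
    (Filter.Eventually.of_forall fun _ => ENNReal.ofReal_lt_top)]
  simp only [ENNReal.toReal_ofReal (h.wordDensity_nonneg x _), smul_eq_mul]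

theorem integral_wordDensity (h : IsBias W ν t) (x : Fin n → ZMod 2) :
    ∫ y, wordDensity t x y ∂(Measure.pi fun _ => ν) = 1 := by
  have := W.isProb
  have h1 := h.integral_wordLaw x fun _ => 1
  have : IsProbabilityMeasure (W.wordLaw x) := by
    unfold MBIOSChannel.wordLaw
    infer_instance
  simpa using h1.symm

theorem integrable_of_abs_le (h : IsBias W ν t) {G : (Fin n → 𝒴) → ℝ} (hG : Measurable G) {c : ℝ}
    (hc : ∀ y, |G y| ≤ c) : Integrable G (Measure.pi fun _ => ν) := by
  have := h.isProb
  exact Integrable.of_bound hG.aestronglyMeasurable c (Filter.Eventually.of_forall hc)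

theorem integrable_wordDensity (h : IsBias W ν t) (x : Fin n → ZMod 2) :
    Integrable (wordDensity t x) (Measure.pi fun _ => ν) :=
  h.integrable_of_abs_le (h.measurable_wordDensity x) (c := 2 ^ n) fun y => by
    rw [abs_of_nonneg (h.wordDensity_nonneg x y)]
    exact h.wordDensity_le x y

theorem prod_one_add_checkBias_nonneg (h : IsBias W ν t) {m : ℕ} (S : Fin m → Finset (Fin n))
    (y : Fin n → 𝒴) : 0 ≤ ∏ j, (1 + checkBias t (S j) y) :=
  Finset.prod_nonneg fun j _ => by linarith [(abs_le.1 (h.abs_checkBias_le (S j) y)).1]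

theorem integrable_prod_one_add_checkBias (h : IsBias W ν t) {m : ℕ} (S : Fin m → Finset (Fin n)) :
    Integrable (fun y => ∏ j, (1 + checkBias t (S j) y)) (Measure.pi fun _ => ν) := by
  have hm := fun j => h.measurable_checkBias (S j)
  refine h.integrable_of_abs_le (by fun_prop) (c := ∏ _j : Fin m, 2) fun y => ?_
  rw [abs_of_nonneg (h.prod_one_add_checkBias_nonneg S y)]
  refine Finset.prod_le_prod (fun j _ => ?_) fun j _ => ?_ <;>
    linarith [(abs_le.1 (h.abs_checkBias_le (S j) y)).1,
      (abs_le.1 (h.abs_checkBias_le (S j) y)).2]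

/-- Expand the product over sets of checks. For a nonempty set, flipping the output along a word
violating exactly one of its checks negates the term but preserves the measure, so only the empty
set contributes. -/
theorem integral_prod_one_add_checkBias (h : IsBias W ν t) {m : ℕ} (S : Fin m → Finset (Fin n))
    (hS : ∀ j, ∃ σ : Fin n → ZMod 2, ∀ k, ∑ i ∈ S k, σ i = if k = j then 1 else 0) :
    ∫ y, ∏ j, (1 + checkBias t (S j) y) ∂(Measure.pi fun _ => ν) = 1 := by
  have := h.isProb
  have hm := fun j => h.measurable_checkBias (S j)
  have hJm : ∀ J : Finset (Fin m), Measurable fun y => ∏ j ∈ J, checkBias t (S j) y :=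
    fun J => by fun_prop
  simp_rw [Finset.prod_one_add]
  rw [integral_finsetSum]
  · rw [Finset.sum_eq_single_of_mem ∅ (Finset.mem_powerset.2 (Finset.empty_subset _))]
    · simp
    · intro J _ hJ
      obtain ⟨j, hj⟩ := Finset.nonempty_iff_ne_empty.2 hJ
      obtain ⟨σ, hσ⟩ := hS j
      have h1 := h.integral_flipWord σ (hJm J)
      have h2 : ∀ y, ∏ k ∈ J, checkBias t (S k) (W.flipWord σ y) =
          -∏ k ∈ J, checkBias t (S k) y := by
        intro y
        simp only [h.checkBias_flipWord, Finset.prod_mul_distrib, hσ]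
        rw [Finset.prod_eq_single_of_mem j hj (fun k _ hk => by rw [if_neg hk, bitSign_zero])]
        simp
      simp only [h2, integral_neg] at h1
      linarith
  · intro J _
    refine h.integrable_of_abs_le (hJm J) (c := 1) fun y => ?_
    rw [Finset.abs_prod]
    exact Finset.prod_le_one (fun _ _ => abs_nonneg _) fun _ _ => h.abs_checkBias_le _ _

theorem integral_checkBias_sq (h : IsBias W ν t) (S : Finset (Fin n)) :
    ∫ y, checkBias t S y ^ 2 ∂(Measure.pi fun _ => ν) = (∫ y, t y ^ 2 ∂ν) ^ S.card := by
  have := h.isProb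
  have h1 : ∀ y : Fin n → 𝒴, checkBias t S y ^ 2 = ∏ i, if i ∈ S then t (y i) ^ 2 else 1 := by
    intro y
    rw [checkBias, ← Finset.prod_pow, Finset.prod_ite_mem, Finset.univ_inter]
  simp_rw [h1]
  rw [integral_fintype_prod_eq_prod (fun i y => if i ∈ S then t y ^ 2 else 1)]
  rw [← Finset.prod_const, ← Finset.univ_inter S, ← Finset.prod_ite_mem]
  refine Finset.prod_congr rfl fun i _ => ?_
  by_cases hi : i ∈ S <;> simp [hi]

theorem abs_sign_mul_checkBias_le (h : IsBias W ν t) (b : ZMod 2) (S : Finset (Fin n))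
    (y : Fin n → 𝒴) : |bitSign b * checkBias t S y| ≤ 1 := by
  rw [abs_mul, abs_bitSign, one_mul]
  exact h.abs_checkBias_le S y

/-- This domination tames the singularity of the logarithm: density times log(1 ± u) stays bounded,
and the check factors are positive wherever the density is. -/
theorem wordDensity_le_mul_one_add_checkBias (h : IsBias W ν t) (x : Fin n → ZMod 2)
    (S : Finset (Fin n)) (y : Fin n → 𝒴) :
    wordDensity t x y ≤ 2 ^ n * (1 + bitSign (∑ i ∈ S, x i) * checkBias t S y) := by
  have key : ∀ A : Finset (Fin n), ∏ i ∈ A, (1 + bitSign (x i) * t (y i)) ≤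
      2 ^ A.card * (1 + ∏ i ∈ A, (bitSign (x i) * t (y i))) := by
    intro A
    induction A using Finset.induction_on with
    | empty => norm_num
    | insert a A ha ih =>
      rw [Finset.prod_insert ha, Finset.prod_insert ha, Finset.card_insert_of_notMem ha]
      have h1 : |∏ i ∈ A, (bitSign (x i) * t (y i))| ≤ 1 := by
        rw [Finset.abs_prod]
        exact Finset.prod_le_one (fun _ _ => abs_nonneg _) fun _ _ => h.abs_sign_mul_le _ _
      rw [abs_le] at h1
      have h2 := abs_le.1 (h.abs_sign_mul_le (x a) (y a))
      have h3 := mul_le_mul_of_nonneg_left ih (h.density_nonneg (x a) (y a))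
      refine h3.trans ?_
      -- (1+a)(1+b) ≤ 2(1+ab) is a rearrangement of (1-a)(1-b) ≥ 0.
      have h4 : (0 : ℝ) ≤ 2 ^ A.card * ((1 - bitSign (x a) * t (y a)) *
          (1 - ∏ i ∈ A, (bitSign (x i) * t (y i)))) :=
        mul_nonneg (by positivity) (mul_nonneg (by linarith) (by linarith))
      rw [pow_succ]
      nlinarith
  have hS : ∏ i ∈ S, (bitSign (x i) * t (y i)) =
      bitSign (∑ i ∈ S, x i) * checkBias t S y := by
    rw [Finset.prod_mul_distrib, ← bitSign_sum, checkBias]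
  rw [wordDensity, ← Finset.prod_mul_prod_compl S]
  have h1 := key S
  rw [hS] at h1
  have h2 : ∏ i ∈ Sᶜ, (1 + bitSign (x i) * t (y i)) ≤ 2 ^ Sᶜ.card := by
    rw [← Finset.prod_const]
    exact Finset.prod_le_prod (fun _ _ => h.density_nonneg _ _) fun _ _ => h.density_le_two _ _
  have h3 : (0 : ℝ) ≤ 1 + bitSign (∑ i ∈ S, x i) * checkBias t S y := by linarith [(abs_le.1 (h.abs_sign_mul_checkBias_le (∑ i ∈ S, x i) S y)).1]
  calc _ ≤ 2 ^ S.card * (1 + bitSign (∑ i ∈ S, x i) * checkBias t S y) * 2 ^ Sᶜ.card :=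
        mul_le_mul h1 h2 (Finset.prod_nonneg fun _ _ => h.density_nonneg _ _) (by positivity)
    _ = 2 ^ n * (1 + bitSign (∑ i ∈ S, x i) * checkBias t S y) := by
        rw [mul_right_comm, ← pow_add, Finset.card_add_card_compl, Fintype.card_fin]

theorem measurable_wordDensity_mul_log (h : IsBias W ν t) (x : Fin n → ZMod 2)
    (S : Finset (Fin n)) :
    Measurable fun y => wordDensity t x y * Real.log (1 + bitSign (∑ i ∈ S, x i) * checkBias t S y) := by
  have h1 := h.measurable_wordDensity x
  have h2 := h.measurable_checkBias S
  fun_prop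

theorem integrable_wordDensity_mul_log (h : IsBias W ν t) (x : Fin n → ZMod 2)
    (S : Finset (Fin n)) :
    Integrable (fun y => wordDensity t x y * Real.log (1 + bitSign (∑ i ∈ S, x i) * checkBias t S y))
      (Measure.pi fun _ => ν) := by
  refine h.integrable_of_abs_le (h.measurable_wordDensity_mul_log x S) (c := 2 ^ n * 2) fun y => ?_
  have h1 := mul_log_one_add_abs_le (h.abs_sign_mul_checkBias_le (∑ i ∈ S, x i) S y)
  have h2 : (0 : ℝ) ≤ 1 + bitSign (∑ i ∈ S, x i) * checkBias t S y := by linarith [(abs_le.1 (h.abs_sign_mul_checkBias_le (∑ i ∈ S, x i) S y)).1]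
  rw [abs_mul, abs_of_nonneg h2] at h1
  rw [abs_mul, abs_of_nonneg (h.wordDensity_nonneg x y)]
  calc _ ≤ 2 ^ n * (1 + bitSign (∑ i ∈ S, x i) * checkBias t S y) * |Real.log (1 + bitSign (∑ i ∈ S, x i) * checkBias t S y)| :=
        mul_le_mul_of_nonneg_right (h.wordDensity_le_mul_one_add_checkBias x S y) (abs_nonneg _)
    _ ≤ _ := by
        rw [mul_assoc]
        gcongr

end IsBias

/-- The weight is 2 on words of even parity over S and 0 on the others, so 1 + u_S appears as the
output density for a random word satisfying the check. -/
theorem sum_sign_mul_wordDensity {𝒳 : Type*} (t : 𝒳 → ℝ) (S : Finset (Fin n)) (y : Fin n → 𝒳) :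
    ∑ σ : Fin n → ZMod 2, (1 + bitSign (∑ i ∈ S, σ i)) * wordDensity t σ y =
      2 ^ n * (1 + checkBias t S y) := by
  have h1 : ∑ σ : Fin n → ZMod 2, wordDensity t σ y = 2 ^ n := by
    simp only [wordDensity]
    rw [← Fintype.prod_sum (fun i b => 1 + bitSign b * t (y i))]
    have : ∀ i : Fin n, ∑ b : ZMod 2, (1 + bitSign b * t (y i)) = 2 := by
      intro i
      rw [show (Finset.univ : Finset (ZMod 2)) = {0, 1} from rfl, Finset.sum_pair (by decide)]
      simp only [bitSign_zero, bitSign_one]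
      ring
    simp [this]
  have h2 : ∑ σ : Fin n → ZMod 2, bitSign (∑ i ∈ S, σ i) * wordDensity t σ y =
      2 ^ n * checkBias t S y := by
    have h3 : ∀ σ : Fin n → ZMod 2, bitSign (∑ i ∈ S, σ i) * wordDensity t σ y =
        ∏ i, (if i ∈ S then bitSign (σ i) else 1) * (1 + bitSign (σ i) * t (y i)) := by
      intro σ
      rw [Finset.prod_mul_distrib, Finset.prod_ite_mem, Finset.univ_inter, bitSign_sum,
        wordDensity]
    simp only [h3]
    rw [← Fintype.prod_sum
      (fun i b => (if i ∈ S then bitSign b else 1) * (1 + bitSign b * t (y i)))]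
    have : ∀ i : Fin n, ∑ b : ZMod 2, (if i ∈ S then bitSign b else 1) *
        (1 + bitSign b * t (y i)) = 2 * if i ∈ S then t (y i) else 1 := by
      intro i
      rw [show (Finset.univ : Finset (ZMod 2)) = {0, 1} from rfl, Finset.sum_pair (by decide)]
      simp only [bitSign_zero, bitSign_one]
      split_ifs <;> ring
    simp only [this]
    rw [Finset.prod_mul_distrib, Finset.prod_ite_mem, Finset.univ_inter, checkBias]
    simp
  simp only [add_mul, one_mul, Finset.sum_add_distrib, h1, h2]
  ring

end Words

/-! ### Expected logarithm of a check factor. -/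

section Checks

variable {𝒴 : Type*} [MeasurableSpace 𝒴] {n : ℕ}

theorem sum_one_add_sign {S : Finset (Fin n)} (hS : S.Nonempty) :
    ∑ σ : Fin n → ZMod 2, (1 + bitSign (∑ i ∈ S, σ i)) = 2 ^ n := by
  -- With t = 0 all densities are 1, and the identity merely counts words.
  have h := sum_sign_mul_wordDensity (fun _ : Unit => 0) S (fun _ => ())
  simpa [wordDensity, checkBias, hS.card_ne_zero] using h

namespace IsBias

variable {W : MBIOSChannel 𝒴} {ν : Measure 𝒴} {t : 𝒴 → ℝ}

/-- By channel symmetry the law of u_S is the same for all words of even parity over S, so a fixed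
word may be replaced by the average over all of them, whose density is 1 + u_S. -/
theorem integral_wordDensity_mul_log_checkBias (h : IsBias W ν t) {x : Fin n → ZMod 2}
    {S : Finset (Fin n)} (hS : S.Nonempty) (hx : ∑ i ∈ S, x i = 0) :
    ∫ y, wordDensity t x y * Real.log (1 + checkBias t S y) ∂(Measure.pi fun _ => ν) =
      ∫ y, (1 + checkBias t S y) * Real.log (1 + checkBias t S y) ∂(Measure.pi fun _ => ν) := by
  set I := ∫ y, wordDensity t x y * Real.log (1 + checkBias t S y) ∂(Measure.pi fun _ => ν)
  have hint : Integrable (fun y => wordDensity t x y * Real.log (1 + checkBias t S y))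
      (Measure.pi fun _ => ν) := by
    simpa [hx] using h.integrable_wordDensity_mul_log x S
  -- For odd σ both sides have weight 0. For even σ, flipping along x + σ carries the density of x
  -- to that of σ and fixes the check bias.
  have hterm : ∀ σ : Fin n → ZMod 2, ∀ y,
      (1 + bitSign (∑ i ∈ S, σ i)) * wordDensity t σ y * Real.log (1 + checkBias t S y) =
      (1 + bitSign (∑ i ∈ S, σ i)) * (wordDensity t x (W.flipWord (x + σ) y) *
        Real.log (1 + checkBias t S (W.flipWord (x + σ) y))) := by
    intro σ y
    have h1 : x + (x + σ) = σ := by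
      ext i
      simp [← add_assoc, CharTwo.add_self_eq_zero]
    rw [h.wordDensity_flipWord, h1, h.checkBias_flipWord]
    simp only [Pi.add_apply, Finset.sum_add_distrib, hx, zero_add]
    rcases bitSign_eq (∑ i ∈ S, σ i) with hs | hs <;> rw [hs] <;> ring_nf
  have hm := h.measurable_wordDensity_mul_log x S
  simp only [hx, bitSign_zero, one_mul] at hm
  have h2 : ∀ σ : Fin n → ZMod 2, ∫ y, (1 + bitSign (∑ i ∈ S, σ i)) * wordDensity t σ y *
      Real.log (1 + checkBias t S y) ∂(Measure.pi fun _ => ν) =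
      (1 + bitSign (∑ i ∈ S, σ i)) * I := by
    intro σ
    simp_rw [hterm σ]
    rw [integral_const_mul, h.integral_flipWord (x + σ) hm]
  have h3 : ∀ σ : Fin n → ZMod 2, Integrable (fun y => (1 + bitSign (∑ i ∈ S, σ i)) *
      wordDensity t σ y * Real.log (1 + checkBias t S y)) (Measure.pi fun _ => ν) := by
    intro σ
    simp_rw [hterm σ]
    exact ((h.measurePreserving_flipWord (x + σ)).integrable_comp_of_integrable hint).const_mul _
  have h4 : ∫ y, ∑ σ : Fin n → ZMod 2, (1 + bitSign (∑ i ∈ S, σ i)) * wordDensity t σ y *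
      Real.log (1 + checkBias t S y) ∂(Measure.pi fun _ => ν) = 2 ^ n * I := by
    rw [integral_finsetSum _ fun σ _ => h3 σ]
    simp only [h2]
    rw [← Finset.sum_mul, sum_one_add_sign hS]
  simp_rw [← Finset.sum_mul, sum_sign_mul_wordDensity, mul_assoc] at h4
  rw [integral_const_mul] at h4
  exact (mul_left_cancel₀ (by positivity) h4).symm

/-- Flipping one symbol of S negates u_S and preserves the measure, so u_S may be averaged with
-u_S. -/
theorem integral_mul_log_checkBias (h : IsBias W ν t) {S : Finset (Fin n)} (hS : S.Nonempty) :
    ∫ y, (1 + checkBias t S y) * Real.log (1 + checkBias t S y) ∂(Measure.pi fun _ => ν) =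
      ∫ y, entropyDeficit (checkBias t S y ^ 2) ∂(Measure.pi fun _ => ν) := by
  obtain ⟨a, ha⟩ := hS
  have hu := h.measurable_checkBias S
  have hm : Measurable fun y => (1 + checkBias t S y) * Real.log (1 + checkBias t S y) := by
    fun_prop
  have hm' : Measurable fun y => (1 - checkBias t S y) * Real.log (1 - checkBias t S y) := by
    fun_prop
  have h1 := h.integral_flipWord (Pi.single a 1) hm
  have h2 : ∑ i ∈ S, (Pi.single a 1 : Fin n → ZMod 2) i = 1 := by
    simp [ha]
  simp only [h.checkBias_flipWord, h2, bitSign_one, neg_one_mul, ← sub_eq_add_neg] at h1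
  have hi : Integrable (fun y => (1 + checkBias t S y) * Real.log (1 + checkBias t S y))
      (Measure.pi fun _ => ν) :=
    h.integrable_of_abs_le hm fun y => mul_log_one_add_abs_le (h.abs_checkBias_le S y)
  have hi' : Integrable (fun y => (1 - checkBias t S y) * Real.log (1 - checkBias t S y))
      (Measure.pi fun _ => ν) :=
    h.integrable_of_abs_le hm' (c := 2) fun y => by
      have := mul_log_one_add_abs_le (x := -checkBias t S y)
        (by rw [abs_neg]; exact h.abs_checkBias_le S y)
      simpa [sub_eq_add_neg] using this
  simp_rw [entropyDeficit_sq]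
  rw [integral_div, integral_add hi hi', h1]
  ring

/-- Jensen for the convex deficit, combined with the factorisation of the second moment of u_S. -/
theorem entropyDeficit_le_integral (h : IsBias W ν t) {x : Fin n → ZMod 2}
    {S : Finset (Fin n)} (hS : S.Nonempty) (hx : ∑ i ∈ S, x i = 0) :
    entropyDeficit ((∫ y, t y ^ 2 ∂ν) ^ S.card) ≤
      ∫ y, wordDensity t x y * Real.log (1 + checkBias t S y) ∂(Measure.pi fun _ => ν) := by
  have := h.isProb
  have hu := h.measurable_checkBias S
  have hle : ∀ y, checkBias t S y ^ 2 ≤ 1 := fun y =>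
    (sq_le_one_iff_abs_le_one _).2 (h.abs_checkBias_le S y)
  rw [h.integral_wordDensity_mul_log_checkBias hS hx, h.integral_mul_log_checkBias hS,
    ← h.integral_checkBias_sq]
  refine convexOn_entropyDeficit.map_integral_le continuous_entropyDeficit.continuousOn
    isClosed_Icc (Filter.Eventually.of_forall fun y => ⟨sq_nonneg _, hle y⟩) ?_ ?_
  · refine h.integrable_of_abs_le (hu.pow_const 2) (c := 1) fun y => ?_
    rw [abs_of_nonneg (sq_nonneg _)]
    exact hle y
  · refine h.integrable_of_abs_le (continuous_entropyDeficit.measurable.comp (hu.pow_const 2))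
      (c := entropyDeficit 1) fun y => ?_
    have h0 : checkBias t S y ^ 2 ∈ Set.Icc (0 : ℝ) 1 := ⟨sq_nonneg _, hle y⟩
    have h1 := half_le_entropyDeficit h0
    rw [Function.comp_apply, abs_of_nonneg (by linarith [h0.1])]
    exact monotoneOn_entropyDeficit h0 (Set.right_mem_Icc.2 zero_le_one) h0.2

theorem integrable_wordDensity_mul_log_symbol (h : IsBias W ν t) (x : Fin n → ZMod 2)
    (i : Fin n) :
    Integrable (fun y => wordDensity t x y * Real.log (1 + bitSign (x i) * t (y i)))
      (Measure.pi fun _ => ν) := by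
  simpa [checkBias] using h.integrable_wordDensity_mul_log x {i}

theorem integral_wordDensity_mul_log_symbol (h : IsBias W ν t) (x : Fin n → ZMod 2)
    (i : Fin n) :
    ∫ y, wordDensity t x y * Real.log (1 + bitSign (x i) * t (y i)) ∂(Measure.pi fun _ => ν) =
      biasInfo ν t := by
  have := W.isProb
  have hm := h.measurable
  rw [← h.integral_wordLaw, MBIOSChannel.wordLaw,
    integral_comp_eval (μ := fun i => W.law (x i)) (i := i)
      (f := fun y => Real.log (1 + bitSign (x i) * t y))
      (h.measurable_density _).log.aestronglyMeasurable, h.integral_law, biasInfo]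
  exact h.integral_bitSign (G := fun s => (1 + s) * Real.log (1 + s)) (by fun_prop) (x i)

end IsBias

end Checks

/-! ### Gibbs' inequality for codeword, output and decision. -/

section Decoding

variable {𝒴 : Type*} [MeasurableSpace 𝒴] {n m : ℕ}

theorem real_bind_eq_integral {α β : Type*} [MeasurableSpace α] [MeasurableSpace β]
    (P : Measure α) (D : Kernel α β) [IsMarkovKernel D] {S : Set β} (hS : MeasurableSet S) :
    (P.bind D).real S = ∫ y, (D y).real S ∂P := by
  rw [Measure.real, Measure.bind_apply hS D.aemeasurable]
  simp only [Measure.real]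
  rw [integral_toReal (D.measurable_coe hS).aemeasurable
    (Filter.Eventually.of_forall fun y => measure_lt_top _ _)]

/-- The probability of the word `x` if each bit differs from the corresponding bit of `z` with
probability `ρ`, independently. -/
noncomputable def flipProb (ρ : ℝ) (x z : Fin n → ZMod 2) : ℝ :=
  ∏ i, if z i ≠ x i then ρ else 1 - ρ

theorem flipProb_pos {ρ : ℝ} (hρ : ρ ∈ Set.Ioo (0 : ℝ) 1) (x z : Fin n → ZMod 2) :
    0 < flipProb ρ x z := by
  refine Finset.prod_pos fun i _ => ?_
  split_ifs
  · exact hρ.1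
  · linarith [hρ.2]

theorem sum_flipProb (ρ : ℝ) (z : Fin n → ZMod 2) : ∑ x, flipProb ρ x z = 1 := by
  simp only [flipProb]
  rw [← Fintype.prod_sum (fun i b => if z i ≠ b then ρ else 1 - ρ)]
  refine Finset.prod_eq_one fun i _ => ?_
  rw [show (Finset.univ : Finset (ZMod 2)) = {0, 1} from rfl, Finset.sum_pair (by decide)]
  rcases eq_zero_or_eq_one_of_zmod_two (z i) with h | h <;> simp [h]

theorem log_flipProb {ρ : ℝ} (hρ : ρ ∈ Set.Ioo (0 : ℝ) 1) (x z : Fin n → ZMod 2) :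
    Real.log (flipProb ρ x z) =
      ∑ i, if z i ≠ x i then Real.log ρ else Real.log (1 - ρ) := by
  rw [flipProb, Real.log_prod]
  · refine Finset.sum_congr rfl fun i _ => ?_
    split_ifs <;> rfl
  · intro i _
    split_ifs
    · exact hρ.1.ne'
    · linarith [hρ.2]

theorem sub_le_mul_log_sub_log {p s : ℝ} (hp : 0 < p) (hs : 0 < s) :
    p - s ≤ p * (Real.log p - Real.log s) := by
  have h := mul_le_mul_of_nonneg_left (Real.log_le_sub_one_of_pos (div_pos hs hp)) hp.le
  rw [Real.log_div hs.ne' hp.ne', mul_sub, mul_sub, mul_div_cancel₀ _ hp.ne'] at h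
  linarith

/-- The probability that the decoder `D` errs in the `i`-th bit, given the received word `y`. -/
noncomputable def symbolError (D : Kernel (Fin n → 𝒴) (Fin n → ZMod 2)) (x : Fin n → ZMod 2)
    (i : Fin n) (y : Fin n → 𝒴) : ℝ :=
  (D y).real {z | z i ≠ x i}

theorem measurableSet_of_finite_words (S : Set (Fin n → ZMod 2)) : MeasurableSet S :=
  (Set.toFinite S).measurableSet

theorem measurable_symbolError (D : Kernel (Fin n → 𝒴) (Fin n → ZMod 2)) (x : Fin n → ZMod 2)
    (i : Fin n) : Measurable (symbolError D x i) :=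
  (D.measurable_coe (measurableSet_of_finite_words _)).ennreal_toReal

theorem symbolError_mem_Icc (D : Kernel (Fin n → 𝒴) (Fin n → ZMod 2)) [IsMarkovKernel D]
    (x : Fin n → ZMod 2) (i : Fin n) (y : Fin n → 𝒴) : symbolError D x i y ∈ Set.Icc (0 : ℝ) 1 :=
  ⟨measureReal_nonneg, measureReal_le_one⟩

theorem integral_log_flipProb (D : Kernel (Fin n → 𝒴) (Fin n → ZMod 2)) [IsMarkovKernel D]
    {ρ : ℝ} (hρ : ρ ∈ Set.Ioo (0 : ℝ) 1) (x : Fin n → ZMod 2) (y : Fin n → 𝒴) :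
    ∫ z, Real.log (flipProb ρ x z) ∂D y =
      ∑ i, (symbolError D x i y * Real.log ρ + (1 - symbolError D x i y) * Real.log (1 - ρ)) := by
  simp only [log_flipProb hρ]
  rw [integral_finsetSum _ fun i _ => Integrable.of_finite]
  refine Finset.sum_congr rfl fun i _ => ?_
  have hS : MeasurableSet {z : Fin n → ZMod 2 | z i ≠ x i} := measurableSet_of_finite_words _
  have h1 : ∀ z : Fin n → ZMod 2, (if z i ≠ x i then Real.log ρ else Real.log (1 - ρ)) =
      {z : Fin n → ZMod 2 | z i ≠ x i}.indicator
        (fun _ => Real.log ρ - Real.log (1 - ρ)) z + Real.log (1 - ρ) := by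
    intro z
    by_cases hz : z i ≠ x i
    · rw [if_pos hz, Set.indicator_of_mem (by exact hz)]; ring
    · rw [if_neg hz, Set.indicator_of_notMem (by exact hz)]; ring
  simp only [h1]
  rw [integral_add Integrable.of_finite Integrable.of_finite, integral_indicator_const _ hS,
    integral_const, probReal_univ, symbolError]
  simp only [smul_eq_mul]
  ring

namespace IsBias

variable {W : MBIOSChannel 𝒴} {ν : Measure 𝒴} {t : 𝒴 → ℝ}

/-- This is p - s ≤ p log(p/s) with p the true density and s the test density scaled by `K`, the
logarithms being split into sums. -/
theorem gibbs_pointwise (h : IsBias W ν t) (S : Fin m → Finset (Fin n)) {x : Fin n → ZMod 2}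
    (hx : ∀ j, ∑ i ∈ S j, x i = 0) {K r : ℝ} (hK : 0 < K) (hr : 0 < r) (y : Fin n → 𝒴) :
    wordDensity t x y - K * (∏ j, (1 + checkBias t (S j) y)) * r ≤
      wordDensity t x y * (∑ i, Real.log (1 + bitSign (x i) * t (y i)) - Real.log K -
        ∑ j, Real.log (1 + checkBias t (S j) y)) - wordDensity t x y * Real.log r := by
  have hw := h.prod_one_add_checkBias_nonneg S y
  rcases (h.wordDensity_nonneg x y).eq_or_lt with h0 | hpos
  · rw [← h0]
    have : 0 ≤ K * (∏ j, (1 + checkBias t (S j) y)) * r := by positivity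
    linarith
  -- Splitting the logarithm needs nonzero factors; domination supplies them where the density is
  -- positive.
  have hc : ∀ j, 0 < 1 + checkBias t (S j) y := by
    intro j
    have h1 := h.wordDensity_le_mul_one_add_checkBias x (S j) y
    rw [hx j, bitSign_zero, one_mul] at h1
    exact pos_of_mul_pos_right (hpos.trans_le h1) (by positivity)
  have hd : ∀ i, 1 + bitSign (x i) * t (y i) ≠ 0 := fun i =>
    (Finset.prod_ne_zero_iff.1 hpos.ne') i (Finset.mem_univ i)
  have hw' : 0 < ∏ j, (1 + checkBias t (S j) y) := Finset.prod_pos fun j _ => hc j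
  have h1 := sub_le_mul_log_sub_log hpos (s := K * (∏ j, (1 + checkBias t (S j) y)) * r)
    (by positivity)
  rw [Real.log_mul (by positivity) hr.ne', Real.log_mul hK.ne' hw'.ne',
    Real.log_prod (fun j _ => (hc j).ne')] at h1
  have h2 : Real.log (wordDensity t x y) = ∑ i, Real.log (1 + bitSign (x i) * t (y i)) :=
    Real.log_prod fun i _ => hd i
  rw [h2] at h1
  refine h1.trans_eq ?_
  ring

theorem gibbs_decoder (h : IsBias W ν t) (S : Fin m → Finset (Fin n)) {x : Fin n → ZMod 2}
    (hx : ∀ j, ∑ i ∈ S j, x i = 0) {K ρ : ℝ} (hK : 0 < K) (hρ : ρ ∈ Set.Ioo (0 : ℝ) 1)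
    (D : Kernel (Fin n → 𝒴) (Fin n → ZMod 2)) [IsMarkovKernel D] (y : Fin n → 𝒴) :
    wordDensity t x y - K * (∏ j, (1 + checkBias t (S j) y)) * ∫ z, flipProb ρ x z ∂D y ≤
      wordDensity t x y * (∑ i, Real.log (1 + bitSign (x i) * t (y i)) - Real.log K -
        ∑ j, Real.log (1 + checkBias t (S j) y)) -
      wordDensity t x y * ∑ i, (symbolError D x i y * Real.log ρ +
        (1 - symbolError D x i y) * Real.log (1 - ρ)) := by
  have h1 := integral_mono (μ := D y) Integrable.of_finite Integrable.of_finite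
    fun z => h.gibbs_pointwise S hx hK (flipProb_pos hρ x z) y
  rw [integral_sub Integrable.of_finite Integrable.of_finite,
    integral_sub Integrable.of_finite Integrable.of_finite, integral_const, integral_const,
    integral_const_mul (K * _), integral_const_mul (wordDensity t x y), probReal_univ, one_smul,
    one_smul, integral_log_flipProb D hρ] at h1
  exact h1

theorem sum_integral_flipProb_le (D : Kernel (Fin n → 𝒴) (Fin n → ZMod 2)) [IsMarkovKernel D]
    {ρ : ℝ} (hρ : ρ ∈ Set.Ioo (0 : ℝ) 1) (A : Finset (Fin n → ZMod 2)) (y : Fin n → 𝒴) :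
    ∑ x ∈ A, ∫ z, flipProb ρ x z ∂D y ≤ 1 := by
  rw [← integral_finsetSum _ fun x _ => Integrable.of_finite]
  calc ∫ z, ∑ x ∈ A, flipProb ρ x z ∂D y ≤ ∫ _, (1 : ℝ) ∂D y := by
        refine integral_mono Integrable.of_finite Integrable.of_finite fun z => ?_
        simp only
        rw [← sum_flipProb ρ z]
        exact Finset.sum_le_sum_of_subset_of_nonneg (Finset.subset_univ A)
          fun x _ _ => (flipProb_pos hρ x z).le
    _ = 1 := by simp

theorem integral_wordDensity_mul_symbolError (h : IsBias W ν t)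
    (D : Kernel (Fin n → 𝒴) (Fin n → ZMod 2)) [IsMarkovKernel D] (x : Fin n → ZMod 2)
    (i : Fin n) :
    ∫ y, wordDensity t x y * symbolError D x i y ∂(Measure.pi fun _ => ν) =
      ((W.wordLaw x).bind D).real {z | z i ≠ x i} := by
  rw [real_bind_eq_integral _ _ (measurableSet_of_finite_words _), h.integral_wordLaw]
  rfl

theorem integrable_wordDensity_mul_symbolError (h : IsBias W ν t)
    (D : Kernel (Fin n → 𝒴) (Fin n → ZMod 2)) [IsMarkovKernel D] (x : Fin n → ZMod 2)
    (i : Fin n) :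
    Integrable (fun y => wordDensity t x y * symbolError D x i y) (Measure.pi fun _ => ν) := by
  refine h.integrable_of_abs_le
    ((h.measurable_wordDensity x).mul (measurable_symbolError D x i)) (c := 2 ^ n) fun y => ?_
  have h1 := symbolError_mem_Icc D x i y
  rw [abs_of_nonneg (mul_nonneg (h.wordDensity_nonneg x y) h1.1)]
  exact (mul_le_of_le_one_right (h.wordDensity_nonneg x y) h1.2).trans (h.wordDensity_le x y)

/-- Integrated relative entropy of the true joint law to the test law. `flipProb` makes the decoding
term linear in the bit error probabilities, so averaging over bits and codewords leaves only their
mean. -/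
theorem gibbs_integrated (h : IsBias W ν t) (S : Fin m → Finset (Fin n))
    (hS : ∀ j, (S j).Nonempty)
    (hσ : ∀ j, ∃ σ : Fin n → ZMod 2, ∀ k, ∑ i ∈ S k, σ i = if k = j then 1 else 0)
    (A : Finset (Fin n → ZMod 2)) (hA : A.Nonempty) (hx : ∀ x ∈ A, ∀ j, ∑ i ∈ S j, x i = 0)
    {ρ : ℝ} (hρ : ρ ∈ Set.Ioo (0 : ℝ) 1) (D : Kernel (Fin n → 𝒴) (Fin n → ZMod 2))
    [IsMarkovKernel D] :
    0 ≤ ∑ x ∈ A, (n * biasInfo ν t - Real.log A.card -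
      ∑ j, entropyDeficit ((∫ y, t y ^ 2 ∂ν) ^ (S j).card) -
      ∑ i, (((W.wordLaw x).bind D).real {z | z i ≠ x i} * Real.log ρ +
        (1 - ((W.wordLaw x).bind D).real {z | z i ≠ x i}) * Real.log (1 - ρ))) := by
  have hK : (0 : ℝ) < A.card := by exact_mod_cast hA.card_pos
  set w : (Fin n → 𝒴) → ℝ := fun y => ∏ j, (1 + checkBias t (S j) y)
  -- the integrand of the right-hand side, expanded into integrable terms
  let R : (Fin n → ZMod 2) → (Fin n → 𝒴) → ℝ := fun x y =>
    ∑ i, wordDensity t x y * Real.log (1 + bitSign (x i) * t (y i)) -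
      wordDensity t x y * Real.log A.card -
      ∑ j, wordDensity t x y * Real.log (1 + checkBias t (S j) y) -
      ∑ i, (wordDensity t x y * symbolError D x i y * Real.log ρ +
        (wordDensity t x y - wordDensity t x y * symbolError D x i y) * Real.log (1 - ρ))
  have hR : ∀ x y, R x y = wordDensity t x y *
      (∑ i, Real.log (1 + bitSign (x i) * t (y i)) - Real.log A.card -
        ∑ j, Real.log (1 + checkBias t (S j) y)) -
      wordDensity t x y * ∑ i, (symbolError D x i y * Real.log ρ +
        (1 - symbolError D x i y) * Real.log (1 - ρ)) := by
    intro x y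
    simp only [R, mul_sub, Finset.mul_sum]
    congr 1
    refine Finset.sum_congr rfl fun i _ => ?_
    ring
  have hcheck : ∀ x ∈ A, ∀ j, Integrable
      (fun y => wordDensity t x y * Real.log (1 + checkBias t (S j) y))
      (Measure.pi fun _ => ν) := by
    intro x hxA j
    simpa [hx x hxA j] using h.integrable_wordDensity_mul_log x (S j)
  have he := fun x i => h.integrable_wordDensity_mul_symbolError D x i
  have hf := fun x : Fin n → ZMod 2 => h.integrable_wordDensity x
  have hlog := fun x i => h.integrable_wordDensity_mul_log_symbol (n := n) x i
  have hT : ∀ x i, Integrable (fun y => wordDensity t x y * symbolError D x i y * Real.log ρ +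
      (wordDensity t x y - wordDensity t x y * symbolError D x i y) * Real.log (1 - ρ))
      (Measure.pi fun _ => ν) := fun x i =>
    ((he x i).mul_const _).add (((hf x).sub (he x i)).mul_const _)
  have h1 : ∀ x, Integrable (fun y =>
      ∑ i, wordDensity t x y * Real.log (1 + bitSign (x i) * t (y i)))
      (Measure.pi fun _ => ν) := fun x => integrable_finsetSum _ fun i _ => hlog x i
  have h2 : ∀ x ∈ A, Integrable (fun y =>
      ∑ j, wordDensity t x y * Real.log (1 + checkBias t (S j) y))
      (Measure.pi fun _ => ν) := fun x hxA => integrable_finsetSum _ fun j _ => hcheck x hxA j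
  have h3 : ∀ x, Integrable (fun y => ∑ i, (wordDensity t x y * symbolError D x i y * Real.log ρ +
      (wordDensity t x y - wordDensity t x y * symbolError D x i y) * Real.log (1 - ρ)))
      (Measure.pi fun _ => ν) := fun x => integrable_finsetSum _ fun i _ => hT x i
  have hRint : ∀ x ∈ A, Integrable (R x) (Measure.pi fun _ => ν) := fun x hxA =>
    (((h1 x).sub ((hf x).mul_const _)).sub (h2 x hxA)).sub (h3 x)
  have hRle : ∀ x ∈ A, ∫ y, R x y ∂(Measure.pi fun _ => ν) ≤ n * biasInfo ν t -
      Real.log A.card - ∑ j, entropyDeficit ((∫ y, t y ^ 2 ∂ν) ^ (S j).card) -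
      ∑ i, (((W.wordLaw x).bind D).real {z | z i ≠ x i} * Real.log ρ +
        (1 - ((W.wordLaw x).bind D).real {z | z i ≠ x i}) * Real.log (1 - ρ)) := by
    intro x hxA
    have hsum : ∑ j, entropyDeficit ((∫ y, t y ^ 2 ∂ν) ^ (S j).card) ≤
        ∑ j, ∫ y, wordDensity t x y * Real.log (1 + checkBias t (S j) y)
          ∂(Measure.pi fun _ => ν) :=
      Finset.sum_le_sum fun j _ => h.entropyDeficit_le_integral (hS j) (hx x hxA j)
    have ha : Integrable (fun y =>
        ∑ i, wordDensity t x y * Real.log (1 + bitSign (x i) * t (y i)) -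
          wordDensity t x y * Real.log A.card) (Measure.pi fun _ => ν) :=
      (h1 x).sub ((hf x).mul_const _)
    have hb : Integrable (fun y =>
        ∑ i, wordDensity t x y * Real.log (1 + bitSign (x i) * t (y i)) -
          wordDensity t x y * Real.log A.card -
          ∑ j, wordDensity t x y * Real.log (1 + checkBias t (S j) y)) (Measure.pi fun _ => ν) :=
      ha.sub (h2 x hxA)
    simp only [R]
    rw [integral_sub hb (h3 x), integral_sub ha (h2 x hxA),
      integral_sub (h1 x) ((hf x).mul_const _),
      integral_finsetSum _ fun i _ => hlog x i,
      integral_finsetSum _ fun j _ => hcheck x hxA j,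
      integral_finsetSum _ fun i _ => hT x i, integral_mul_const, h.integral_wordDensity, one_mul]
    have h4 : ∀ i, ∫ y, (wordDensity t x y * symbolError D x i y * Real.log ρ +
        (wordDensity t x y - wordDensity t x y * symbolError D x i y) * Real.log (1 - ρ))
        ∂(Measure.pi fun _ => ν) = ((W.wordLaw x).bind D).real {z | z i ≠ x i} * Real.log ρ +
        (1 - ((W.wordLaw x).bind D).real {z | z i ≠ x i}) * Real.log (1 - ρ) := by
      intro i
      have hc : Integrable (fun y => wordDensity t x y - wordDensity t x y * symbolError D x i y)
          (Measure.pi fun _ => ν) := (hf x).sub (he x i)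
      rw [integral_add ((he x i).mul_const _) (hc.mul_const _),
        integral_mul_const, integral_mul_const, integral_sub (hf x) (he x i),
        h.integral_wordDensity, h.integral_wordDensity_mul_symbolError]
    simp only [h4, h.integral_wordDensity_mul_log_symbol]
    rw [Finset.sum_const, Finset.card_univ, Fintype.card_fin, nsmul_eq_mul]
    linarith
  -- The guessing probabilities sum to at most 1 over `A`, so the test mass is at most |A| w. As w
  -- has integral 1, the left side integrates to 0.
  have hmain : ∀ y, ∑ x ∈ A, wordDensity t x y - A.card * w y ≤ ∑ x ∈ A, R x y := by
    intro y
    have h5 := Finset.sum_le_sum fun x hxA => h.gibbs_decoder S (hx x hxA) hK hρ D y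
    simp only [← hR] at h5
    refine le_trans ?_ h5
    rw [Finset.sum_sub_distrib, ← Finset.mul_sum]
    have h6 := sum_integral_flipProb_le D hρ A y
    have h7 : 0 ≤ A.card * w y := mul_nonneg hK.le (h.prod_one_add_checkBias_nonneg S y)
    have h8 := mul_le_of_le_one_right h7 h6
    linarith
  have hfs : Integrable (fun y => ∑ x ∈ A, wordDensity t x y) (Measure.pi fun _ => ν) :=
    integrable_finsetSum _ fun x _ => hf x
  have hw : Integrable (fun y => A.card * w y) (Measure.pi fun _ => ν) :=
    (h.integrable_prod_one_add_checkBias S).const_mul _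
  have h9 := integral_mono (hfs.sub hw) (integrable_finsetSum A hRint) hmain
  rw [integral_finsetSum A hRint] at h9
  have h10 : ∫ y, (∑ x ∈ A, wordDensity t x y - A.card * w y) ∂(Measure.pi fun _ => ν) = 0 := by
    rw [integral_sub hfs hw, integral_const_mul, integral_finsetSum A fun x _ => hf x,
      h.integral_prod_one_add_checkBias S hσ]
    simp [h.integral_wordDensity]
  have h11 : ∫ y, ((fun y => ∑ x ∈ A, wordDensity t x y) - fun y => A.card * w y) y
      ∂(Measure.pi fun _ => ν) = 0 := h10
  rw [h11] at h9
  exact h9.trans (Finset.sum_le_sum hRle)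

end IsBias

end Decoding

/-! ### From Gibbs' inequality to the rate trade-off. -/

section Fano

variable {𝒴 : Type*} [MeasurableSpace 𝒴] {n m : ℕ} {𝒞 : Submodule (ZMod 2) (Fin n → ZMod 2)}
  {H : Matrix (Fin m) (Fin n) (ZMod 2)}

theorem sum_rowSupport (H : Matrix (Fin m) (Fin n) (ZMod 2)) (x : Fin n → ZMod 2) (j : Fin m) :
    ∑ i ∈ rowSupport H j, x i = H.mulVec x j := by
  rw [rowSupport, Finset.sum_filter, Matrix.mulVec, dotProduct]
  refine Finset.sum_congr rfl fun i _ => ?_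
  rcases eq_zero_or_eq_one_of_zmod_two (H j i) with h | h <;> simp [h]

open Classical in
theorem MBIOSChannel.bitErrorProb_mem_Icc (W : MBIOSChannel 𝒴) (hn : 0 < n)
    (D : Kernel (Fin n → 𝒴) (Fin n → ZMod 2)) [IsMarkovKernel D] :
    W.bitErrorProb 𝒞 D ∈ Set.Icc (0 : ℝ) 1 := by
  have := W.isProb
  have hP : ∀ x : Fin n → ZMod 2, IsProbabilityMeasure (W.wordLaw x) := fun x => by
    unfold MBIOSChannel.wordLaw
    infer_instance
  have hn' : (0 : ℝ) < n := by exact_mod_cast hn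
  have hK : (0 : ℝ) < Nat.card 𝒞 := by exact_mod_cast Nat.card_pos
  refine ⟨by unfold MBIOSChannel.bitErrorProb; positivity, ?_⟩
  rw [MBIOSChannel.bitErrorProb, div_le_one hn']
  calc _ ≤ ∑ _i : Fin n, (1 : ℝ) := by
        refine Finset.sum_le_sum fun i _ => ?_
        rw [div_le_one hK]
        calc _ ≤ ∑ _x : 𝒞, (1 : ℝ) := Finset.sum_le_sum fun x _ => measureReal_le_one
          _ = Nat.card 𝒞 := by simp
    _ = n := by simp

open Classical in
-- Take all codewords in `gibbs_integrated`, so that the logarithm of their number is (n-m) log 2,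
-- and optimise over ρ: the cross-entropy becomes the binary entropy of the mean bit error
-- probability.
theorem IsBias.le_mul_binEntropy {W : MBIOSChannel 𝒴} {ν : Measure 𝒴} {t : 𝒴 → ℝ}
    (h : IsBias W ν t) (hn : 0 < n) (hH : IsFullRankParityCheck 𝒞 H)
    (D : Kernel (Fin n → 𝒴) (Fin n → ZMod 2)) [IsMarkovKernel D] :
    (n - m) * Real.log 2 - n * biasInfo ν t +
      ∑ j, entropyDeficit ((∫ y, t y ^ 2 ∂ν) ^ (rowSupport H j).card) ≤
    n * Real.binEntropy (W.bitErrorProb 𝒞 D) := by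
  have hn' : (0 : ℝ) < n := by exact_mod_cast hn
  have hPb := W.bitErrorProb_mem_Icc (𝒞 := 𝒞) hn D
  rw [← div_le_iff₀' hn']
  refine le_binEntropy_of_forall hPb.1 hPb.2 fun ρ hρ => ?_
  let A : Finset (Fin n → ZMod 2) := Finset.univ.filter fun x => x ∈ 𝒞
  have hA : ∀ x, x ∈ A ↔ x ∈ 𝒞 := fun x => by simp [A]
  have hcard : A.card = Nat.card 𝒞 := by
    rw [Nat.card_eq_fintype_card, Fintype.card_subtype]
  have hK : (0 : ℝ) < Nat.card 𝒞 := by exact_mod_cast Nat.card_pos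
  have hlogK : Real.log (Nat.card 𝒞) = (n - m) * Real.log 2 := by
    have hk : (Module.finrank (ZMod 2) 𝒞 : ℝ) = n - m :=
      eq_sub_of_add_eq (by exact_mod_cast hH.finrank_add)
    rw [Module.natCard_eq_pow_finrank (K := ZMod 2), Nat.card_zmod, Nat.cast_pow, Real.log_pow, hk,
      Nat.cast_ofNat]
  have hg := h.gibbs_integrated (rowSupport H) hH.rowSupport_nonempty
    (fun j => by
      obtain ⟨σ, hσ⟩ := hH.surjective (Pi.single j 1)
      exact ⟨σ, fun k => by rw [sum_rowSupport, hσ, Pi.single_apply]⟩)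
    A ⟨0, (hA 0).2 𝒞.zero_mem⟩
    (fun x hx j => by rw [sum_rowSupport, (hH.mem_iff x).1 ((hA x).1 hx), Pi.zero_apply]) hρ D
  set P : (Fin n → ZMod 2) → Fin n → ℝ := fun x i =>
    ((W.wordLaw x).bind D).real {z | z i ≠ x i}
  have hPsum : ∑ x ∈ A, ∑ i, P x i = n * Nat.card 𝒞 * W.bitErrorProb 𝒞 D := by
    have h1 : W.bitErrorProb 𝒞 D = (∑ i : Fin n, (∑ x : 𝒞, P x.1 i) / Nat.card 𝒞) / n := rfl
    rw [h1, ← Finset.sum_div, Finset.sum_comm]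
    have h2 : ∀ i, ∑ x ∈ A, P x i = ∑ x : 𝒞, P x.1 i := fun i =>
      Finset.sum_subtype A hA fun x => P x i
    simp only [h2]
    field_simp
  have h3 : ∀ x, ∑ i, (P x i * Real.log ρ + (1 - P x i) * Real.log (1 - ρ)) =
      (∑ i, P x i) * (Real.log ρ - Real.log (1 - ρ)) + n * Real.log (1 - ρ) := by
    intro x
    have h4 : ∀ i, P x i * Real.log ρ + (1 - P x i) * Real.log (1 - ρ) =
        P x i * (Real.log ρ - Real.log (1 - ρ)) + Real.log (1 - ρ) := fun i => by ring
    simp only [h4]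
    rw [Finset.sum_add_distrib, ← Finset.sum_mul]
    simp
  change 0 ≤ ∑ x ∈ A, (n * biasInfo ν t - Real.log A.card -
    ∑ j, entropyDeficit ((∫ y, t y ^ 2 ∂ν) ^ (rowSupport H j).card) -
    ∑ i, (P x i * Real.log ρ + (1 - P x i) * Real.log (1 - ρ))) at hg
  simp only [h3, hcard, hlogK] at hg
  rw [Finset.sum_sub_distrib, Finset.sum_const, Finset.sum_add_distrib, ← Finset.sum_mul, hPsum,
    Finset.sum_const, hcard, nsmul_eq_mul, nsmul_eq_mul] at hg
  set s := ∑ j, entropyDeficit ((∫ y, t y ^ 2 ∂ν) ^ (rowSupport H j).card)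
  set p := W.bitErrorProb 𝒞 D
  have h5 : 0 ≤ (Nat.card 𝒞 : ℝ) * (n * biasInfo ν t - (n - m) * Real.log 2 - s -
      (n * (p * (Real.log ρ - Real.log (1 - ρ))) + n * Real.log (1 - ρ))) := by
    refine hg.trans_eq ?_
    ring
  have h6 := nonneg_of_mul_nonneg_right h5 hK
  rw [div_le_iff₀' hn']
  linarith

/-- The trade-off between rate, bit error probability and average right degree. -/
theorem MBIOSChannel.entropyDeficit_rpow_le (W : MBIOSChannel 𝒴) (hC0 : 0 < W.capacity)
    (hC1 : W.capacity < 1) (hn : 0 < n) (hH : IsFullRankParityCheck 𝒞 H)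
    (D : Kernel (Fin n → 𝒴) (Fin n → ZMod 2)) [IsMarkovKernel D] :
    0 < W.g₁ ∧ W.g₁ < 1 ∧ (codeRate 𝒞 - W.capacity) * Real.log 2 +
      (1 - codeRate 𝒞) * entropyDeficit (W.g₁ ^ avgRightDegree H) ≤
      Real.binEntropy (W.bitErrorProb 𝒞 D) := by
  obtain ⟨ν, t, h⟩ := W.exists_isBias
  have hn' : (0 : ℝ) < n := by exact_mod_cast hn
  have h0 := h.integral_sq_pos hC0
  have h1 := h.integral_sq_lt_one hC1
  have hF := h.le_mul_binEntropy hn hH D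
  rw [← h.g₁_eq] at h0 h1 hF
  refine ⟨h0, h1, ?_⟩
  have h2 : (n : ℝ) * (1 - codeRate 𝒞) = m := hH.mul_one_sub_codeRate hn
  have h3 : m * entropyDeficit (W.g₁ ^ avgRightDegree H) ≤
      ∑ j, entropyDeficit (W.g₁ ^ (rowSupport H j).card) := by
    rcases Nat.eq_zero_or_pos m with rfl | hm
    · simp
    · rw [avgRightDegree_eq]
      exact mul_entropyDeficit_rpow_avg_le hm h0 h1.le _
  have h4 := mul_le_mul_of_nonneg_left h.biasInfo_le hn'.le
  refine le_of_mul_le_mul_left ?_ hn'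
  calc (n : ℝ) * ((codeRate 𝒞 - W.capacity) * Real.log 2 +
        (1 - codeRate 𝒞) * entropyDeficit (W.g₁ ^ avgRightDegree H))
      = (n - n * (1 - codeRate 𝒞)) * Real.log 2 - n * (W.capacity * Real.log 2) +
        (n * (1 - codeRate 𝒞)) * entropyDeficit (W.g₁ ^ avgRightDegree H) := by ring
    _ ≤ _ := by rw [h2]; linarith

end Fano

/-! ### The erasure channel: capacity and counting of erasures. -/

section ErasureChannel

instance : DiscreteMeasurableSpace BECOutput := ⟨fun _ => trivial⟩

theorem bec_law_none {p : ℝ} (hp : p ∈ Set.Icc (0 : ℝ) 1) (b : ZMod 2) :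
    (bec p hp).law b {none} = ENNReal.ofReal p := by
  simp [bec]

theorem bec_law_some {p : ℝ} (hp : p ∈ Set.Icc (0 : ℝ) 1) (b c : ZMod 2) :
    (bec p hp).law b {some c} = if b = c then ENNReal.ofReal (1 - p) else 0 := by
  by_cases h : b = c <;> simp [bec, h]

theorem bec_law_real_none {p : ℝ} (hp : p ∈ Set.Icc (0 : ℝ) 1) (b : ZMod 2) :
    ((bec p hp).law b).real {none} = p := by
  rw [Measure.real, bec_law_none, ENNReal.toReal_ofReal hp.1]

theorem bec_law_real_compl_none {p : ℝ} (hp : p ∈ Set.Icc (0 : ℝ) 1) (b : ZMod 2) :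
    ((bec p hp).law b).real {none}ᶜ = 1 - p := by
  have := (bec p hp).isProb b
  rw [probReal_compl_eq_one_sub (MeasurableSet.of_discrete), bec_law_real_none]

theorem IsBias.law_real_singleton {𝒴 : Type*} [MeasurableSpace 𝒴] [MeasurableSingletonClass 𝒴]
    {W : MBIOSChannel 𝒴} {ν : Measure 𝒴} {t : 𝒴 → ℝ} (h : IsBias W ν t) (b : ZMod 2) (y : 𝒴) :
    (W.law b).real {y} = (1 + bitSign b * t y) * ν.real {y} := by
  rw [h.law, Measure.real, withDensity_apply _ (measurableSet_singleton y), lintegral_singleton,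
    ENNReal.toReal_mul, ENNReal.toReal_ofReal (h.density_nonneg b y)]
  rfl

/-- The flip rule and the masses of `some 0` force t = 1, -1, 0 at `some 0`, `some 1`, `none`. Only
this direction is needed, to pass from R ≥ (1-ε)C to R ≥ (1-ε)(1-p). -/
theorem one_sub_le_capacity_bec {p : ℝ} (hp : p ∈ Set.Icc (0 : ℝ) 1) (h1 : p < 1) :
    1 - p ≤ (bec p hp).capacity := by
  obtain ⟨ν, t, h⟩ := (bec p hp).exists_isBias
  have := h.isProb
  have h00 := h.law_real_singleton 0 (some 0)
  have h10 := h.law_real_singleton 1 (some 0)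
  have h0n := h.flip none
  have h01 := h.flip (some 0)
  simp only [Measure.real, bec_law_some, bitSign_zero, bitSign_one] at h00 h10
  simp only [if_true, one_mul, one_ne_zero, if_false, ENNReal.toReal_zero, neg_mul,
    ENNReal.toReal_ofReal (by linarith : (0 : ℝ) ≤ 1 - p)] at h00 h10
  change t none = -t none at h0n
  change t (some (0 + 1)) = -t (some 0) at h01
  rw [zero_add] at h01
  have hν : (ν {some 0}).toReal ≠ 0 := by
    intro h0
    rw [h0, mul_zero] at h00
    linarith
  have ht0 : t (some 0) = 1 := by
    have := (mul_eq_zero.1 h10.symm).resolve_right hν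
    linarith
  have ht1 : t (some 1) = -1 := by rw [h01, ht0]
  have htn : t none = 0 := by linarith
  have hinfo : biasInfo ν t = (1 - p) * Real.log 2 := by
    rw [biasInfo, integral_fintype Integrable.of_finite, Fintype.sum_option,
      show (Finset.univ : Finset (ZMod 2)) = {0, 1} from rfl, Finset.sum_pair (by decide), ht0,
      ht1, htn, h00, ht0]
    norm_num [Measure.real]
    ring
  have h2 := h.biasInfo_le
  rw [hinfo] at h2
  exact le_of_mul_le_mul_right h2 (Real.log_pos one_lt_two)

variable {n m : ℕ} {𝒞 : Submodule (ZMod 2) (Fin n → ZMod 2)}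
  {H : Matrix (Fin m) (Fin n) (ZMod 2)}

open Classical in
/-- The erased positions of a received word. -/
noncomputable def erasedPositions (y : Fin n → BECOutput) : Finset (Fin n) :=
  Finset.univ.filter fun i => y i = none

open Classical in
/-- The parity checks which involve an erased symbol. -/
noncomputable def erasedChecks (H : Matrix (Fin m) (Fin n) (ZMod 2)) (y : Fin n → BECOutput) :
    Finset (Fin m) :=
  Finset.univ.filter fun j => ∃ i ∈ rowSupport H j, y i = none

open Classical in
/-- The positions at which two codewords compatible with the received word may differ. -/
noncomputable def undeterminedPositions (𝒞 : Submodule (ZMod 2) (Fin n → ZMod 2))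
    (y : Fin n → BECOutput) : Finset (Fin n) :=
  Finset.univ.filter fun i => ∃ c ∈ 𝒞, (∀ k, c k ≠ 0 → y k = none) ∧ c i ≠ 0

open Classical in
-- Two vectors on the erased positions with equal syndrome on the erased checks differ by a
-- codeword, since the other checks see only zeros. That codeword is supported on the undetermined
-- positions, so agreement there makes the vectors equal. Compare powers of 2.
theorem card_erasedPositions_le (hH : IsFullRankParityCheck 𝒞 H) (y : Fin n → BECOutput) :
    (erasedPositions y).card ≤ (erasedChecks H y).card + (undeterminedPositions 𝒞 y).card := by
  let ext : (erasedPositions y → ZMod 2) → Fin n → ZMod 2 := fun v k =>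
    if h : k ∈ erasedPositions y then v ⟨k, h⟩ else 0
  let f : (erasedPositions y → ZMod 2) →
      (erasedChecks H y → ZMod 2) × (undeterminedPositions 𝒞 y → ZMod 2) := fun v =>
    (fun j => H.mulVec (ext v) j, fun i => ext v i)
  have hf : Function.Injective f := by
    intro v v' hvv
    obtain ⟨hT, hU⟩ := Prod.ext_iff.1 hvv
    have hsupp : ∀ k, (ext v - ext v') k ≠ 0 → y k = none := by
      intro k hk
      by_contra hy
      have hk' : k ∉ erasedPositions y := by simpa [erasedPositions] using hy
      simp [ext, hk'] at hk
    have hmem : ext v - ext v' ∈ 𝒞 := by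
      rw [hH.mem_iff]
      ext j
      by_cases hj : j ∈ erasedChecks H y
      · rw [Matrix.mulVec_sub, Pi.sub_apply, Pi.zero_apply, sub_eq_zero]
        exact congrFun hT ⟨j, hj⟩
      · rw [← sum_rowSupport, Pi.zero_apply]
        refine Finset.sum_eq_zero fun i hi => ?_
        by_contra hne
        exact hj (by simpa [erasedChecks] using ⟨i, hi, hsupp i hne⟩)
    have heq : ∀ k, ext v k = ext v' k := by
      intro k
      by_contra hne
      have hk : k ∈ undeterminedPositions 𝒞 y := by
        simp only [undeterminedPositions, Finset.mem_filter, Finset.mem_univ, true_and]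
        exact ⟨_, hmem, hsupp, sub_ne_zero.2 hne⟩
      exact hne (congrFun hU ⟨k, hk⟩)
    ext ⟨k, hk⟩
    simpa [ext, hk] using heq k
  have hcard := Fintype.card_le_of_injective f hf
  rw [Fintype.card_prod, Fintype.card_fun, Fintype.card_fun, Fintype.card_fun, ZMod.card,
    Fintype.card_coe, Fintype.card_coe, Fintype.card_coe, ← pow_add] at hcard
  exact (Nat.pow_le_pow_iff_right one_lt_two).1 hcard

theorem bec_wordLaw_singleton_ne_zero_iff {p : ℝ} (hp : p ∈ Set.Icc (0 : ℝ) 1) (h0 : 0 < p)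
    (h1 : p < 1) (x : Fin n → ZMod 2) (y : Fin n → BECOutput) :
    (bec p hp).wordLaw x {y} ≠ 0 ↔ ∀ i, y i = none ∨ y i = some (x i) := by
  have := (bec p hp).isProb
  rw [MBIOSChannel.wordLaw, Measure.pi_singleton, Finset.prod_ne_zero_iff]
  refine ⟨fun h i => ?_, fun h i _ => ?_⟩
  · have hi := h i (Finset.mem_univ i)
    rcases hy : y i with _ | c
    · exact Or.inl rfl
    · rw [hy, bec_law_some] at hi
      refine Or.inr ?_
      by_cases hc : x i = c
      · rw [hc]
      · simp [hc] at hi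
  · rcases h i with hy | hy <;> rw [hy]
    · rw [bec_law_none]; simpa using h0
    · rw [bec_law_some, if_pos rfl]; simpa using h1

/-- If c is a codeword supported on erasures with c_i ≠ 0, the output is possible under both x and x
+ c. A decision on bit i would be wrong for one of them, with positive probability. -/
theorem ae_real_erased_eq_one {p : ℝ} (hp : p ∈ Set.Icc (0 : ℝ) 1) (h0 : 0 < p) (h1 : p < 1)
    (D : Kernel (Fin n → BECOutput) (Fin n → BECOutput)) [IsMarkovKernel D]
    (hD : IsErrorless p hp 𝒞 D) {x : Fin n → ZMod 2} (hx : x ∈ 𝒞) :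
    ∀ᵐ y ∂(bec p hp).wordLaw x, ∀ i ∈ undeterminedPositions 𝒞 y,
      (D y).real {z | z i = none} = 1 := by
  have hzero : ∀ x ∈ 𝒞, ∀ y, (bec p hp).wordLaw x {y} ≠ 0 → ∀ i,
      D y {z | ∃ b, z i = some b ∧ b ≠ x i} = 0 := by
    intro x hx y hy i
    have h2 := hD x hx i
    rw [Measure.bind_apply MeasurableSet.of_discrete D.aemeasurable,
      lintegral_eq_zero_iff (D.measurable_coe MeasurableSet.of_discrete)] at h2
    exact (ae_iff_of_countable.1 h2) y hy
  rw [ae_iff_of_countable]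
  intro y hy i hi
  simp only [undeterminedPositions, Finset.mem_filter, Finset.mem_univ, true_and] at hi
  obtain ⟨c, hc, hsupp, hci⟩ := hi
  have hy' := (bec_wordLaw_singleton_ne_zero_iff hp h0 h1 x y).1 hy
  have hyc : (bec p hp).wordLaw (x + c) {y} ≠ 0 := by
    rw [bec_wordLaw_singleton_ne_zero_iff hp h0 h1]
    intro k
    by_cases hk : c k = 0
    · simpa [hk] using hy' k
    · exact Or.inl (hsupp k hk)
  have hz1 := hzero x hx y hy i
  have hz2 := hzero (x + c) (𝒞.add_mem hx hc) y hyc i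
  have hz : D y {z | z i = none}ᶜ = 0 := by
    refine measure_mono_null (fun z hz => ?_) (measure_union_null hz1 hz2)
    obtain ⟨b, hb⟩ := Option.ne_none_iff_exists'.1 hz
    by_cases hbx : b = x i
    · refine Or.inr ⟨b, hb, fun h => hci ?_⟩
      rw [hbx, Pi.add_apply] at h
      simpa using h
    · exact Or.inl ⟨b, hb, hbx⟩
  rw [Measure.real, (prob_compl_eq_zero_iff MeasurableSet.of_discrete).1 hz, ENNReal.toReal_one]

theorem integral_card_erasedPositions {p : ℝ} (hp : p ∈ Set.Icc (0 : ℝ) 1) (x : Fin n → ZMod 2) :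
    ∫ y, ((erasedPositions y).card : ℝ) ∂(bec p hp).wordLaw x = n * p := by
  have := (bec p hp).isProb
  have h : ∀ y : Fin n → BECOutput, ((erasedPositions y).card : ℝ) =
      ∑ i, ({none} : Set BECOutput).indicator (fun _ => (1 : ℝ)) (y i) := by
    intro y
    rw [erasedPositions, Finset.card_filter, Nat.cast_sum]
    refine Finset.sum_congr rfl fun i _ => ?_
    by_cases hy : y i = none <;> simp [hy]
  simp only [h]
  rw [MBIOSChannel.wordLaw, integral_finsetSum _ fun i _ => Integrable.of_finite]
  have h2 : ∀ i, ∫ y : Fin n → BECOutput, ({none} : Set BECOutput).indicator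
      (fun _ => (1 : ℝ)) (y i) ∂(Measure.pi fun i => (bec p hp).law (x i)) = p := by
    intro i
    rw [integral_comp_eval (μ := fun i => (bec p hp).law (x i)) (i := i)
      (f := ({none} : Set BECOutput).indicator fun _ => (1 : ℝ))
      (Measurable.of_discrete.aestronglyMeasurable),
      integral_indicator_const _ MeasurableSet.of_discrete, bec_law_real_none, smul_eq_mul, mul_one]
  rw [Finset.sum_congr rfl fun i _ => h2 i]
  simp

theorem integral_card_erasedChecks {p : ℝ} (hp : p ∈ Set.Icc (0 : ℝ) 1)
    (H : Matrix (Fin m) (Fin n) (ZMod 2)) (x : Fin n → ZMod 2) :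
    ∫ y, ((erasedChecks H y).card : ℝ) ∂(bec p hp).wordLaw x =
      ∑ j, (1 - (1 - p) ^ (rowSupport H j).card) := by
  have := (bec p hp).isProb
  have hP : IsProbabilityMeasure ((bec p hp).wordLaw x) := by
    unfold MBIOSChannel.wordLaw
    infer_instance
  let A : Fin m → Set (Fin n → BECOutput) := fun j =>
    Set.univ.pi fun i => if i ∈ rowSupport H j then {none}ᶜ else Set.univ
  have hA : ∀ j y, y ∈ A j ↔ ∀ i ∈ rowSupport H j, y i ≠ none := by
    intro j y
    simp only [A, Set.mem_pi, Set.mem_univ, true_implies]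
    refine forall_congr' fun i => ?_
    by_cases hi : i ∈ rowSupport H j <;> simp [hi]
  have h : ∀ y : Fin n → BECOutput, ((erasedChecks H y).card : ℝ) =
      ∑ j, (A j)ᶜ.indicator (fun _ => (1 : ℝ)) y := by
    intro y
    rw [erasedChecks, Finset.card_filter, Nat.cast_sum]
    refine Finset.sum_congr rfl fun j _ => ?_
    by_cases hy : y ∈ A j
    · have := (hA j y).1 hy
      rw [Set.indicator_of_notMem (by simpa using hy), if_neg (by push Not; exact this),
        Nat.cast_zero]
    · have : ∃ i ∈ rowSupport H j, y i = none := by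
        by_contra hne
        push Not at hne
        exact hy ((hA j y).2 hne)
      rw [Set.indicator_of_mem (by simpa using hy), if_pos this, Nat.cast_one]
  simp only [h]
  rw [integral_finsetSum _ fun i _ => Integrable.of_finite]
  refine Finset.sum_congr rfl fun j _ => ?_
  rw [integral_indicator_const _ MeasurableSet.of_discrete, smul_eq_mul, mul_one,
    probReal_compl_eq_one_sub MeasurableSet.of_discrete]
  congr 1
  rw [MBIOSChannel.wordLaw, Measure.real, Measure.pi_pi, ENNReal.toReal_prod]
  have hprod : (1 - p) ^ (rowSupport H j).card = ∏ i, if i ∈ rowSupport H j then 1 - p else 1 := by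
    rw [Finset.prod_ite_mem, Finset.univ_inter, Finset.prod_const]
  rw [hprod]
  refine Finset.prod_congr rfl fun i _ => ?_
  by_cases hi : i ∈ rowSupport H j
  · simp only [hi, if_true]
    exact bec_law_real_compl_none hp (x i)
  · simp [hi]

/-- Expectation of the counting inequality; a check of degree d escapes erasure with probability
(1-p)^d. -/
theorem le_sum_real_erased {p : ℝ} (hp : p ∈ Set.Icc (0 : ℝ) 1) (h0 : 0 < p) (h1 : p < 1)
    (hH : IsFullRankParityCheck 𝒞 H)
    (D : Kernel (Fin n → BECOutput) (Fin n → BECOutput)) [IsMarkovKernel D]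
    (hD : IsErrorless p hp 𝒞 D) {x : Fin n → ZMod 2} (hx : x ∈ 𝒞) :
    n * p - ∑ j, (1 - (1 - p) ^ (rowSupport H j).card) ≤
      ∑ i, (((bec p hp).wordLaw x).bind D).real {z | z i = none} := by
  have := (bec p hp).isProb
  have hP : IsProbabilityMeasure ((bec p hp).wordLaw x) := by
    unfold MBIOSChannel.wordLaw
    infer_instance
  rw [← integral_card_erasedPositions hp x, ← integral_card_erasedChecks hp H x,
    ← integral_sub Integrable.of_finite Integrable.of_finite]
  simp only [fun i => real_bind_eq_integral ((bec p hp).wordLaw x) D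
    (MeasurableSet.of_discrete (s := {z : Fin n → BECOutput | z i = none}))]
  rw [← integral_finsetSum _ fun i _ => Integrable.of_finite]
  refine integral_mono_ae Integrable.of_finite Integrable.of_finite ?_
  filter_upwards [ae_real_erased_eq_one hp h0 h1 D hD hx] with y hy
  have h2 : ((erasedPositions y).card : ℝ) ≤
      (erasedChecks H y).card + (undeterminedPositions 𝒞 y).card := by
    exact_mod_cast card_erasedPositions_le hH y
  calc ((erasedPositions y).card : ℝ) - (erasedChecks H y).card
      ≤ ∑ i ∈ undeterminedPositions 𝒞 y, (D y).real {z | z i = none} := by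
        rw [Finset.sum_congr rfl hy, Finset.sum_const, nsmul_eq_mul, mul_one]
        linarith
    _ ≤ ∑ i, (D y).real {z | z i = none} :=
        Finset.sum_le_sum_of_subset_of_nonneg (Finset.subset_univ _)
          fun i _ _ => measureReal_nonneg

/-- The trade-off between rate, erasure probability and average right degree. -/
theorem le_erasureProb {p : ℝ} (hp : p ∈ Set.Icc (0 : ℝ) 1) (h0 : 0 < p) (h1 : p < 1)
    (hn : 0 < n) (hH : IsFullRankParityCheck 𝒞 H)
    (D : Kernel (Fin n → BECOutput) (Fin n → BECOutput)) [IsMarkovKernel D]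
    (hD : IsErrorless p hp 𝒞 D) :
    p - (1 - codeRate 𝒞) * (1 - (1 - p) ^ avgRightDegree H) ≤ erasureProb p hp 𝒞 D := by
  classical
  have hn' : (0 : ℝ) < n := by exact_mod_cast hn
  have hK : (0 : ℝ) < Nat.card 𝒞 := by exact_mod_cast Nat.card_pos
  have h2 : (n : ℝ) * (1 - codeRate 𝒞) = m := hH.mul_one_sub_codeRate hn
  have h3 : m * (1 - p) ^ avgRightDegree H ≤ ∑ j, (1 - p) ^ (rowSupport H j).card := by
    rcases Nat.eq_zero_or_pos m with rfl | hm
    · simp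
    · rw [avgRightDegree_eq, ← le_div_iff₀' (by exact_mod_cast hm)]
      exact rpow_avg_le_avg_pow hm (by linarith) _
  have h4 : n * p - ∑ j, (1 - (1 - p) ^ (rowSupport H j).card) ≤ n * erasureProb p hp 𝒞 D := by
    have h5 : ∑ _x : 𝒞, (n * p - ∑ j, (1 - (1 - p) ^ (rowSupport H j).card)) ≤
        ∑ x : 𝒞, ∑ i, (((bec p hp).wordLaw x.1).bind D).real {z | z i = none} :=
      Finset.sum_le_sum fun x _ => le_sum_real_erased hp h0 h1 hH D hD x.2
    rw [Finset.sum_const, Finset.card_univ, ← Nat.card_eq_fintype_card, nsmul_eq_mul,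
      Finset.sum_comm] at h5
    rw [erasureProb, ← Finset.sum_div, mul_div_cancel₀ _ hn'.ne', le_div_iff₀' hK]
    convert h5
  refine le_of_mul_le_mul_left ?_ hn'
  calc (n : ℝ) * (p - (1 - codeRate 𝒞) * (1 - (1 - p) ^ avgRightDegree H))
      = n * p - (n * (1 - codeRate 𝒞)) + (n * (1 - codeRate 𝒞)) * (1 - p) ^ avgRightDegree H := by
        ring
    _ ≤ n * p - m + ∑ j, (1 - p) ^ (rowSupport H j).card := by rw [h2]; linarith
    _ = n * p - ∑ j, (1 - (1 - p) ^ (rowSupport H j).card) := by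
        rw [Finset.sum_sub_distrib]
        simp
        ring
    _ ≤ _ := h4

end ErasureChannel

/-! ### Solving the trade-offs for the average degree. -/

section Bounds

theorem h₂Inv_spec {u : ℝ} (hu : u ∈ Set.Icc (0 : ℝ) 1) :
    h₂Inv u ∈ Set.Icc (0 : ℝ) (1 / 2) ∧ h₂ (h₂Inv u) = u := by
  have h2 : Real.log 2 ≠ 0 := (Real.log_pos one_lt_two).ne'
  have hc : ContinuousOn h₂ (Set.Icc 0 (1 / 2)) :=
    (Real.binEntropy_continuous.div_const _).continuousOn
  have h0 : h₂ 0 = 0 := by simp [h₂]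
  have h1 : h₂ (1 / 2) = 1 := by
    rw [h₂, one_div, Real.binEntropy_two_inv, div_self h2]
  have hex : ∃ a ∈ Set.Icc (0 : ℝ) (1 / 2), h₂ a = u := by
    have := intermediate_value_Icc (by norm_num : (0 : ℝ) ≤ 1 / 2) hc
    rw [h0, h1] at this
    exact this hu
  exact ⟨Function.invFunOn_mem hex, Function.invFunOn_eq hex⟩

theorem h₂Inv_le {u a : ℝ} (hu : u ∈ Set.Icc (0 : ℝ) 1) (ha : a ∈ Set.Icc (0 : ℝ) (1 / 2))
    (h : u ≤ h₂ a) : h₂Inv u ≤ a := by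
  obtain ⟨h1, h3⟩ := h₂Inv_spec hu
  rw [← h3, h₂, h₂, div_le_div_iff_of_pos_right (Real.log_pos one_lt_two)] at h
  rw [one_div] at ha h1
  exact (Real.binEntropy_strictMonoOn.le_iff_le h1 ha).1 h

theorem h₂Inv_lt_half {u : ℝ} (hu : u ∈ Set.Ico (0 : ℝ) 1) : h₂Inv u < 1 / 2 := by
  obtain ⟨h1, h3⟩ := h₂Inv_spec ⟨hu.1, hu.2.le⟩
  refine h1.2.lt_of_ne fun h => hu.2.ne ?_
  rw [← h3, h, h₂, one_div, Real.binEntropy_two_inv, div_self (Real.log_pos one_lt_two).ne']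

variable {n m : ℕ} {𝒞 : Submodule (ZMod 2) (Fin n → ZMod 2)}
  {H : Matrix (Fin m) (Fin n) (ZMod 2)}

theorem avgRightDegree_nonneg (H : Matrix (Fin m) (Fin n) (ZMod 2)) : 0 ≤ avgRightDegree H := by
  rw [avgRightDegree_eq]
  positivity

theorem IsFullRankParityCheck.one_sub_codeRate_nonneg (hH : IsFullRankParityCheck 𝒞 H)
    (hn : 0 < n) : 0 ≤ 1 - codeRate 𝒞 := by
  have h1 := hH.mul_one_sub_codeRate hn
  have h2 : (0 : ℝ) < n := by exact_mod_cast hn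
  exact nonneg_of_mul_nonneg_right (h1 ▸ Nat.cast_nonneg m) h2

theorem IsFullRankParityCheck.one_sub_codeRate_pos (hH : IsFullRankParityCheck 𝒞 H)
    (hn : 0 < n) (hm : 0 < m) : 0 < 1 - codeRate 𝒞 := by
  have h1 := hH.mul_one_sub_codeRate hn
  have h2 : (0 : ℝ) < n := by exact_mod_cast hn
  have h3 : (0 : ℝ) < m := by exact_mod_cast hm
  exact pos_of_mul_pos_right (h1 ▸ h3) h2.le

/-- With v = g₁^(a_R/2) the trade-off reads 1 - C - h₂(P_b) ≤ (1-R) h₂((1-v)/2). Bounding 1 - R by 1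
- (1-ε)C and inverting h₂ gives v ≤ 1 - 2 h₂⁻¹(u); take logarithms. -/
theorem degreeBound_le_avgRightDegree {𝒴 : Type*} [MeasurableSpace 𝒴] (W : MBIOSChannel 𝒴)
    (hC0 : 0 < W.capacity) (hC1 : W.capacity < 1) {ε : ℝ} (hε0 : 0 < ε)
    (hn : 0 < n) (hm : 0 < m) (hH : IsFullRankParityCheck 𝒞 H)
    (D : Kernel (Fin n → 𝒴) (Fin n → ZMod 2)) [IsMarkovKernel D]
    (hR : (1 - ε) * W.capacity ≤ codeRate 𝒞) (hPb : h₂ (W.bitErrorProb 𝒞 D) ≤ 1 - W.capacity) :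
    degreeBound W.capacity W.g₁ ε (W.bitErrorProb 𝒞 D) ≤ avgRightDegree H := by
  obtain ⟨hg0, hg1, hmain⟩ := W.entropyDeficit_rpow_le hC0 hC1 hn hH D
  have hlog2 : 0 < Real.log 2 := Real.log_pos one_lt_two
  have hR1 := hH.one_sub_codeRate_pos hn hm
  have hPbI := W.bitErrorProb_mem_Icc (𝒞 := 𝒞) hn D
  set C := W.capacity
  set g := W.g₁
  set Pb := W.bitErrorProb 𝒞 D
  set a := avgRightDegree H
  set R := codeRate 𝒞
  have ha : 0 ≤ a := avgRightDegree_nonneg H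
  set v := √(g ^ a) with hv
  have hga : g ^ a ≤ 1 := Real.rpow_le_one hg0.le hg1.le ha
  have hv0 : 0 < v := Real.sqrt_pos.2 (Real.rpow_pos_of_pos hg0 a)
  have hv1 : v ≤ 1 := by exact Real.sqrt_le_iff.2 ⟨zero_le_one, by simpa using hga⟩
  set u := (1 - C - h₂ Pb) / (1 - (1 - ε) * C) with hu
  have hden : 0 < 1 - (1 - ε) * C := by linarith
  have hh0 : 0 ≤ h₂ Pb := div_nonneg (Real.binEntropy_nonneg hPbI.1 hPbI.2) hlog2.le
  have hu0 : 0 ≤ u := div_nonneg (by linarith) hden.le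
  have hu1 : u < 1 := by
    rw [hu, div_lt_one hden]
    nlinarith [mul_pos hε0 hC0]
  have hkey : u ≤ h₂ ((1 - v) / 2) := by
    have h1 : (R - C) * Real.log 2 + (1 - R) * (Real.log 2 - Real.binEntropy ((1 - v) / 2)) ≤
        Real.binEntropy Pb := hmain
    have h2 : 1 - C - h₂ Pb ≤ (1 - R) * h₂ ((1 - v) / 2) := by
      rw [h₂, h₂, ← mul_div_assoc, sub_le_iff_le_add, ← add_div, le_div_iff₀ hlog2]
      linarith
    have h3 : 0 ≤ h₂ ((1 - v) / 2) :=
      div_nonneg (Real.binEntropy_nonneg (by linarith) (by linarith)) hlog2.le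
    rw [hu, div_le_iff₀' hden]
    exact h2.trans (mul_le_mul_of_nonneg_right (by linarith) h3)
  have h4 := h₂Inv_le ⟨hu0, hu1.le⟩ ⟨by linarith, by linarith⟩ hkey
  have h5 := h₂Inv_lt_half ⟨hu0, hu1⟩
  have hlogg : 0 < Real.log (1 / g) := Real.log_pos (one_lt_one_div hg0 hg1)
  rw [degreeBound, ← hu, div_le_iff₀ hlogg]
  have h6 : Real.log v ≤ Real.log (1 - 2 * h₂Inv u) := Real.log_le_log hv0 (by linarith)
  rw [hv, Real.log_sqrt (Real.rpow_nonneg hg0.le a), Real.log_rpow hg0] at h6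
  rw [one_div, one_div, Real.log_inv, Real.log_inv]
  linarith

theorem degreeBoundBEC_le_avgRightDegree {p : ℝ} (hp : p ∈ Set.Icc (0 : ℝ) 1) (h0 : 0 < p)
    (h1 : p < 1) {ε : ℝ} (hε0 : 0 < ε) (hε1 : ε < 1) (hn : 0 < n)
    (hH : IsFullRankParityCheck 𝒞 H)
    (D : Kernel (Fin n → BECOutput) (Fin n → BECOutput)) [IsMarkovKernel D]
    (hR : (1 - ε) * (bec p hp).capacity ≤ codeRate 𝒞) (hD : IsErrorless p hp 𝒞 D) :
    degreeBoundBEC p ε (erasureProb p hp 𝒞 D) ≤ avgRightDegree H := by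
  have hmain := le_erasureProb hp h0 h1 hn hH D hD
  have hC := one_sub_le_capacity_bec hp h1
  have hR' : (1 - ε) * (1 - p) ≤ codeRate 𝒞 :=
    (mul_le_mul_of_nonneg_left hC (by linarith)).trans hR
  have hPb0 : 0 ≤ erasureProb p hp 𝒞 D := by
    unfold erasureProb
    positivity
  set Pb := erasureProb p hp 𝒞 D
  set a := avgRightDegree H
  set R := codeRate 𝒞
  have ha : 0 ≤ a := avgRightDegree_nonneg H
  have hp' : 0 < 1 - p := by linarith
  have hs0 : 0 < (1 - p) ^ a := Real.rpow_pos_of_pos hp' a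
  have hs1 : (1 - p) ^ a ≤ 1 := Real.rpow_le_one hp'.le (by linarith) ha
  set s := (1 - p) ^ a with hs
  have hden : 0 < (1 - p) * ε + Pb := by positivity
  have hlog : 0 < Real.log (1 / (1 - p)) := Real.log_pos (one_lt_one_div hp' (by linarith))
  have h2 : 1 + (p - Pb) / ((1 - p) * ε + Pb) ≤ s⁻¹ := by
    rw [one_add_div hden.ne', div_le_iff₀ hden, inv_mul_eq_div, le_div_iff₀ hs0]
    -- 1 - (1-ε)(1-p) = p + (1-p)ε is also the numerator once the left side of `h2` is put over one
    -- denominator.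
    have h3 : (1 - R) * (1 - s) ≤ (1 - (1 - ε) * (1 - p)) * (1 - s) :=
      mul_le_mul_of_nonneg_right (by linarith) (by linarith)
    linarith
  have h3 : 0 < 1 + (p - Pb) / ((1 - p) * ε + Pb) := by
    rw [one_add_div hden.ne']
    refine div_pos ?_ hden
    have := mul_pos hp' hε0
    linarith
  have h4 := Real.log_le_log h3 h2
  rw [Real.log_inv, hs, Real.log_rpow hp'] at h4
  rw [degreeBoundBEC, div_le_iff₀ hlog, one_div (1 - p), Real.log_inv]
  linarith

/-- The logarithmic lower bound on the number of fundamental cycles for a family of codes whose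
rates `R` and right degrees `a` satisfy `R ≤ C + K ε` and `(1 - R) g ^ a ≤ A ε`. -/
theorem exists_log_bound {C g : ℝ} (hC1 : C < 1) (hg0 : 0 < g) (hg1 : g < 1)
    {A K : ℝ} (hA : 0 < A) (hK : 0 < K) :
    ∃ c > (0 : ℝ), ∃ δ > (0 : ℝ), δ ≤ 1 ∧ ∀ (ε : ℝ) (n : ℕ) (R a N : ℝ), 0 < ε → ε ≤ δ →
      0 ≤ a → R ≤ C + K * ε → (1 - R) * g ^ a ≤ A * ε →
      (n : ℝ) * ((1 - R) * (a - 1) - 1) ≤ N → 0 ≤ R →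
      0 ≤ c * n * Real.log (1 / ε) ∧ c * n * Real.log (1 / ε) ≤ N := by
  have hlg : 0 < Real.log (1 / g) := Real.log_pos (one_lt_one_div hg0 hg1)
  -- `b` bounds 1 - R from below once Kε ≤ (1-C)/2. Then a ≥ (ln(1/ε) - ln(A/b))/ln(1/g), and `c` is
  -- half the resulting coefficient of ln(1/ε).
  set b := (1 - C) / 2 with hb
  have hb0 : 0 < b := by linarith
  set c := b / (2 * Real.log (1 / g)) with hc
  have hc0 : 0 < c := by positivity
  -- The 2 absorbs -(1-R) - 1 ≥ -2. The last term in δ ensures B ≤ c ln(1/ε), so the spare half of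
  -- the coefficient pays for all constants.
  set B := b * Real.log (A / b) / Real.log (1 / g) + 2 with hB
  refine ⟨c, hc0, min 1 (min (b / K) (Real.exp (-(B / c)))),
    lt_min one_pos (lt_min (div_pos hb0 hK) (Real.exp_pos _)), min_le_left _ _, ?_⟩
  intro ε n R a N hε hεδ ha hR hs hN hR0
  have hε1 : ε ≤ 1 := hεδ.trans (min_le_left _ _)
  have hε2 : ε ≤ b / K := hεδ.trans ((min_le_right _ _).trans (min_le_left _ _))
  have hε3 : ε ≤ Real.exp (-(B / c)) := hεδ.trans ((min_le_right _ _).trans (min_le_right _ _))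
  have hn : (0 : ℝ) ≤ n := Nat.cast_nonneg n
  have hL : 0 ≤ Real.log (1 / ε) := Real.log_nonneg (one_le_one_div hε hε1)
  refine ⟨by positivity, le_trans ?_ hN⟩
  have hRb : b ≤ 1 - R := by
    rw [le_div_iff₀ hK] at hε2
    linarith
  have hLB : B ≤ c * Real.log (1 / ε) := by
    have h1 := Real.log_le_log hε hε3
    rw [Real.log_exp] at h1
    rw [one_div, Real.log_inv, ← div_le_iff₀' hc0]
    linarith
  have hga : 0 < g ^ a := Real.rpow_pos_of_pos hg0 a
  have h2 : g ^ a ≤ A / b * ε := by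
    rw [div_mul_eq_mul_div, le_div_iff₀' hb0]
    exact (mul_le_mul_of_nonneg_right hRb hga.le).trans hs
  have h3 := Real.log_le_log hga h2
  rw [Real.log_rpow hg0, Real.log_mul (by positivity) hε.ne'] at h3
  have h4 : Real.log (1 / ε) - Real.log (A / b) ≤ a * Real.log (1 / g) := by
    rw [one_div, one_div, Real.log_inv, Real.log_inv]
    linarith
  have h5 : 2 * c * Real.log (1 / ε) - (B - 2) ≤ b * a := by
    have h6 : 2 * c * Real.log (1 / ε) - (B - 2) =
        b * ((Real.log (1 / ε) - Real.log (A / b)) / Real.log (1 / g)) := by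
      rw [hB, hc]
      field_simp
      ring
    rw [h6]
    exact mul_le_mul_of_nonneg_left ((div_le_iff₀ hlg).2 h4) hb0.le
  have h7 : b * a ≤ (1 - R) * a := mul_le_mul_of_nonneg_right hRb ha
  calc c * n * Real.log (1 / ε) = n * (c * Real.log (1 / ε)) := by ring
    _ ≤ _ := mul_le_mul_of_nonneg_left (by linarith) hn

end Bounds

/-! ### Logarithmic growth and the final assembly. -/

section Cycles

variable {n m : ℕ} {𝒞 : Submodule (ZMod 2) (Fin n → ZMod 2)}
  {H : Matrix (Fin m) (Fin n) (ZMod 2)}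

theorem codeRate_nonneg (𝒞 : Submodule (ZMod 2) (Fin n → ZMod 2)) : 0 ≤ codeRate 𝒞 := by
  unfold codeRate
  positivity

theorem MBIOSChannel.g₁_mem_Ioo {𝒴 : Type*} [MeasurableSpace 𝒴] (W : MBIOSChannel 𝒴)
    (hC0 : 0 < W.capacity) (hC1 : W.capacity < 1) : W.g₁ ∈ Set.Ioo (0 : ℝ) 1 := by
  obtain ⟨ν, t, h⟩ := W.exists_isBias
  rw [h.g₁_eq]
  exact ⟨h.integral_sq_pos hC0, h.integral_sq_lt_one hC1⟩

/-- The bound φ(s) ≥ s/2 linearises the trade-off, avoiding the inverse entropy. Dropping the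
non-negative degree term bounds the rate; inserting R - C ≥ -εC bounds the degree term. -/
theorem MBIOSChannel.rate_and_degree_le {𝒴 : Type*} [MeasurableSpace 𝒴] (W : MBIOSChannel 𝒴)
    (hC0 : 0 < W.capacity) (hC1 : W.capacity < 1) {K ε : ℝ} (hn : 0 < n)
    (hH : IsFullRankParityCheck 𝒞 H) (D : Kernel (Fin n → 𝒴) (Fin n → ZMod 2))
    [IsMarkovKernel D] (hR : (1 - ε) * W.capacity ≤ codeRate 𝒞)
    (hPb : h₂ (W.bitErrorProb 𝒞 D) ≤ K * ε) :
    codeRate 𝒞 ≤ W.capacity + K * ε ∧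
      (1 - codeRate 𝒞) * W.g₁ ^ avgRightDegree H ≤ 2 * Real.log 2 * (K + W.capacity) * ε := by
  obtain ⟨hg0, hg1, hmain⟩ := W.entropyDeficit_rpow_le hC0 hC1 hn hH D
  have hlog2 : 0 < Real.log 2 := Real.log_pos one_lt_two
  have hR1 := hH.one_sub_codeRate_nonneg hn
  have ha := avgRightDegree_nonneg H
  have hs : W.g₁ ^ avgRightDegree H ∈ Set.Icc (0 : ℝ) 1 :=
    ⟨Real.rpow_nonneg hg0.le _, Real.rpow_le_one hg0.le hg1.le ha⟩
  have h1 := mul_le_mul_of_nonneg_left (half_le_entropyDeficit hs) hR1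
  have h2 : 0 ≤ (1 - codeRate 𝒞) * W.g₁ ^ avgRightDegree H := mul_nonneg hR1 hs.1
  rw [h₂, div_le_iff₀ hlog2] at hPb
  have h3 : (codeRate 𝒞 - W.capacity) * Real.log 2 +
      (1 - codeRate 𝒞) * W.g₁ ^ avgRightDegree H / 2 ≤ K * ε * Real.log 2 := by linarith
  constructor
  · have h4 : (codeRate 𝒞 - W.capacity) * Real.log 2 ≤ K * ε * Real.log 2 := by linarith
    linarith [le_of_mul_le_mul_right h4 hlog2]
  · have h5 : -(ε * W.capacity) * Real.log 2 ≤ (codeRate 𝒞 - W.capacity) * Real.log 2 :=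
      mul_le_mul_of_nonneg_right (by linarith) hlog2.le
    linarith

theorem bec_rate_and_degree_le {p : ℝ} (hp : p ∈ Set.Icc (0 : ℝ) 1) (h0 : 0 < p) (h1 : p < 1)
    {K ε : ℝ} (hε1 : ε ≤ 1) (hn : 0 < n) (hH : IsFullRankParityCheck 𝒞 H)
    (D : Kernel (Fin n → BECOutput) (Fin n → BECOutput)) [IsMarkovKernel D]
    (hR : (1 - ε) * (bec p hp).capacity ≤ codeRate 𝒞) (hD : IsErrorless p hp 𝒞 D)
    (hPb : erasureProb p hp 𝒞 D ≤ K * ε) :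
    codeRate 𝒞 ≤ 1 - p + K * ε ∧
      (1 - codeRate 𝒞) * (1 - p) ^ avgRightDegree H ≤ (K + (1 - p)) * ε := by
  have hmain := le_erasureProb hp h0 h1 hn hH D hD
  have hR' : (1 - ε) * (1 - p) ≤ codeRate 𝒞 :=
    (mul_le_mul_of_nonneg_left (one_sub_le_capacity_bec hp h1) (by linarith)).trans hR
  have h2 : 0 ≤ (1 - codeRate 𝒞) * (1 - p) ^ avgRightDegree H :=
    mul_nonneg (hH.one_sub_codeRate_nonneg hn) (Real.rpow_nonneg (by linarith) _)
  constructor <;> linarith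

end Cycles

theorem corollary1 :
    -- the cardinality is the cycle rank `|E| - |V| + C(G)`, and exceeds `n[(1-R)(a_R-1)-1]`
    (∀ (n m : ℕ) (𝒞 : Submodule (ZMod 2) (Fin n → ZMod 2)) (H : Matrix (Fin m) (Fin n) (ZMod 2))
        (F : SimpleGraph (Fin n ⊕ Fin m)),
      0 < n → IsFullRankParityCheck 𝒞 H → IsFullSpanningForest (tannerGraph H) F →
      (fundamentalSystem (tannerGraph H) F).ncard = cycleRank (tannerGraph H) ∧
      (cycleRank (tannerGraph H) : ℤ) =
        (tannerGraph H).edgeSet.ncard - Fintype.card (Fin n ⊕ Fin m) +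
          numComponents (tannerGraph H) ∧
      (n : ℝ) * ((1 - codeRate 𝒞) * (avgRightDegree H - 1) - 1) <
        (fundamentalSystem (tannerGraph H) F).ncard) ∧
    -- the lower bound with `a_R` replaced, for a general MBIOS channel
    (∀ (𝒴 : Type*) [MeasurableSpace 𝒴] (W : MBIOSChannel 𝒴),
      0 < W.capacity → W.capacity < 1 →
      ∀ (ε : ℝ) (n m : ℕ) (𝒞 : Submodule (ZMod 2) (Fin n → ZMod 2))
        (H : Matrix (Fin m) (Fin n) (ZMod 2)) (F : SimpleGraph (Fin n ⊕ Fin m))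
        (D : Kernel (Fin n → 𝒴) (Fin n → ZMod 2)) [IsMarkovKernel D],
      0 < ε → ε < 1 → 0 < n →
      IsFullRankParityCheck 𝒞 H → IsFullSpanningForest (tannerGraph H) F →
      (1 - ε) * W.capacity ≤ codeRate 𝒞 →
      h₂ (W.bitErrorProb 𝒞 D) ≤ 1 - W.capacity →
      (n : ℝ) * ((1 - codeRate 𝒞) *
          (degreeBound W.capacity W.g₁ ε (W.bitErrorProb 𝒞 D) - 1) - 1) <
        (fundamentalSystem (tannerGraph H) F).ncard) ∧
    -- the lower bound with `a_R` replaced, for the BEC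
    (∀ (p : ℝ) (h0 : 0 < p) (h1 : p < 1)
        (ε : ℝ) (n m : ℕ) (𝒞 : Submodule (ZMod 2) (Fin n → ZMod 2))
        (H : Matrix (Fin m) (Fin n) (ZMod 2)) (F : SimpleGraph (Fin n ⊕ Fin m))
        (D : Kernel (Fin n → BECOutput) (Fin n → BECOutput)) [IsMarkovKernel D],
      0 < ε → ε < 1 → 0 < n →
      IsFullRankParityCheck 𝒞 H → IsFullSpanningForest (tannerGraph H) F →
      (1 - ε) * (bec p ⟨h0.le, h1.le⟩).capacity ≤ codeRate 𝒞 →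
      IsErrorless p ⟨h0.le, h1.le⟩ 𝒞 D →
      (n : ℝ) * ((1 - codeRate 𝒞) *
          (degreeBoundBEC p ε (erasureProb p ⟨h0.le, h1.le⟩ 𝒞 D) - 1) - 1) <
        (fundamentalSystem (tannerGraph H) F).ncard) ∧
    -- the order `Ω(ln(1/ε))`, for a general MBIOS channel
    (∀ (𝒴 : Type*) [MeasurableSpace 𝒴] (W : MBIOSChannel 𝒴),
      0 < W.capacity → W.capacity < 1 → ∀ K : ℝ, 0 < K →
      ∃ c > (0 : ℝ), ∃ δ > (0 : ℝ),
      ∀ (ε : ℝ) (n m : ℕ) (𝒞 : Submodule (ZMod 2) (Fin n → ZMod 2))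
        (H : Matrix (Fin m) (Fin n) (ZMod 2)) (F : SimpleGraph (Fin n ⊕ Fin m))
        (D : Kernel (Fin n → 𝒴) (Fin n → ZMod 2)) [IsMarkovKernel D],
      0 < ε → ε ≤ δ → 0 < n →
      IsFullRankParityCheck 𝒞 H → IsFullSpanningForest (tannerGraph H) F →
      (1 - ε) * W.capacity ≤ codeRate 𝒞 →
      h₂ (W.bitErrorProb 𝒞 D) ≤ K * ε →
      0 ≤ c * n * Real.log (1 / ε) ∧
      c * n * Real.log (1 / ε) ≤ (fundamentalSystem (tannerGraph H) F).ncard) ∧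
    -- the order `Ω(ln(1/ε))`, for the BEC
    (∀ (p : ℝ) (h0 : 0 < p) (h1 : p < 1) (K : ℝ), 0 < K →
      ∃ c > (0 : ℝ), ∃ δ > (0 : ℝ),
      ∀ (ε : ℝ) (n m : ℕ) (𝒞 : Submodule (ZMod 2) (Fin n → ZMod 2))
        (H : Matrix (Fin m) (Fin n) (ZMod 2)) (F : SimpleGraph (Fin n ⊕ Fin m))
        (D : Kernel (Fin n → BECOutput) (Fin n → BECOutput)) [IsMarkovKernel D],
      0 < ε → ε ≤ δ → 0 < n →
      IsFullRankParityCheck 𝒞 H → IsFullSpanningForest (tannerGraph H) F →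
      (1 - ε) * (bec p ⟨h0.le, h1.le⟩).capacity ≤ codeRate 𝒞 →
      IsErrorless p ⟨h0.le, h1.le⟩ 𝒞 D →
      erasureProb p ⟨h0.le, h1.le⟩ 𝒞 D ≤ K * ε →
      0 ≤ c * n * Real.log (1 / ε) ∧
      c * n * Real.log (1 / ε) ≤ (fundamentalSystem (tannerGraph H) F).ncard) := by
  refine ⟨?_, ?_, ?_, ?_, ?_⟩
  · intro n m 𝒞 H F hn hH hF
    refine ⟨hF.ncard_fundamentalSystem, ?_, lt_ncard_fundamentalSystem hn hH hF fun _ => le_rfl⟩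
    have h := cycleRank_add_card (tannerGraph H)
    rw [Nat.card_eq_fintype_card] at h
    omega
  · intro 𝒴 _ W hC0 hC1 ε n m 𝒞 H F D _ hε0 _ hn hH hF hR hPb
    exact lt_ncard_fundamentalSystem hn hH hF fun hm =>
      degreeBound_le_avgRightDegree W hC0 hC1 hε0 hn hm hH D hR hPb
  · intro p h0 h1 ε n m 𝒞 H F D _ hε0 hε1 hn hH hF hR hD
    exact lt_ncard_fundamentalSystem hn hH hF fun _ =>
      degreeBoundBEC_le_avgRightDegree _ h0 h1 hε0 hε1 hn hH D hR hD
  · intro 𝒴 _ W hC0 hC1 K hK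
    obtain ⟨hg0, hg1⟩ := W.g₁_mem_Ioo hC0 hC1
    have hA : 0 < 2 * Real.log 2 * (K + W.capacity) := by
      have := Real.log_pos one_lt_two
      positivity
    obtain ⟨c, hc, δ, hδ, -, h⟩ := exists_log_bound hC1 hg0 hg1 hA hK
    refine ⟨c, hc, δ, hδ, fun ε n m 𝒞 H F D _ hε0 hεδ hn hH hF hR hPb => ?_⟩
    obtain ⟨h1, h2⟩ := W.rate_and_degree_le hC0 hC1 hn hH D hR hPb
    exact h ε n _ _ _ hε0 hεδ (avgRightDegree_nonneg H) h1 h2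
      (lt_ncard_fundamentalSystem hn hH hF fun _ => le_rfl).le (codeRate_nonneg 𝒞)
  · intro p h0 h1 K hK
    -- The erasure trade-off decays like (1-p)^a_R, so 1-p serves as both `C` and `g`. The bound δ ≤
    -- 1 keeps 1 - ε ≥ 0 when C is replaced by 1 - p.
    obtain ⟨c, hc, δ, hδ, hδ1, h⟩ := exists_log_bound (C := 1 - p) (g := 1 - p) (by linarith)
      (by linarith) (by linarith) (by linarith : 0 < K + (1 - p)) hK
    refine ⟨c, hc, δ, hδ, fun ε n m 𝒞 H F D _ hε0 hεδ hn hH hF hR hD hPb => ?_⟩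
    obtain ⟨h2, h3⟩ := bec_rate_and_degree_le _ h0 h1 (hεδ.trans hδ1) hn hH D hR hD hPb
    exact h ε n _ _ _ hε0 hεδ (avgRightDegree_nonneg H) h2 h3
      (lt_ncard_fundamentalSystem hn hH hF fun _ => le_rfl).le (codeRate_nonneg 𝒞)
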